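/- **Setting.** Let $f$ be a meromorphic function on $\mathbb C$ of finite order, and let $n_\rho\in\mathbb Z$ be the multiplicity of $\rho$ in the divisor of $f$ (positive for zeros, negative for poles, $0$ otherwise). The convergence exponent $d$ of $f$ is the least integer $d\ge 0$ with $\sum_{\rho\ne 0}|n_\rho|\,|\rho|^{-d}<\infty$. For $d\geq 1$ put $m=d-1$ and $E_m(z)=(1-z)e^{z+z^2/2+\dots+z^m/m}$. For $\sigma\in\mathbb C$ let $Q_{f,\sigma}$ be the polynomial (unique up to an additive constant in $2\pi i\mathbb Z$) of the Hadamard factorization $$f(s)=(s-\sigma)^{n_\sigma}e^{Q_{f,\sigma}(s)}\prod_{\rho\neq\sigma}E_m\Big(\frac{s-\sigma}{\rho-\sigma}\Big)^{n_\rho},$$ let $g=\max(\deg Q_{f,0},m)$ be the genus of $f$, and let $P_{f,\sigma}(s)=-Q_{f,\sigma}'(s)=c_0(\sigma)+c_1(\sigma)s+\dots+c_{g-1}(\sigma)s^{g-1}$ be the discrepancy polynomial. When the divisor of $f$ is contained in a left half plane and $d\ge1$, the Newton–Cramer distribution of $f$ with parameter $\sigma$ is the distribution on $\mathbb R$ $$W_\sigma(f)=e^{\sigma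 t}\frac{D^d}{Dt^d}\Big(\big(K(t)-K(0)\big)\mathbf 1_{[0,\infty)}(t)\Big),\qquad K(t)=n_\sigma\frac{t^d}{d!}+\sum_{\rho\ne\sigma}\frac{n_\rho}{(\rho-\sigma)^d}e^{(\rho-\sigma)t}\quad(t\ge 0),$$ and the symmetric Newton–Cramer distribution (formally $\sum_\rho n_\rho e^{\rho|t|}$) is $$\widehat W_\sigma(f)(t)=W_\sigma(f)(t)+W_\sigma(f)(-t).$$ If $F$ is holomorphic on a half plane $\Re s>\sigma_2>0$ and $|F(s)|\le C|s|^{m_0-2}$ there, its inverse Laplace transform is the distribution $$\mathcal L^{-1}(F)=\frac{D^{m_0}}{Dt^{m_0}}L,\qquad L(t)=\frac1{2\pi}\int_{-\infty}^{+\infty}\frac{F(c+iu)}{(c+iu)^{m_0}}e^{(c+iu)t}\,du\qquad(c>\sigma_2).$$ **Theorem.** 1. (General case.) Let $f$ be a meromorphic function on $\mathbb C$ of finite order with convergence exponent $d\geq 1$, whose divisor is contained in a left half plane. Then the Hadamard factorizations above exist, $F=f'/f$ satisfies the growth hypothesis above for some $m_0$ and $\sigma_2$, and for every $\sigma\in\mathbb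 C$ (and every admissible choice of $m_0$, $\sigma_2$ and $c$) one has, as distributions on $\mathbb R$, $$\widehat W_\sigma(f)=2\sum_{0\le l\le\frac{g-1}2}c_{2l}(\sigma)\,\delta_0^{(2l)}+\Big(\mathcal L^{-1}(f'/f)(t)+\mathcal L^{-1}(f'/f)(-t)\Big).$$ 2. (Dirichlet series.) Let $f$ be a meromorphic function on $\mathbb C$ of finite order that is given on some half plane $\Re s>\bar\sigma$ by a non-constant Dirichlet series $$f(s)=1+\sum_{n\ge1}a_ne^{-\lambda_ns},\qquad \sum_{n\ge 1}|a_n|e^{-\lambda_n\bar\sigma}<\infty,$$ with $a_n\in\mathbb C$ and $0<\lambda_1<\lambda_2<\cdots\to+\infty$ (some $a_n$ may vanish, so that finite sums are included). Let $\Lambda$ be the set of non-zero sequences $\mathbf k=(k_n)_{n\ge1}$ of non-negative integers with finite support. For $\mathbf k\in\Lambda$ put $\langle\lambda,\mathbf k\rangle=\sum_n\lambda_nk_n$, $\|\mathbf k\|=\sum_nk_n$ and $$b_{\mathbf k}=\frac{(-1)^{\|\mathbf k\|}}{\|\mathbf k\|}\,\frac{\|\mathbf k\|!}{\prod_jk_j!}\prod_ja_j^{k_j},$$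 so that $-\log f(s)=\sum_{\mathbf k\in\Lambda}b_{\mathbf k}e^{-\langle\lambda,\mathbf k\rangle s}$ for $\Re s$ large; for $\mathbf k\in-\Lambda$ put $\langle\lambda,\mathbf k\rangle=\sum_n\lambda_nk_n$ and $|\mathbf k|=-\mathbf k$, and for $\mathbf k\in\Lambda$ put $|\mathbf k|=\mathbf k$. Then the Hadamard factorizations above exist, the sum over $\Lambda\cup(-\Lambda)$ below converges unconditionally in the space of distributions on $\mathbb R$, and for every $\sigma\in\mathbb C$ one has, as distributions on $\mathbb R$, $$\widehat W_\sigma(f)=2\sum_{0\le l\le\frac{g-1}2}c_{2l}(\sigma)\,\delta_0^{(2l)}+\sum_{\mathbf k\in\Lambda\cup(-\Lambda)}\langle\lambda,|\mathbf k|\rangle\,b_{|\mathbf k|}\,\delta_{\langle\lambda,\mathbf k\rangle}.$$ -/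

import Mathlib

open scoped Pointwise

namespace PoissonNewton

noncomputable section

open Filter Topology MeasureTheory TopologicalSpace
open scoped Distributions ContDiff

/-! ### Meromorphic functions of finite order and their divisors -/

/-- The multiplicity `n_ρ` of `ρ` in the divisor of `f`: positive at zeros, negative at poles,
and `0` elsewhere. -/
def mult (f : ℂ → ℂ) (ρ : ℂ) : ℤ := MeromorphicOn.divisor f Set.univ ρ

/-- A meromorphic function on `ℂ`. It is represented by its normal form, which is continuous off
the poles and has the value `0` at the poles; every meromorphic function has exactly one such
representative. -/
def IsMeromorphic (f : ℂ → ℂ) : Prop := MeromorphicNFOn f Set.univ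

/-- `f` is of finite order: its Nevanlinna characteristic satisfies `T(r, f) = O(r ^ A)`
as `r → ∞`, for some `A`. -/
def HasFiniteOrder (f : ℂ → ℂ) : Prop :=
  ∃ A : ℝ, ValueDistribution.characteristic f ⊤ =O[atTop] fun r : ℝ ↦ r ^ A

/-- The convergence exponent of `f`: the least integer `d ≥ 0` such that
`∑_{ρ ≠ 0} |n_ρ| |ρ|^{-d} < ∞`. -/
def convExponent (f : ℂ → ℂ) : ℕ :=
  sInf {d : ℕ | Summable fun ρ : {ρ : ℂ // ρ ≠ 0} ↦ |(mult f ρ : ℝ)| / ‖(ρ : ℂ)‖ ^ d}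

/-- The divisor of `f` is contained in a left half plane. -/
def DivisorInLeftHalfPlane (f : ℂ → ℂ) : Prop :=
  ∃ σ₁ : ℝ, ∀ ρ : ℂ, mult f ρ ≠ 0 → ρ.re ≤ σ₁

/-! ### Hadamard factorization, genus and discrepancy polynomial -/

/-- The elementary factor `E_m(z) = (1 - z) exp (z + z^2/2 + ⋯ + z^m/m)`. -/
def elemFactor (m : ℕ) (z : ℂ) : ℂ :=
  (1 - z) * Complex.exp (∑ j ∈ Finset.Icc 1 m, z ^ j / j)

/-- `Q` is a polynomial `Q_{f,σ}` of the Hadamard factorization of `f` centred at `σ`,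
`f(s) = (s - σ)^{n_σ} e^{Q(s)} ∏_{ρ ≠ σ} E_m((s - σ)/(ρ - σ))^{n_ρ}`, where `m = d - 1` and `d` is
the convergence exponent; the identity is required at the points `s` off the divisor. -/
def IsHadamardPolynomial (f : ℂ → ℂ) (σ : ℂ) (Q : Polynomial ℂ) : Prop :=
  ∀ s : ℂ, mult f s = 0 →
    Multipliable (fun ρ : {ρ : ℂ // ρ ≠ σ} ↦
      elemFactor (convExponent f - 1) ((s - σ) / (ρ - σ)) ^ mult f ρ) ∧
    f s = (s - σ) ^ mult f σ * Complex.exp (Q.eval s) *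
      ∏' ρ : {ρ : ℂ // ρ ≠ σ},
        elemFactor (convExponent f - 1) ((s - σ) / (ρ - σ)) ^ mult f ρ

open Classical in
/-- The polynomial `Q_{f,σ}` of the Hadamard factorization centred at `σ`. It is determined up to
an additive constant in `2πiℤ`, and any choice is taken. -/
def hadamardPolynomial (f : ℂ → ℂ) (σ : ℂ) : Polynomial ℂ :=
  if h : ∃ Q, IsHadamardPolynomial f σ Q then h.choose else 0

/-- The genus `g = max (deg Q_f, m)`, where `Q_f = Q_{f,0}` and `m = d - 1`. -/
def genus (f : ℂ → ℂ) : ℕ := max (hadamardPolynomial f 0).natDegree (convExponent f - 1)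

/-- The discrepancy polynomial `P_{f,σ} = - Q_{f,σ}'`. -/
def discrepancyPolynomial (f : ℂ → ℂ) (σ : ℂ) : Polynomial ℂ :=
  -Polynomial.derivative (hadamardPolynomial f σ)

/-! ### Complex distributions on the real line -/

/-- Complex-valued distributions on `ℝ`. As in Mathlib, they are tested on real-valued test
functions. -/
abbrev Distr : Type := 𝓓'((⊤ : Opens ℝ), ℂ)

/-- Real-valued test functions on `ℝ`. -/
abbrev Test : Type := 𝓓((⊤ : Opens ℝ), ℝ)

/-- The distribution `φ ↦ ∫ φ(t) u(t) dt` of a locally integrable function `u`. -/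
def ofFun (u : ℝ → ℂ) : Distr :=
  (TestFunction.integralAgainstBilinCLM (ContinuousLinearMap.lsmul ℝ ℝ) volume u :
    Test →L[ℝ] ℂ)

/-- The `j`-th distributional derivative. -/
def distDeriv (j : ℕ) (T : Distr) : Distr := (fun S : Distr ↦ LineDeriv.lineDerivOp (1 : ℝ) S)^[j] T

/-- The Dirac mass `δ_x`. -/
def dirac (x : ℝ) : Distr := Distribution.mapCLM Complex.ofRealCLM (Distribution.delta x)

/-- Multiplication of test functions by a smooth real function. -/
def testMul (g : ℝ → ℝ) (hg : ContDiff ℝ ∞ g) : Test →L[ℝ] Test :=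
  TestFunction.limitCLM ℝ
    (fun φ ↦ ⟨fun t ↦ φ t * g t, φ.contDiff.mul hg, φ.hasCompactSupport.mul_right,
      Set.subset_univ _⟩)
    (fun _ hK ↦ TestFunction.ofSupportedInCLM ℝ hK ∘L
      ContDiffMapSupportedIn.bilinLeftCLM (ContinuousLinearMap.mul ℝ ℝ) hg)
    (fun _ _ _ ↦ by ext; simp)

/-- Composition of test functions with `t ↦ -t`. -/
def testReflect : Test →L[ℝ] Test :=
  TestFunction.limitCLM ℝ
    (fun φ ↦ ⟨fun t ↦ φ (-t), φ.contDiff.comp contDiff_neg,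
      φ.hasCompactSupport.comp_homeomorph (Homeomorph.neg ℝ), Set.subset_univ _⟩)
    (fun K _ ↦ TestFunction.ofSupportedInCLM ℝ (Set.subset_univ _) ∘L
      ContDiffMapSupportedIn.mkCLM ℝ (K₂ := K.map (fun t : ℝ ↦ -t) continuous_neg)
        (fun φ t ↦ φ (-t)) (fun _ _ _ ↦ rfl) (fun _ _ _ ↦ rfl)
        (fun φ ↦ φ.contDiff.comp contDiff_neg)
        (fun φ t ht ↦ φ.zero_on_compl fun h ↦ ht ⟨-t, h, neg_neg t⟩)
        (fun i hi ↦ ⟨{i}, 1, zero_le_one, fun φ t _ ↦ by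
          have h := (LinearIsometryEquiv.neg ℝ (E := ℝ)).norm_iteratedFDeriv_comp_right
            (𝕜 := ℝ) φ t i
          have h' := ContDiffMapSupportedIn.norm_iteratedFDeriv_apply_le_seminorm ℝ hi
            (f := φ) (x := -t)
          rw [one_mul, Finset.sup_singleton]
          exact (le_of_eq h).trans h'⟩))
    (fun _ _ _ ↦ rfl)

theorem contDiff_exp_mul (σ : ℂ) : ContDiff ℝ ∞ fun t : ℝ ↦ Complex.exp (σ * t) :=
  (contDiff_const.mul Complex.ofRealCLM.contDiff).cexp

/-- The distribution `e^{σt} T`, that is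
`φ ↦ ⟨T, e^{σt} φ⟩ = ⟨T, Re (e^{σt}) φ⟩ + i ⟨T, Im (e^{σt}) φ⟩`. -/
def expMul (σ : ℂ) (T : Distr) : Distr :=
  ContinuousLinearMap.precompCompactConvergenceCLM ℂ
      (testMul (fun t ↦ (Complex.exp (σ * t)).re)
        (Complex.reCLM.contDiff.comp (contDiff_exp_mul σ))) T +
    Complex.I • ContinuousLinearMap.precompCompactConvergenceCLM ℂ
      (testMul (fun t ↦ (Complex.exp (σ * t)).im)
        (Complex.imCLM.contDiff.comp (contDiff_exp_mul σ))) T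

/-- The distribution `T(-t)`, defined by `⟨T(-t), φ(t)⟩ = ⟨T(t), φ(-t)⟩`. -/
def reflect (T : Distr) : Distr :=
  ContinuousLinearMap.precompCompactConvergenceCLM ℂ testReflect T

/-! ### The Newton–Cramer distributions -/

/-- The function `K_{d,σ}(t) = n_σ t^d / d! + ∑_{ρ ≠ σ} n_ρ (ρ - σ)^{-d} e^{(ρ - σ) t}`, to be used
for `t ≥ 0`, where `d` is the convergence exponent of `f`. -/
def newtonCramerKernel (f : ℂ → ℂ) (σ : ℂ) (t : ℝ) : ℂ :=
  mult f σ * ((t : ℂ) ^ convExponent f / (convExponent f).factorial) +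
    ∑' ρ : {ρ : ℂ // ρ ≠ σ},
      mult f ρ / ((ρ : ℂ) - σ) ^ convExponent f * Complex.exp ((ρ - σ) * t)

/-- The Newton–Cramer distribution
`W_σ(f) = e^{σt} (D/Dt)^d ((K_{d,σ}(t) - K_{d,σ}(0)) 1_{[0,∞)}(t))`. -/
def newtonCramer (f : ℂ → ℂ) (σ : ℂ) : Distr :=
  expMul σ (distDeriv (convExponent f) (ofFun (Set.indicator (Set.Ici 0) fun t ↦
    newtonCramerKernel f σ t - newtonCramerKernel f σ 0)))

/-- The symmetric Newton–Cramer distribution `Ŵ_σ(f)(t) = W_σ(f)(t) + W_σ(f)(-t)`. -/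
def symNewtonCramer (f : ℂ → ℂ) (σ : ℂ) : Distr :=
  newtonCramer f σ + reflect (newtonCramer f σ)

/-! ### The inverse Laplace transform -/

/-- `F` is holomorphic on a half plane `Re s > σ₂`, where `0 < σ₂ < c`, and satisfies there
`|F(s)| ≤ C |s|^m / |s|^2`. -/
def LaplaceAdmissible (F : ℂ → ℂ) (m : ℕ) (c : ℝ) : Prop :=
  ∃ σ₂ C : ℝ, 0 < σ₂ ∧ σ₂ < c ∧ DifferentiableOn ℂ F {s | σ₂ < s.re} ∧
    ∀ s : ℂ, σ₂ < s.re → ‖F s‖ ≤ C * ‖s‖ ^ m / ‖s‖ ^ 2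

/-- The inverse Laplace transform `𝓛⁻¹(F) = (D/Dt)^m L` of a function `F` of polynomial growth on
a right half plane, where
`L(t) = (1/2π) ∫_ℝ F(c + iu) (c + iu)^{-m} e^{(c + iu) t} du`.
It is used only for `m` and `c` that are admissible for `F`. -/
def invLaplace (F : ℂ → ℂ) (m : ℕ) (c : ℝ) : Distr :=
  distDeriv m (ofFun fun t ↦ (1 / (2 * Real.pi) : ℂ) *
    ∫ u : ℝ, F (c + Complex.I * u) / (c + Complex.I * u) ^ m *
      Complex.exp ((c + Complex.I * u) * t))

/-! ### Dirichlet series -/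

/-- `f(s) = 1 + ∑_n a_n e^{-λ_n s}` is a non-constant Dirichlet series that converges absolutely
on some half plane, with frequencies `0 < λ_0 < λ_1 < ⋯ → ∞`. Coefficients may vanish, so finite
Dirichlet series are included. -/
structure IsDirichletSeries (f : ℂ → ℂ) (a : ℕ → ℂ) (freq : ℕ → ℝ) : Prop where
  freq_pos : ∀ n, 0 < freq n
  freq_strictMono : StrictMono freq
  freq_tendsto : Tendsto freq atTop atTop
  nonconstant : ∃ n, a n ≠ 0
  eq_series : ∃ σbar : ℝ, (Summable fun n ↦ ‖a n‖ * Real.exp (-freq n * σbar)) ∧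
    ∀ s : ℂ, σbar < s.re → f s = 1 + ∑' n, a n * Complex.exp (-freq n * s)

/-- The index set `Λ` of non-zero, finitely supported sequences of non-negative integers. -/
def Lam : Set (ℕ →₀ ℤ) := {k | k ≠ 0 ∧ ∀ n, 0 ≤ k n}

/-- The pairing `⟨λ, k⟩ = ∑_n λ_n k_n`. -/
def pairing (freq : ℕ → ℝ) (k : ℕ →₀ ℤ) : ℝ := k.sum fun n j ↦ freq n * j

/-- The sequence `|k|`, equal to `k` for `k ∈ Λ` and to `-k` for `k ∈ -Λ`. -/
def absIndex (k : ℕ →₀ ℤ) : ℕ →₀ ℤ := k.mapRange (fun j ↦ |j|) abs_zero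

/-- For `k ∈ Λ`, the coefficient
`b_k = ((-1)^{‖k‖} / ‖k‖) (‖k‖! / ∏_j k_j!) ∏_j a_j^{k_j}`, where `‖k‖ = ∑_j k_j`, of
`e^{-⟨λ, k⟩ s}` in the expansion of `-log (1 + ∑_n a_n e^{-λ_n s})`. -/
def logCoeff (a : ℕ → ℂ) (k : ℕ →₀ ℤ) : ℂ :=
  let size : ℕ := k.sum fun _ j ↦ j.toNat
  (-1) ^ size / size * (size.factorial / k.prod fun _ j ↦ (j.toNat.factorial : ℂ)) *
    k.prod fun n j ↦ a n ^ j.toNat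

end

end PoissonNewton

open PoissonNewton

open scoped Pointwise
namespace PoissonNewton
noncomputable section
open Filter Topology MeasureTheory TopologicalSpace
open scoped Distributions ContDiff

/-! ### Elementary factors -/

/-! The formula is the inverse Laplace transform of the partial fraction expansion of `f'/f`. With
`d = m + 1`, logarithmic differentiation of the Hadamard product gives `f'/f - Q' = n_σ/(s-σ) + ∑
n_ρ (ρ-σ)^{-d} ((s-σ)^d/(s-ρ) - (s-σ)^m)`. The summand of index `ρ` is the Laplace transform of the
corresponding term of `W_σ(f)`: on `[0,∞)` the function `e^{(ρ-σ)t} - 1` is differentiated `d` times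
and multiplied by `e^{σt}`. Hence `W_σ(f)` has transform `f'/f + P`, where `P = -Q'`, and the
polynomial `P` contributes `∑ c_j δ^{(j)}`. Adding the reflection cancels the odd derivatives and
doubles the even ones.

All identities are checked against a test function `φ`: both sides become integrals over one
vertical line of a function times `∫ e^{st} φ(t) dt`, which decays faster than any power
(`newtonCramer_apply`, `invLaplace_apply`). Fourier inversion on that line is enough; no contour is
moved.

Two classical facts support this. The factorization (`exists_hadamard_factorization`) holds because
the quotient of `f` by its canonical products is `e^Q`, and the Nevanlinna characteristic bounds the
circle means of `(Re Q)⁺` polynomially, so that `Q` is a polynomial. The coefficients `c_j(σ)`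
vanish for `j ≥ g` (`discrepancyPolynomial_coeff_eq_zero`) because on the positive real axis `f'/f -
Q_{f,τ}'` is `o(x^m)` for every centre `τ`.

For a Dirichlet series, `f'/f = ∑ ⟨λ,k⟩ b_k e^{-⟨λ,k⟩s}` converges absolutely far to the right, and
each exponential inverts to a Dirac mass. Finite order makes the convergence exponent finite
(Jensen); it is not `0`, since otherwise `f'/f` would be rational and exponentially decreasing on
the real axis, hence zero. -/

lemma elemFactor_zero_right (m : ℕ) : elemFactor m 0 = 1 := by
  have : ∑ j ∈ Finset.Icc 1 m, (0 : ℂ) ^ j / j = 0 :=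
    Finset.sum_eq_zero fun j hj ↦ by
      rw [zero_pow (by have := (Finset.mem_Icc.1 hj).1; omega), zero_div]
  simp [elemFactor, this]

lemma elemFactor_eq_zero_iff {m : ℕ} {z : ℂ} : elemFactor m z = 0 ↔ z = 1 := by
  rw [elemFactor, mul_eq_zero, or_iff_left (Complex.exp_ne_zero _), sub_eq_zero, eq_comm]

/-- Identifies the exponent in `E_m` with a Taylor polynomial of the logarithm, so that the
remainder estimate for `log` bounds `E_m` near `0`. -/
lemma logTaylor_neg (m : ℕ) (z : ℂ) :
    Complex.logTaylor (m + 1) (-z) = -∑ j ∈ Finset.Icc 1 m, z ^ j / j := by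
  induction m with
  | zero => simp [Complex.logTaylor]
  | succ m ih =>
    rw [Complex.logTaylor_succ, Pi.add_apply, ih, Finset.sum_Icc_succ_top (by omega), neg_add]
    congr 1
    have : ((-1 : ℂ)) ^ (m + 1 + 1) * (-z) ^ (m + 1) = -z ^ (m + 1) := by
      rw [neg_pow z, pow_succ _ (m + 1), mul_assoc, mul_comm (-1 : ℂ), ← mul_assoc, ← mul_assoc,
        ← mul_pow]
      simp
    rw [this, neg_div]

/-- The exponent `w` is `log (1 - z)` minus its Taylor polynomial of degree `m`; for `‖z‖ ≤ 1/2` the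
factor `(1 - ‖z‖)⁻¹` in the remainder is at most `2`. -/
lemma exists_elemFactor_eq_exp (m : ℕ) {z : ℂ} (hz : ‖z‖ ≤ 1 / 2) :
    ∃ w, elemFactor m z = Complex.exp w ∧ ‖w‖ ≤ 2 * ‖z‖ ^ (m + 1) := by
  refine ⟨Complex.log (1 + -z) - Complex.logTaylor (m + 1) (-z), ?_, ?_⟩
  · have h1 : (1 : ℂ) + -z ≠ 0 := fun h ↦ by
      have : z = 1 := by linear_combination -h
      rw [this] at hz; norm_num at hz
    rw [logTaylor_neg, sub_neg_eq_add, Complex.exp_add, Complex.exp_log h1, elemFactor,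
      sub_eq_add_neg]
  · have h := Complex.norm_log_sub_logTaylor_le m (z := -z) (by rw [norm_neg]; linarith)
    rw [norm_neg] at h
    refine h.trans ?_
    have h2 : (1 - ‖z‖)⁻¹ ≤ 2 := by
      rw [inv_le_comm₀ (by linarith) (by norm_num)]; linarith
    have h3 : ‖z‖ ^ (m + 1) * (1 - ‖z‖)⁻¹ ≤ ‖z‖ ^ (m + 1) * 2 := by gcongr
    have h4 : (0 : ℝ) ≤ ‖z‖ ^ (m + 1) * (1 - ‖z‖)⁻¹ :=
      mul_nonneg (by positivity) (inv_nonneg.2 (by linarith))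
    refine (div_le_self h4 (by have := m.cast_nonneg (α := ℝ); linarith)).trans ?_
    linarith

/-- The growth constant of the elementary factor `E_m`. -/
def elemConst (m : ℕ) : ℝ := (m + 1) * 2 ^ (m + 1) + 2

lemma elemConst_nonneg (m : ℕ) : 0 ≤ elemConst m := by unfold elemConst; positivity

lemma norm_elemFactor_le (m : ℕ) (z : ℂ) :
    ‖elemFactor m z‖ ≤ Real.exp (elemConst m * ‖z‖ ^ (m + 1)) := by
  rcases le_total ‖z‖ (1 / 2) with hz | hz
  · obtain ⟨w, hw, hw2⟩ := exists_elemFactor_eq_exp m hz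
    rw [hw]
    refine (Complex.norm_exp_le_exp_norm w).trans (Real.exp_le_exp.2 (hw2.trans ?_))
    gcongr
    have : (0 : ℝ) ≤ (m + 1) * 2 ^ (m + 1) := by positivity
    unfold elemConst; linarith
  -- Since `2‖z‖ ≥ 1`, every power up to the `(m+1)`-st is absorbed by the top one. The factor `1 -
  -- z` costs one such term and the exponent `m`, whence `(m + 1) * 2 ^ (m + 1)` in `elemConst`; the
  -- summand `2` there serves small `z`.
  · have hpow : ∀ j ≤ m + 1, ‖z‖ ^ j ≤ 2 ^ (m + 1) * ‖z‖ ^ (m + 1) := by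
      intro j hj
      have h1 : (1 : ℝ) ≤ 2 * ‖z‖ := by linarith
      calc ‖z‖ ^ j ≤ (2 * ‖z‖) ^ j := by gcongr; linarith [norm_nonneg z]
        _ ≤ (2 * ‖z‖) ^ (m + 1) := pow_le_pow_right₀ h1 hj
        _ = _ := mul_pow _ _ _
    have h1 : ‖1 - z‖ ≤ Real.exp ‖z‖ := by
      refine (norm_sub_le _ _).trans ?_
      rw [norm_one, add_comm]; exact Real.add_one_le_exp _
    have h2 : ‖∑ j ∈ Finset.Icc 1 m, z ^ j / j‖ ≤ m * (2 ^ (m + 1) * ‖z‖ ^ (m + 1)) := by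
      refine (norm_sum_le _ _).trans ?_
      calc ∑ j ∈ Finset.Icc 1 m, ‖z ^ j / (j : ℂ)‖
          ≤ ∑ j ∈ Finset.Icc 1 m, 2 ^ (m + 1) * ‖z‖ ^ (m + 1) := by
            refine Finset.sum_le_sum fun j hj ↦ ?_
            have hj' := Finset.mem_Icc.1 hj
            rw [norm_div, norm_pow, Complex.norm_natCast]
            refine (div_le_self (by positivity) (by exact_mod_cast hj'.1)).trans (hpow j (by omega))
        _ = _ := by simp
    rw [elemFactor, norm_mul]
    calc _ ≤ Real.exp ‖z‖ * Real.exp (m * (2 ^ (m + 1) * ‖z‖ ^ (m + 1))) := by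
          gcongr
          exact (Complex.norm_exp_le_exp_norm _).trans (Real.exp_le_exp.2 h2)
      _ ≤ _ := by
          rw [← Real.exp_add, Real.exp_le_exp]
          have h3 := hpow 1 (by omega)
          have h4 : (0 : ℝ) ≤ ‖z‖ ^ (m + 1) := by positivity
          rw [pow_one] at h3
          unfold elemConst
          linarith

lemma differentiable_elemFactor (m : ℕ) : Differentiable ℂ (elemFactor m) := by
  unfold elemFactor; fun_prop

/-- The derivative of the exponent is the geometric sum `(x^m - 1)/(x - 1)`, and the factor `1 - x`
contributes `1/(x - 1)`. -/
lemma logDeriv_elemFactor (m : ℕ) {x : ℂ} (hx : x ≠ 1) :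
    logDeriv (elemFactor m) x = x ^ m / (x - 1) := by
  have h1 : (1 : ℂ) - x ≠ 0 := sub_ne_zero.2 hx.symm
  have h2 : x - 1 ≠ 0 := sub_ne_zero.2 hx
  have hs : HasDerivAt (fun z : ℂ ↦ ∑ j ∈ Finset.Icc 1 m, z ^ j / (j : ℂ))
      (∑ j ∈ Finset.Icc 1 m, x ^ (j - 1)) x := by
    refine HasDerivAt.fun_sum fun j hj ↦ ?_
    have hj : (j : ℂ) ≠ 0 := by
      have := (Finset.mem_Icc.1 hj).1
      exact_mod_cast (by omega : j ≠ 0)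
    have h := (hasDerivAt_pow j x).div_const (j : ℂ)
    rwa [mul_div_cancel_left₀ _ hj] at h
  have hsum : ∑ j ∈ Finset.Icc 1 m, x ^ (j - 1) = ∑ j ∈ Finset.range m, x ^ j := by
    rw [Finset.range_eq_Ico, Finset.sum_Ico_eq_sum_range, ← Finset.Ico_add_one_right_eq_Icc,
      Finset.sum_Ico_eq_sum_range]
    simp
  rw [hsum, geom_sum_eq hx] at hs
  have hd : HasDerivAt (elemFactor m) _ x :=
    ((hasDerivAt_const x (1 : ℂ)).sub (hasDerivAt_id x)).mul hs.cexp
  rw [logDeriv_apply, hd.deriv, elemFactor]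
  have := Complex.exp_ne_zero (∑ j ∈ Finset.Icc 1 m, x ^ j / (j : ℂ))
  simp only [Pi.sub_apply, id]
  field_simp
  ring

/-! ### Canonical products -/

variable {ι : Type*}

/-- The product `∏ E_m(z / w_i) ^ k_i`. -/
def canonicalProduct (m : ℕ) (w : ι → ℂ) (k : ι → ℕ) (z : ℂ) : ℂ :=
  ∏' i, elemFactor m (z / w i) ^ k i

/-- The summands tend to zero along the cofinite filter. With `c i` zero or at least `1` and `A =
(2R)^(m+1)`, this puts all but finitely many relevant `w i` outside the disc of radius `2R`. -/
lemma eventually_le_norm_of_summable {m : ℕ} {w : ι → ℂ} {c : ι → ℝ}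
    (h : Summable fun i ↦ c i / ‖w i‖ ^ (m + 1)) (A : ℝ) :
    ∀ᶠ i in cofinite, c i * A < ‖w i‖ ^ (m + 1) ∨ w i = 0 := by
  have h0 := (h.mul_right A).tendsto_cofinite_zero
  filter_upwards [h0.eventually (gt_mem_nhds zero_lt_one)] with i hi
  rcases eq_or_ne (w i) 0 with h | h
  · exact .inr h
  · left
    have : 0 < ‖w i‖ ^ (m + 1) := by positivity
    rw [div_mul_eq_mul_div, div_lt_one this] at hi
    exact hi

/-- The majorant for the Weierstrass M-test: the power is `exp (k v)` with `‖k v‖ ≤ 1` for almost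
all indices, and there `‖exp x - 1‖ ≤ 2‖x‖`. -/
lemma eventually_norm_elemFactor_pow_sub_one_le {m : ℕ} {w : ι → ℂ} {k : ι → ℕ}
    (h : Summable fun i ↦ (k i : ℝ) / ‖w i‖ ^ (m + 1)) {R : ℝ} (hR : 0 ≤ R) :
    ∀ᶠ i in cofinite, ∀ z ∈ Metric.closedBall (0 : ℂ) R,
      ‖elemFactor m (z / w i) ^ k i - 1‖ ≤ 4 * R ^ (m + 1) * (k i / ‖w i‖ ^ (m + 1)) := by
  filter_upwards [eventually_le_norm_of_summable h ((2 * R) ^ (m + 1))] with i hi z hz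
  have hz : ‖z‖ ≤ R := by simpa using hz
  rcases Nat.eq_zero_or_pos (k i) with hk | hk
  · simp [hk]
  -- For `w i = 0` the convention `z / 0 = 0` makes the factor `E_m(0) = 1`. Later products may
  -- therefore run over all `ρ`, the centre `σ` included.
  rcases eq_or_ne (w i) 0 with h0 | h0
  · simp [h0, elemFactor_zero_right]
  have hi := (hi.resolve_right h0).le
  have hw : 0 < ‖w i‖ := by positivity
  have hk1 : (1 : ℝ) ≤ k i := by exact_mod_cast hk
  have h2 : 2 * R ≤ ‖w i‖ := by
    refine le_of_pow_le_pow_left₀ (n := m + 1) (by omega) hw.le ?_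
    exact (le_mul_of_one_le_left (by positivity) hk1).trans hi
  have hq : ‖z / w i‖ ≤ R / ‖w i‖ := by rw [norm_div]; gcongr
  obtain ⟨v, hv, hv2⟩ := exists_elemFactor_eq_exp m (z := z / w i) (hq.trans (by
    rw [div_le_div_iff₀ hw (by norm_num)]; linarith))
  have hv3 : ‖v‖ ≤ 2 * (R ^ (m + 1) / ‖w i‖ ^ (m + 1)) := by
    refine hv2.trans ?_
    rw [← div_pow]; gcongr
  have hv4 : ‖(k i : ℂ) * v‖ ≤ 2 * R ^ (m + 1) * (k i / ‖w i‖ ^ (m + 1)) := by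
    rw [norm_mul, Complex.norm_natCast]
    calc (k i : ℝ) * ‖v‖ ≤ k i * (2 * (R ^ (m + 1) / ‖w i‖ ^ (m + 1))) := by gcongr
      _ = _ := by ring
  have hv5 : 2 * R ^ (m + 1) * (k i / ‖w i‖ ^ (m + 1)) ≤ 1 := by
    rw [mul_div_assoc', div_le_one (by positivity)]
    refine le_trans ?_ hi
    rw [mul_pow]
    have : (2 : ℝ) ≤ 2 ^ (m + 1) := by
      simpa using pow_le_pow_right₀ (one_le_two (α := ℝ)) (show 1 ≤ m + 1 by omega)
    have hRp : 0 ≤ R ^ (m + 1) := by positivity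
    nlinarith [mul_nonneg hRp (by linarith : (0 : ℝ) ≤ k i)]
  rw [hv, ← Complex.exp_nat_mul]
  refine (Complex.norm_exp_sub_one_le (hv4.trans hv5)).trans ?_
  linarith

lemma hasProdUniformlyOn_canonicalProduct {m : ℕ} {w : ι → ℂ} {k : ι → ℕ}
    (h : Summable fun i ↦ (k i : ℝ) / ‖w i‖ ^ (m + 1)) {R : ℝ} (hR : 0 ≤ R) :
    HasProdUniformlyOn (fun i z ↦ elemFactor m (z / w i) ^ k i) (canonicalProduct m w k)
      (Metric.closedBall 0 R) := by
  have := Summable.hasProdUniformlyOn_one_add (f := fun i z ↦ elemFactor m (z / w i) ^ k i - 1)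
    (isCompact_closedBall (0 : ℂ) R) (h.mul_left (4 * R ^ (m + 1)))
    (eventually_norm_elemFactor_pow_sub_one_le h hR) fun i ↦ by
      have := (differentiable_elemFactor m).continuous
      fun_prop
  simp only [add_sub_cancel] at this
  exact this

lemma hasProdLocallyUniformlyOn_canonicalProduct {m : ℕ} {w : ι → ℂ} {k : ι → ℕ}
    (h : Summable fun i ↦ (k i : ℝ) / ‖w i‖ ^ (m + 1)) :
    HasProdLocallyUniformlyOn (fun i z ↦ elemFactor m (z / w i) ^ k i) (canonicalProduct m w k)
      Set.univ := by
  refine hasProdLocallyUniformlyOn_of_forall_compact isOpen_univ fun K _ hK ↦ ?_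
  obtain ⟨R, hR⟩ := hK.isBounded.subset_closedBall 0
  exact (hasProdUniformlyOn_canonicalProduct h (le_max_right R 0)).mono
    (hR.trans (Metric.closedBall_subset_closedBall (le_max_left _ _)))

lemma hasProd_canonicalProduct {m : ℕ} {w : ι → ℂ} {k : ι → ℕ}
    (h : Summable fun i ↦ (k i : ℝ) / ‖w i‖ ^ (m + 1)) (z : ℂ) :
    HasProd (fun i ↦ elemFactor m (z / w i) ^ k i) (canonicalProduct m w k z) :=
  (hasProdLocallyUniformlyOn_canonicalProduct h).hasProd (Set.mem_univ z)

lemma differentiable_canonicalProduct {m : ℕ} {w : ι → ℂ} {k : ι → ℕ}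
    (h : Summable fun i ↦ (k i : ℝ) / ‖w i‖ ^ (m + 1)) :
    Differentiable ℂ (canonicalProduct m w k) := by
  rw [← differentiableOn_univ]
  refine (hasProdLocallyUniformlyOn_canonicalProduct h).differentiableOn
    (.of_forall fun s ↦ ?_) isOpen_univ
  have := differentiable_elemFactor m
  simpa [Finset.prod_fn] using
    Differentiable.differentiableOn (Differentiable.fun_finsetProd fun i _ ↦ by fun_prop)

lemma norm_canonicalProduct_le {m : ℕ} {w : ι → ℂ} {k : ι → ℕ}
    (h : Summable fun i ↦ (k i : ℝ) / ‖w i‖ ^ (m + 1)) (z : ℂ) :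
    ‖canonicalProduct m w k z‖ ≤
      Real.exp (elemConst m * (∑' i, (k i : ℝ) / ‖w i‖ ^ (m + 1)) * ‖z‖ ^ (m + 1)) := by
  refine le_of_tendsto (hasProd_canonicalProduct h z).norm (.of_forall fun s ↦ ?_)
  calc ∏ i ∈ s, ‖elemFactor m (z / w i) ^ k i‖
      ≤ ∏ i ∈ s, Real.exp (elemConst m * (k i / ‖w i‖ ^ (m + 1)) * ‖z‖ ^ (m + 1)) := by
        refine Finset.prod_le_prod (fun _ _ ↦ norm_nonneg _) fun i _ ↦ ?_
        rw [norm_pow]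
        refine (pow_le_pow_left₀ (norm_nonneg _) (norm_elemFactor_le m _) _).trans ?_
        rw [← Real.exp_nat_mul, Real.exp_le_exp, norm_div, div_pow]
        apply le_of_eq; ring
    _ = Real.exp (elemConst m * (∑ i ∈ s, (k i : ℝ) / ‖w i‖ ^ (m + 1)) * ‖z‖ ^ (m + 1)) := by
        rw [← Real.exp_sum, Finset.mul_sum, Finset.sum_mul]
    _ ≤ _ := by
        have := elemConst_nonneg m
        gcongr
        exact h.sum_le_tsum s fun i _ ↦ by positivity

lemma canonicalProduct_ne_zero {m : ℕ} {w : ι → ℂ} {k : ι → ℕ}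
    (h : Summable fun i ↦ (k i : ℝ) / ‖w i‖ ^ (m + 1)) {z : ℂ}
    (hz : ∀ i, k i ≠ 0 → w i ≠ 0 → z ≠ w i) : canonicalProduct m w k z ≠ 0 := by
  have := tprod_one_add_ne_zero_of_summable (f := fun i ↦ elemFactor m (z / w i) ^ k i - 1) ?_ ?_
  · simpa [canonicalProduct] using this
  · intro i
    rw [add_sub_cancel]
    by_cases hk : k i = 0
    · simp [hk]
    refine pow_ne_zero _ fun h0 ↦ ?_
    rw [elemFactor_eq_zero_iff] at h0
    have hw : w i ≠ 0 := by rintro hw; simp [hw] at h0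
    exact hz i hk hw ((div_eq_one_iff_eq hw).1 h0)
  · refine Summable.of_norm_bounded_eventually
      (h.mul_left (4 * ‖z‖ ^ (m + 1))) ?_
    filter_upwards [eventually_norm_elemFactor_pow_sub_one_le h (norm_nonneg z)] with i hi
    simpa using hi z (by simp)

lemma canonicalProduct_eq_mul [DecidableEq ι] {m : ℕ} {w : ι → ℂ} {k : ι → ℕ}
    (h : Summable fun i ↦ (k i : ℝ) / ‖w i‖ ^ (m + 1)) (j : ι) (z : ℂ) :
    canonicalProduct m w k z =
      elemFactor m (z / w j) ^ k j * canonicalProduct m w (Function.update k j 0) z := by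
  have h' : Summable fun i ↦ (Function.update k j 0 i : ℝ) / ‖w i‖ ^ (m + 1) := by
    refine h.of_nonneg_of_le (fun i ↦ by positivity) fun i ↦ ?_
    rcases eq_or_ne i j with rfl | hij
    · simp; positivity
    · simp [hij]
  have h1 := hasProd_canonicalProduct h' z
  have h2 := (hasProd_ite_eq j (elemFactor m (z / w j) ^ k j)).mul h1
  refine (hasProd_canonicalProduct h z).unique (h2.congr_fun fun i ↦ ?_)
  rcases eq_or_ne i j with rfl | hij
  · simp
  · simp [hij]

/-- The result is kept as a difference because `z^(m+1)/(z-w)` and `z^m` are the Laplace transforms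
of the `(m+1)`-st derivatives of `e^{wt}` and `1`, both cut off to `t ≥ 0`. -/
lemma logDeriv_elemFactor_pow (m : ℕ) (w : ℂ) (k : ℕ) {z : ℂ} (hz : z ≠ w) :
    logDeriv (fun z ↦ elemFactor m (z / w) ^ k) z =
      k * (z ^ (m + 1) / w ^ (m + 1) / (z - w) - z ^ m / w ^ (m + 1)) := by
  rcases eq_or_ne w 0 with rfl | hw
  · simp [elemFactor_zero_right, logDeriv]
  have hd := differentiable_elemFactor m
  have h1 : z / w ≠ 1 := fun h ↦ hz ((div_eq_one_iff_eq hw).1 h)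
  rw [logDeriv_fun_pow (by fun_prop)]
  have h2 : logDeriv (fun z ↦ elemFactor m (z / w)) z = logDeriv (elemFactor m) (z / w) * w⁻¹ := by
    have := logDeriv_comp (f := elemFactor m) (g := fun z ↦ z / w) (x := z) (by fun_prop)
      (by fun_prop)
    simpa [Function.comp_def, div_eq_mul_inv] using this
  rw [h2, logDeriv_elemFactor m h1]
  have h3 : z - w ≠ 0 := sub_ne_zero.2 hz
  rw [div_sub_one hw, div_pow]
  field_simp
  ring

/-- Over a common denominator the summand is `z^m · w/(z-w) · c/w^(m+1)`, and `‖w/(z-w)‖ ≤ 2` as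
soon as `‖w‖ > 2‖z‖`. -/
lemma summable_logDeriv_terms {m : ℕ} {w c : ι → ℂ} (hc : ∀ i, c i = 0 ∨ 1 ≤ ‖c i‖)
    (h : Summable fun i ↦ ‖c i‖ / ‖w i‖ ^ (m + 1)) (z : ℂ) :
    Summable fun i ↦ c i * (z ^ (m + 1) / w i ^ (m + 1) / (z - w i) - z ^ m / w i ^ (m + 1)) := by
  refine Summable.of_norm_bounded_eventually (h.mul_left (‖z‖ ^ m * 2)) ?_
  filter_upwards [eventually_le_norm_of_summable h ((2 * ‖z‖) ^ (m + 1))] with i hi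
  rcases hc i with h0 | h1
  · simp [h0]
  rcases eq_or_ne (w i) 0 with h0 | h0
  · simp [h0]
  have hi := hi.resolve_right h0
  have hw : 0 < ‖w i‖ := by positivity
  have h2 : 2 * ‖z‖ < ‖w i‖ := by
    refine lt_of_pow_lt_pow_left₀ (m + 1) hw.le ?_
    exact (le_mul_of_one_le_left (by positivity) h1).trans_lt hi
  have h4 : ‖w i‖ ≤ 2 * ‖z - w i‖ := by
    have := norm_sub_norm_le (w i) z
    rw [norm_sub_rev] at this
    linarith
  have h3 : z - w i ≠ 0 := by
    rw [← norm_pos_iff]; linarith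
  have h5 : c i * (z ^ (m + 1) / w i ^ (m + 1) / (z - w i) - z ^ m / w i ^ (m + 1)) =
      z ^ m * (w i / (z - w i)) * (c i / w i ^ (m + 1)) := by
    field_simp
    ring
  rw [h5, norm_mul, norm_mul, norm_div (c i), norm_pow, norm_pow, norm_div]
  gcongr
  rw [div_le_iff₀ (by positivity)]
  exact h4

lemma logDeriv_canonicalProduct {m : ℕ} {w : ι → ℂ} {k : ι → ℕ}
    (h : Summable fun i ↦ (k i : ℝ) / ‖w i‖ ^ (m + 1)) {z : ℂ}
    (hz : ∀ i, k i ≠ 0 → w i ≠ 0 → z ≠ w i) :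
    logDeriv (canonicalProduct m w k) z =
      ∑' i, k i * (z ^ (m + 1) / w i ^ (m + 1) / (z - w i) - z ^ m / w i ^ (m + 1)) := by
  have hterm : ∀ i, logDeriv (fun z ↦ elemFactor m (z / w i) ^ k i) z =
      k i * (z ^ (m + 1) / w i ^ (m + 1) / (z - w i) - z ^ m / w i ^ (m + 1)) := by
    intro i
    by_cases hk : k i = 0
    · simp [hk, logDeriv]
    by_cases hw : w i = 0
    · simp [hw, elemFactor_zero_right, logDeriv]
    exact logDeriv_elemFactor_pow m _ _ (hz i hk hw)
  have hd := differentiable_elemFactor m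
  have := logDeriv_tprod_eq_tsum (f := fun i z ↦ elemFactor m (z / w i) ^ k i) isOpen_univ
    (Set.mem_univ z) ?_ (fun i ↦ by fun_prop) ?_
    (hasProdLocallyUniformlyOn_canonicalProduct h).multipliableLocallyUniformlyOn
    (canonicalProduct_ne_zero h hz)
  · simp_rw [hterm] at this
    exact this
  · intro i h0
    by_cases hk : k i = 0
    · simp [hk] at h0
    rw [pow_eq_zero_iff hk, elemFactor_eq_zero_iff] at h0
    have hw : w i ≠ 0 := by rintro hw; simp [hw] at h0
    exact hz i hk hw ((div_eq_one_iff_eq hw).1 h0)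
  · simp_rw [hterm]
    refine summable_logDeriv_terms (c := fun i ↦ (k i : ℂ)) (fun i ↦ ?_) (by simpa using h) z
    rcases Nat.eq_zero_or_pos (k i) with hk | hk
    · simp [hk]
    · right; rw [Complex.norm_natCast]; exact_mod_cast hk

/-! ### Entire functions whose real part grows polynomially in the mean -/

open Real in
lemma norm_circleAverage_le (f : ℂ → ℂ) (R : ℝ) :
    ‖circleAverage f 0 R‖ ≤ circleAverage (fun z ↦ ‖f z‖) 0 R := by
  rw [circleAverage, circleAverage, norm_smul, Real.norm_of_nonneg (by positivity), smul_eq_mul]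
  gcongr
  exact intervalIntegral.norm_integral_le_integral_norm two_pi_pos.le

open Real in
lemma circleAverage_div_pow {Q : ℂ → ℂ} (hQ : Differentiable ℂ Q) (n : ℕ) {r : ℝ} (hr : 0 < r) :
    circleAverage (fun z ↦ Q z / z ^ n) 0 r = iteratedDeriv n Q 0 / n.factorial := by
  rw [circleAverage_eq_circleIntegral hr.ne']
  have h := hQ.differentiableOn.circleIntegral_one_div_sub_center_pow_smul (c := 0) hr n
  have e : (∮ z in C(0, r), (z - 0)⁻¹ • (Q z / z ^ n)) =
      ∮ z in C(0, r), (1 / (z - 0) ^ (n + 1)) • Q z := by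
    congr 1; ext z; simp only [sub_zero, smul_eq_mul, pow_succ]
    field_simp
  rw [e, h, smul_eq_mul, smul_eq_mul]
  have := Complex.two_pi_I_ne_zero
  field_simp

open Real in
-- On the circle `conj Q / z^n` equals `conj (Q z^n) / r^(2n)`, and the mean of `Q z^n` is its value
-- `0` at the origin.
lemma circleAverage_conj_div_pow {Q : ℂ → ℂ} (hQ : Differentiable ℂ Q) {n : ℕ} (hn : n ≠ 0)
    {r : ℝ} (hr : 0 < r) :
    circleAverage (fun z ↦ (starRingEnd ℂ) (Q z) / z ^ n) 0 r = 0 := by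
  have h1 : circleAverage (fun z ↦ Q z * z ^ n) 0 r = 0 := by
    have := DiffContOnCl.circleAverage (f := fun z ↦ Q z * z ^ n) (c := 0) (R := r)
      (by fun_prop : Differentiable ℂ fun z ↦ Q z * z ^ n).diffContOnCl
    simpa [hn] using this
  have hcont : Continuous fun z ↦ Q z * z ^ n := by have := hQ.continuous; fun_prop
  have h2 := (Complex.conjCLE : ℂ →L[ℝ] ℂ).circleAverage_comp_comm (c := 0) (R := r)
    (f := fun z ↦ Q z * z ^ n) hcont.continuousOn.circleIntegrable'
  rw [h1, map_zero] at h2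
  have h3 : circleAverage (fun z ↦ (starRingEnd ℂ) (Q z) / z ^ n) 0 r =
      circleAverage (fun z ↦ ((r : ℂ) ^ (2 * n))⁻¹ •
        ((Complex.conjCLE : ℂ →L[ℝ] ℂ) ∘ fun z ↦ Q z * z ^ n) z) 0 r := by
    refine circleAverage_congr_sphere fun z hz ↦ ?_
    have hz : ‖z‖ = r := by simpa [abs_of_pos hr] using hz
    have hz0 : z ≠ 0 := by rw [← norm_pos_iff, hz]; exact hr
    have hr0 : (r : ℂ) ≠ 0 := by exact_mod_cast hr.ne'
    have hzz : (r : ℂ) ^ (2 * n) = (starRingEnd ℂ) z ^ n * z ^ n := by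
      rw [← mul_pow, mul_comm ((starRingEnd ℂ) z), Complex.mul_conj, Complex.normSq_eq_norm_sq, hz, pow_mul]
      push_cast; rfl
    have hc0 : (starRingEnd ℂ) z ≠ 0 := (map_ne_zero _).2 hz0
    simp only [Function.comp, smul_eq_mul, hzz]
    simp
    field_simp
  rw [h3, circleAverage_fun_smul, h2, smul_zero]

open Real in
-- Adding the vanishing mean of `conj Q / z^n` turns the Taylor coefficient into the mean of `2 Re Q
-- / z^n`. Then `|Re Q| = 2 (Re Q)⁺ - Re Q`, where `Re Q` has mean `Re Q(0)`. Only the mean of `(Re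
-- Q)⁺` enters, which is what Nevanlinna theory controls.
lemma norm_iteratedDeriv_mul_pow_le {Q : ℂ → ℂ} (hQ : Differentiable ℂ Q) {n : ℕ} (hn : n ≠ 0)
    {r : ℝ} (hr : 0 < r) :
    ‖iteratedDeriv n Q 0 / n.factorial‖ * r ^ n ≤
      4 * circleAverage (fun z ↦ max 0 (Q z).re) 0 r - 2 * (Q 0).re := by
  have hcQ := hQ.continuous
  have hz0 : ∀ z ∈ Metric.sphere (0 : ℂ) |r|, z ≠ 0 := fun z hz ↦ by
    rw [← norm_pos_iff]
    have : ‖z‖ = |r| := by simpa using hz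
    rw [this]; positivity
  have hi1 : CircleIntegrable (fun z ↦ Q z / z ^ n) 0 r := by
    refine ContinuousOn.circleIntegrable' ?_
    exact hcQ.continuousOn.div (by fun_prop) fun z hz ↦ pow_ne_zero _ (hz0 z hz)
  have hi2 : CircleIntegrable (fun z ↦ (starRingEnd ℂ) (Q z) / z ^ n) 0 r := by
    refine ContinuousOn.circleIntegrable' ?_
    exact (Complex.continuous_conj.comp hcQ).continuousOn.div (by fun_prop)
      fun z hz ↦ pow_ne_zero _ (hz0 z hz)
  have hsum := circleAverage_add hi1 hi2
  rw [circleAverage_div_pow hQ n hr, circleAverage_conj_div_pow hQ hn hr, add_zero] at hsum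
  have hre : Continuous fun z ↦ (Q z).re := Complex.continuous_re.comp hcQ
  have hmax : Continuous fun z ↦ max 0 (Q z).re := continuous_const.max hre
  have hmean : circleAverage (fun z ↦ (Q z).re) 0 r = (Q 0).re := by
    have h2 := Complex.reCLM.circleAverage_comp_comm (c := 0) (R := r)
      (f := Q) hcQ.continuousOn.circleIntegrable'
    rw [DiffContOnCl.circleAverage hQ.diffContOnCl] at h2
    exact h2
  have habs : circleAverage (fun z ↦ ‖((fun z ↦ Q z / z ^ n) +
      fun z ↦ (starRingEnd ℂ) (Q z) / z ^ n) z‖) 0 r =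
      circleAverage (fun z ↦ (r ^ n)⁻¹ • ((4 : ℝ) • (fun z ↦ max 0 (Q z).re) +
        (-2 : ℝ) • fun z ↦ (Q z).re) z) 0 r := by
    refine circleAverage_congr_sphere fun z hz ↦ ?_
    have hz' : ‖z‖ = r := by simpa [abs_of_pos hr] using hz
    simp only [Pi.add_apply, Pi.smul_apply, smul_eq_mul, ← add_div, Complex.add_conj, norm_div,
      norm_pow, hz', Complex.norm_real, norm_mul, Real.norm_eq_abs]
    rw [div_eq_inv_mul]
    congr 1
    rcases le_total 0 (Q z).re with h | h
    · rw [max_eq_right h, abs_of_nonneg h, abs_two]; ring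
    · rw [max_eq_left h, abs_of_nonpos h, abs_two]; ring
  have hle := norm_circleAverage_le ((fun z ↦ Q z / z ^ n) +
      fun z ↦ (starRingEnd ℂ) (Q z) / z ^ n) r
  rw [habs, circleAverage_fun_smul, circleAverage_add
    (hmax.const_smul (4 : ℝ)).continuousOn.circleIntegrable'
    (hre.const_smul (-2 : ℝ)).continuousOn.circleIntegrable', circleAverage_smul,
    circleAverage_smul, hmean, hsum, smul_eq_mul, smul_eq_mul, smul_eq_mul,
    inv_mul_eq_div, le_div_iff₀ (by positivity)] at hle
  linarith

open Real in
lemma iteratedDeriv_eq_zero_of_circleAverage_le {Q : ℂ → ℂ} (hQ : Differentiable ℂ Q) {C : ℝ}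
    {B n : ℕ} (h : ∀ᶠ r : ℝ in atTop, circleAverage (fun z ↦ max 0 (Q z).re) 0 r ≤ C * r ^ B)
    (hn : B < n) : iteratedDeriv n Q 0 = 0 := by
  set q := ‖iteratedDeriv n Q 0 / n.factorial‖ with hq
  have h1 : ∀ᶠ r : ℝ in atTop, q ≤ 4 * C * (r ^ B / r ^ n) + (-2 * (Q 0).re) * (r ^ n)⁻¹ := by
    filter_upwards [h, eventually_gt_atTop 0] with r hr hr0
    have := norm_iteratedDeriv_mul_pow_le hQ (n := n) (by omega) hr0
    have hrn : 0 < r ^ n := by positivity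
    rw [← div_eq_mul_inv, mul_div_assoc', ← add_div, le_div_iff₀ hrn]
    linarith
  have h2 : Tendsto (fun r : ℝ ↦ 4 * C * (r ^ B / r ^ n) + (-2 * (Q 0).re) * (r ^ n)⁻¹) atTop
      (𝓝 (4 * C * 0 + (-2 * (Q 0).re) * 0)) :=
    ((tendsto_pow_div_pow_atTop_zero hn).const_mul _).add
      ((tendsto_pow_atTop (by omega)).inv_tendsto_atTop.const_mul _)
  have h3 : q ≤ 0 := by
    have := ge_of_tendsto h2 h1
    simpa using this
  have h4 := norm_le_zero_iff.1 h3
  have : (n.factorial : ℂ) ≠ 0 := by exact_mod_cast n.factorial_ne_zero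
  simpa [this] using h4

lemma exists_polynomial_eq_of_circleAverage_le {Q : ℂ → ℂ} (hQ : Differentiable ℂ Q) {C : ℝ}
    {B : ℕ}
    (h : ∀ᶠ r : ℝ in atTop, Real.circleAverage (fun z ↦ max 0 (Q z).re) 0 r ≤ C * r ^ B) :
    ∃ p : Polynomial ℂ, ∀ z, Q z = p.eval z := by
  refine ⟨∑ n ∈ Finset.range (B + 1),
    Polynomial.C ((n.factorial : ℂ)⁻¹ * iteratedDeriv n Q 0) * Polynomial.X ^ n, fun z ↦ ?_⟩
  rw [← Complex.taylorSeries_eq_of_entire' 0 z hQ, tsum_eq_sum (s := Finset.range (B + 1)),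
    Polynomial.eval_finsetSum]
  · simp
  · intro n hn
    rw [iteratedDeriv_eq_zero_of_circleAverage_le hQ h (by simpa using hn)]
    simp

/-- With `η` a primitive of `H'/H`, the function `H e^{-η}` is constant, and a logarithm of that
constant is added to `η`. -/
lemma exists_eq_exp_of_entire {H : ℂ → ℂ} (hH : Differentiable ℂ H) (h0 : ∀ z, H z ≠ 0) :
    ∃ Q : ℂ → ℂ, Differentiable ℂ Q ∧ ∀ z, H z = Complex.exp (Q z) := by
  have hd : Differentiable ℂ (deriv H) := by
    rw [← differentiableOn_univ] at hH ⊢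
    exact hH.deriv isOpen_univ
  obtain ⟨η, hη⟩ := (hd.fun_div hH h0).isExactOn_univ
  have hη : ∀ z, HasDerivAt η (deriv H z / H z) z := fun z ↦ hη z (Set.mem_univ z)
  have hconst : ∀ z, H z * Complex.exp (-η z) = H 0 * Complex.exp (-η 0) := by
    have hdd : ∀ z, HasDerivAt (fun z ↦ H z * Complex.exp (-η z)) 0 z := fun z ↦ by
      have := (hH z).hasDerivAt.mul (hη z).neg.cexp
      refine this.congr_deriv ?_
      have := h0 z
      field_simp
      simp
    intro z
    exact is_const_of_deriv_eq_zero (fun z ↦ (hdd z).differentiableAt) (fun z ↦ (hdd z).deriv) z 0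
  refine ⟨fun z ↦ η z + Complex.log (H 0 * Complex.exp (-η 0)), fun z ↦
    ((hη z).differentiableAt.add_const _), fun z ↦ ?_⟩
  rw [Complex.exp_add, Complex.exp_log (mul_ne_zero (h0 0) (Complex.exp_ne_zero _)), ← hconst z,
    mul_comm, mul_assoc, ← Complex.exp_add]
  simp

/-! ### Weierstrass products with prescribed divisor -/

/-- The entire function with the zeros `ρ` of multiplicity `k ρ` given by the canonical product
centred at `σ`. -/
def weierstrassProduct (m : ℕ) (σ : ℂ) (k : ℂ → ℕ) (s : ℂ) : ℂ :=
  (s - σ) ^ k σ * canonicalProduct m (fun ρ ↦ ρ - σ) k (s - σ)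

section Weierstrass

variable {m : ℕ} {σ : ℂ} {k : ℂ → ℕ}

lemma differentiable_weierstrassProduct
    (h : Summable fun ρ : ℂ ↦ (k ρ : ℝ) / ‖ρ - σ‖ ^ (m + 1)) :
    Differentiable ℂ (weierstrassProduct m σ k) := by
  have := differentiable_canonicalProduct h
  unfold weierstrassProduct
  fun_prop

lemma weierstrassProduct_ne_zero (h : Summable fun ρ : ℂ ↦ (k ρ : ℝ) / ‖ρ - σ‖ ^ (m + 1))
    {s : ℂ} (hs : k s = 0) : weierstrassProduct m σ k s ≠ 0 := by
  refine mul_ne_zero ?_ (canonicalProduct_ne_zero h fun ρ hk _ h0 ↦ hk ?_)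
  · rcases eq_or_ne s σ with rfl | hsσ
    · simp [hs]
    · exact pow_ne_zero _ (sub_ne_zero.2 hsσ)
  · rw [← sub_left_injective h0, hs]

/-- At `σ` the power is explicit. Elsewhere one elementary factor is split off, and `1 - (s-σ)/(ρ-σ)
= -(s-ρ)/(ρ-σ)` shows its simple zero. -/
lemma exists_weierstrassProduct_eq_pow_mul
    (h : Summable fun ρ : ℂ ↦ (k ρ : ℝ) / ‖ρ - σ‖ ^ (m + 1)) (ρ : ℂ) :
    ∃ g : ℂ → ℂ, Differentiable ℂ g ∧ g ρ ≠ 0 ∧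
      ∀ s, weierstrassProduct m σ k s = (s - ρ) ^ k ρ * g s := by
  classical
  rcases eq_or_ne ρ σ with rfl | hρ
  · refine ⟨fun s ↦ canonicalProduct m (fun ρ' ↦ ρ' - ρ) k (s - ρ), ?_, ?_, fun s ↦ rfl⟩
    · have := differentiable_canonicalProduct h
      fun_prop
    · simpa using canonicalProduct_ne_zero h (z := 0) fun i _ hi ↦ hi.symm
  have hρ0 : ρ - σ ≠ 0 := sub_ne_zero.2 hρ
  have h' : Summable fun i ↦ (Function.update k ρ 0 i : ℝ) / ‖i - σ‖ ^ (m + 1) := by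
    refine h.of_nonneg_of_le (fun i ↦ by positivity) fun i ↦ ?_
    rcases eq_or_ne i ρ with rfl | hij
    · simp; positivity
    · simp [hij]
  refine ⟨fun s ↦ (s - σ) ^ k σ * ((-1 / (ρ - σ) *
      Complex.exp (∑ j ∈ Finset.Icc 1 m, ((s - σ) / (ρ - σ)) ^ j / j)) ^ k ρ *
      canonicalProduct m (fun ρ ↦ ρ - σ) (Function.update k ρ 0) (s - σ)), ?_, ?_, fun s ↦ ?_⟩
  · have := differentiable_canonicalProduct h'
    fun_prop
  · refine mul_ne_zero (pow_ne_zero _ hρ0) (mul_ne_zero (pow_ne_zero _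
      (mul_ne_zero (div_ne_zero (by norm_num) hρ0) (Complex.exp_ne_zero _)))
      (canonicalProduct_ne_zero h' fun i hi _ h0 ↦ hi ?_))
    rw [← sub_left_injective h0]; simp
  · have : elemFactor m ((s - σ) / (ρ - σ)) = (s - ρ) * (-1 / (ρ - σ) *
        Complex.exp (∑ j ∈ Finset.Icc 1 m, ((s - σ) / (ρ - σ)) ^ j / j)) := by
      rw [elemFactor, ← mul_assoc]
      congr 1
      field_simp
      ring
    rw [weierstrassProduct, canonicalProduct_eq_mul h ρ, this, mul_pow]
    ring

lemma meromorphicOrderAt_weierstrassProduct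
    (h : Summable fun ρ : ℂ ↦ (k ρ : ℝ) / ‖ρ - σ‖ ^ (m + 1)) (ρ : ℂ) :
    meromorphicOrderAt (weierstrassProduct m σ k) ρ = ((k ρ : ℤ) : WithTop ℤ) := by
  obtain ⟨g, hg, hg0, hgeq⟩ := exists_weierstrassProduct_eq_pow_mul h ρ
  rw [meromorphicOrderAt_eq_int_iff
    ((differentiable_weierstrassProduct h).analyticAt ρ).meromorphicAt]
  exact ⟨g, hg.analyticAt ρ, hg0, .of_forall fun z ↦ by rw [hgeq]; simp⟩

lemma exists_norm_weierstrassProduct_le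
    (h : Summable fun ρ : ℂ ↦ (k ρ : ℝ) / ‖ρ - σ‖ ^ (m + 1)) :
    ∃ C : ℝ, 0 ≤ C ∧
      ∀ s, ‖weierstrassProduct m σ k s‖ ≤ Real.exp (C * (1 + ‖s‖) ^ (m + 1)) := by
  set A := elemConst m * ∑' ρ : ℂ, (k ρ : ℝ) / ‖ρ - σ‖ ^ (m + 1) with hA
  have hA0 : 0 ≤ A := mul_nonneg (elemConst_nonneg m) (tsum_nonneg fun i ↦ by positivity)
  -- `A` bounds the canonical product and `k σ` the monomial, through `x^k ≤ e^{kx}`; the last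
  -- factor comes from `‖s - σ‖ ≤ (1 + ‖σ‖)(1 + ‖s‖)`.
  refine ⟨(k σ + A) * (1 + ‖σ‖) ^ (m + 1), by positivity, fun s ↦ ?_⟩
  have h1 : ‖s - σ‖ ≤ (1 + ‖σ‖) * (1 + ‖s‖) := by
    nlinarith [norm_sub_le s σ, norm_nonneg s, norm_nonneg σ]
  have h1' : (1 : ℝ) ≤ (1 + ‖σ‖) * (1 + ‖s‖) := by
    nlinarith [norm_nonneg s, norm_nonneg σ]
  have h2 : ‖s - σ‖ ^ (m + 1) ≤ (1 + ‖σ‖) ^ (m + 1) * (1 + ‖s‖) ^ (m + 1) := by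
    rw [← mul_pow]; gcongr
  have h3 : ‖s - σ‖ ≤ (1 + ‖σ‖) ^ (m + 1) * (1 + ‖s‖) ^ (m + 1) := by
    rw [← mul_pow]
    exact h1.trans (le_self_pow₀ h1' (by omega))
  have h4 : ‖s - σ‖ ^ k σ ≤ Real.exp (k σ * ‖s - σ‖) := by
    rw [Real.exp_nat_mul]
    gcongr
    linarith [Real.add_one_le_exp ‖s - σ‖]
  rw [weierstrassProduct, norm_mul, norm_pow]
  calc _ ≤ Real.exp (k σ * ‖s - σ‖) * Real.exp (A * ‖s - σ‖ ^ (m + 1)) := by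
        gcongr
        exact norm_canonicalProduct_le h _
    _ ≤ _ := by
        rw [← Real.exp_add, Real.exp_le_exp]
        nlinarith [mul_le_mul_of_nonneg_left h2 hA0,
          mul_le_mul_of_nonneg_left h3 (k σ).cast_nonneg (α := ℝ)]

end Weierstrass

open ValueDistribution in
-- An entire function has no poles to count, so its characteristic is the circle mean of `log⁺ ‖f‖`.
lemma characteristic_le_of_norm_le_exp {f : ℂ → ℂ} (hf : Differentiable ℂ f) {B : ℝ → ℝ}
    (hB : ∀ s, ‖f s‖ ≤ Real.exp (B ‖s‖)) {r : ℝ} (hr : 0 ≤ r) (hBr : 0 ≤ B r) :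
    characteristic f ⊤ r ≤ B r := by
  have hdiv : (MeromorphicOn.divisor f Set.univ)⁻ = 0 := by
    rw [negPart_eq_zero]
    exact MeromorphicOn.AnalyticOnNhd.divisor_nonneg fun z _ ↦ hf.analyticAt z
  have h1 : logCounting f ⊤ r = 0 := by rw [logCounting_top, hdiv]; simp
  rw [characteristic, Pi.add_apply, h1, add_zero, proximity_top]
  refine Real.circleAverage_mono_on_of_le_circle ?_ fun z hz ↦ ?_
  · exact MeromorphicOn.circleIntegrable_posLog_norm fun z _ ↦ (hf.analyticAt z).meromorphicAt
  · have hz : ‖z‖ = r := by simpa [abs_of_nonneg hr] using hz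
    have h2 := hB z
    rw [hz] at h2
    rw [Real.posLog]
    refine max_le hBr ?_
    rcases eq_or_ne (f z) 0 with h0 | h0
    · simpa [h0] using hBr
    · rw [Real.log_le_iff_le_exp (norm_pos_iff.2 h0)]
      exact h2

/-! ### Hadamard factorization -/

lemma HasFiniteOrder.exists_characteristic_le {f : ℂ → ℂ} (hf : HasFiniteOrder f) :
    ∃ (C : ℝ) (B : ℕ), 0 ≤ C ∧ ∀ᶠ r in atTop,
      ValueDistribution.characteristic f ⊤ r ≤ C * r ^ B := by
  obtain ⟨A, hA⟩ := hf
  obtain ⟨C, hC, h⟩ := hA.exists_nonneg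
  obtain ⟨B, hB⟩ := exists_nat_ge A
  refine ⟨C, B, hC, ?_⟩
  filter_upwards [h.bound, eventually_ge_atTop 1] with r hr hr1
  refine (le_abs_self _).trans (hr.trans ?_)
  gcongr
  rw [Real.norm_of_nonneg (by positivity), ← Real.rpow_natCast]
  exact Real.rpow_le_rpow_of_exponent_le hr1 hB

lemma IsMeromorphic.meromorphic {f : ℂ → ℂ} (hf : IsMeromorphic f) : Meromorphic f :=
  fun z ↦ (hf (Set.mem_univ z)).meromorphicAt

lemma meromorphicOrderAt_eq_mult {f : ℂ → ℂ} (hf : IsMeromorphic f)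
    (hne : ∀ z, meromorphicOrderAt f z ≠ ⊤) (z : ℂ) :
    meromorphicOrderAt f z = (mult f z : WithTop ℤ) := by
  rw [mult, MeromorphicOn.divisor_apply (meromorphicOn_univ.2 hf.meromorphic) (Set.mem_univ z),
    WithTop.coe_untop₀_of_ne_top (hne z)]

lemma IsMeromorphic.analyticAt {f : ℂ → ℂ} (hf : IsMeromorphic f)
    (hne : ∀ z, meromorphicOrderAt f z ≠ ⊤) {z : ℂ} (hz : mult f z = 0) : AnalyticAt ℂ f z := by
  rw [← (hf (Set.mem_univ z)).meromorphicOrderAt_nonneg_iff_analyticAt,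
    meromorphicOrderAt_eq_mult hf hne, hz]
  simp

lemma IsMeromorphic.ne_zero {f : ℂ → ℂ} (hf : IsMeromorphic f)
    (hne : ∀ z, meromorphicOrderAt f z ≠ ⊤) {z : ℂ} (hz : mult f z = 0) : f z ≠ 0 := by
  rw [← (hf (Set.mem_univ z)).meromorphicOrderAt_eq_zero_iff,
    meromorphicOrderAt_eq_mult hf hne, hz]
  simp

lemma mult_eq_zero_of_order_top {f : ℂ → ℂ} (hf : IsMeromorphic f) {z : ℂ}
    (hz : meromorphicOrderAt f z = ⊤) (s : ℂ) : mult f s = 0 := by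
  have : meromorphicOrderAt f s = ⊤ := by
    by_contra h
    exact (meromorphicOn_univ.2 hf.meromorphic).meromorphicOrderAt_ne_top_of_isPreconnected
      isPreconnected_univ (Set.mem_univ s) (Set.mem_univ z) h hz
  rw [mult, MeromorphicOn.divisor_apply (meromorphicOn_univ.2 hf.meromorphic) (Set.mem_univ s),
    this, WithTop.untop₀_top]

/-- The multiplicities of the zeros of `f`. -/
def zeroMult (f : ℂ → ℂ) (ρ : ℂ) : ℕ := (mult f ρ).toNat

/-- The multiplicities of the poles of `f`. -/
def poleMult (f : ℂ → ℂ) (ρ : ℂ) : ℕ := (-mult f ρ).toNat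

lemma mult_eq_zeroMult_sub_poleMult (f : ℂ → ℂ) (ρ : ℂ) :
    mult f ρ = zeroMult f ρ - poleMult f ρ := by
  unfold zeroMult poleMult; omega

lemma zeroMult_eq_zero {f : ℂ → ℂ} {ρ : ℂ} (h : mult f ρ = 0) : zeroMult f ρ = 0 := by
  simp [zeroMult, h]

lemma poleMult_eq_zero {f : ℂ → ℂ} {ρ : ℂ} (h : mult f ρ = 0) : poleMult f ρ = 0 := by
  simp [poleMult, h]

lemma zeroMult_le (f : ℂ → ℂ) (ρ : ℂ) : (zeroMult f ρ : ℝ) ≤ |(mult f ρ : ℝ)| := by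
  have : (zeroMult f ρ : ℤ) ≤ |mult f ρ| := by
    unfold zeroMult; rcases abs_cases (mult f ρ) with h | h <;> omega
  exact_mod_cast this

lemma poleMult_le (f : ℂ → ℂ) (ρ : ℂ) : (poleMult f ρ : ℝ) ≤ |(mult f ρ : ℝ)| := by
  have : (poleMult f ρ : ℤ) ≤ |mult f ρ| := by
    unfold poleMult; rcases abs_cases (mult f ρ) with h | h <;> omega
  exact_mod_cast this

lemma summable_zeroMult {f : ℂ → ℂ} {σ : ℂ} {m : ℕ}
    (h : Summable fun ρ : ℂ ↦ |(mult f ρ : ℝ)| / ‖ρ - σ‖ ^ (m + 1)) :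
    Summable fun ρ : ℂ ↦ (zeroMult f ρ : ℝ) / ‖ρ - σ‖ ^ (m + 1) :=
  h.of_nonneg_of_le (fun _ ↦ by positivity) fun ρ ↦ by gcongr; exact zeroMult_le f ρ

lemma summable_poleMult {f : ℂ → ℂ} {σ : ℂ} {m : ℕ}
    (h : Summable fun ρ : ℂ ↦ |(mult f ρ : ℝ)| / ‖ρ - σ‖ ^ (m + 1)) :
    Summable fun ρ : ℂ ↦ (poleMult f ρ : ℝ) / ‖ρ - σ‖ ^ (m + 1) :=
  h.of_nonneg_of_le (fun _ ↦ by positivity) fun ρ ↦ by gcongr; exact poleMult_le f ρ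

open ValueDistribution in
-- With `P`, `Z` the products over poles and zeros, `f P / Z` has order `0` everywhere, so its
-- normal form `H` is entire without zeros and `H = e^Q`. The mean of `(Re Q)⁺` is the proximity
-- function of `H`, hence at most `T(f) + T(P) + T(1/Z)`, and the First Main Theorem replaces
-- `T(1/Z)` by `T(Z) + O(1)`. All three grow polynomially.
theorem exists_hadamard_factorization {f : ℂ → ℂ} (hf : IsMeromorphic f) (hfo : HasFiniteOrder f)
    (hne : ∀ z, meromorphicOrderAt f z ≠ ⊤) {m : ℕ} {σ : ℂ}
    (hs : Summable fun ρ : ℂ ↦ |(mult f ρ : ℝ)| / ‖ρ - σ‖ ^ (m + 1)) :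
    ∃ Q : Polynomial ℂ, ∀ s, mult f s = 0 →
      f s * weierstrassProduct m σ (poleMult f) s =
        Complex.exp (Q.eval s) * weierstrassProduct m σ (zeroMult f) s := by
  have hz := summable_zeroMult hs
  have hp := summable_poleMult hs
  set P := weierstrassProduct m σ (poleMult f) with hP
  set Z := weierstrassProduct m σ (zeroMult f) with hZ
  have dP : Differentiable ℂ P := differentiable_weierstrassProduct hp
  have dZ : Differentiable ℂ Z := differentiable_weierstrassProduct hz
  have oP : ∀ z, meromorphicOrderAt P z = ((poleMult f z : ℤ) : WithTop ℤ) :=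
    meromorphicOrderAt_weierstrassProduct hp
  have oZ : ∀ z, meromorphicOrderAt Z z = ((zeroMult f z : ℤ) : WithTop ℤ) :=
    meromorphicOrderAt_weierstrassProduct hz
  have mf := hf.meromorphic
  have mP : Meromorphic P := fun z ↦ (dP.analyticAt z).meromorphicAt
  have mZ : Meromorphic Z := fun z ↦ (dZ.analyticAt z).meromorphicAt
  have mfP : Meromorphic (f * P) := fun z ↦ (mf z).mul (mP z)
  have mG : Meromorphic (f * P * Z⁻¹) := fun z ↦ (mfP z).mul (mZ z).inv
  have ofP : ∀ z, meromorphicOrderAt (f * P) z = ((mult f z + poleMult f z : ℤ) : WithTop ℤ) := by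
    intro z
    rw [meromorphicOrderAt_mul (mf z) (mP z), oP, meromorphicOrderAt_eq_mult hf hne]
    norm_cast
  have oZi : ∀ z, meromorphicOrderAt Z⁻¹ z = ((-zeroMult f z : ℤ) : WithTop ℤ) := by
    intro z
    rw [meromorphicOrderAt_inv, oZ]
    norm_cast
  have oG : ∀ z, meromorphicOrderAt (f * P * Z⁻¹) z = 0 := by
    intro z
    rw [meromorphicOrderAt_mul (mfP z) (mZ z).inv, ofP, oZi, ← WithTop.coe_add,
      mult_eq_zeroMult_sub_poleMult]
    ring_nf
    rfl
  set H := toMeromorphicNFOn (f * P * Z⁻¹) Set.univ with hH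
  have nH : MeromorphicNFOn H Set.univ := meromorphicNFOn_toMeromorphicNFOn _ _
  have oH : ∀ z, meromorphicOrderAt H z = 0 := fun z ↦ by
    rw [hH, meromorphicOrderAt_toMeromorphicNFOn (meromorphicOn_univ.2 mG) (Set.mem_univ z), oG]
  have aH : ∀ z, AnalyticAt ℂ H z := fun z ↦
    (nH (Set.mem_univ z)).meromorphicOrderAt_nonneg_iff_analyticAt.1 (oH z).ge
  have dH : Differentiable ℂ H := fun z ↦ (aH z).differentiableAt
  have nzH : ∀ z, H z ≠ 0 := fun z ↦
    (nH (Set.mem_univ z)).meromorphicOrderAt_eq_zero_iff.1 (oH z)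
  obtain ⟨Q, hQ, hHQ⟩ := exists_eq_exp_of_entire dH nzH
  -- the Nevanlinna characteristic of `H`
  obtain ⟨Cf, Bf, hCf, hf_char⟩ := hfo.exists_characteristic_le
  obtain ⟨CP, hCP, hPb⟩ := exists_norm_weierstrassProduct_le hp
  obtain ⟨CZ, hCZ, hZb⟩ := exists_norm_weierstrassProduct_le hz
  set c0 := max |Real.log ‖Z 0‖| |Real.log ‖meromorphicTrailingCoeffAt Z 0‖| with hc0
  have hc0' : 0 ≤ c0 := (abs_nonneg _).trans (le_max_left _ _)
  have hbound : ∀ᶠ r : ℝ in atTop, Real.circleAverage (fun z ↦ max 0 (Q z).re) 0 r ≤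
      (Cf + (CP + CZ) * 2 ^ (m + 1) + c0) * r ^ (Bf + (m + 1)) := by
    filter_upwards [hf_char, eventually_ge_atTop 1] with r hr hr1
    have h1 : Real.circleAverage (fun z ↦ max 0 (Q z).re) 0 r = proximity H ⊤ r := by
      rw [proximity_top]
      congr 1
      ext z
      rw [hHQ, Complex.norm_exp, Real.posLog, Real.log_exp]
    have h2 : proximity H ⊤ r ≤ characteristic H ⊤ r := by
      rw [characteristic, Pi.add_apply]
      linarith [logCounting_nonneg (f := H) (e := ⊤) hr1]
    have h3 : characteristic H ⊤ r = characteristic (f * P * Z⁻¹) ⊤ r :=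
      characteristic_congr_codiscrete
        (toMeromorphicNFOn_eqOn_codiscrete (meromorphicOn_univ.2 mG)).symm (by linarith)
    have h4 := characteristic_mul_top_le hr1 mfP (fun z ↦ by rw [ofP]; exact WithTop.coe_ne_top)
      (f₂ := Z⁻¹) (fun z ↦ (mZ z).inv) (fun z ↦ by rw [oZi]; exact WithTop.coe_ne_top)
    have h5 := characteristic_mul_top_le hr1 mf hne mP
      (fun z ↦ by rw [oP]; exact WithTop.coe_ne_top)
    have h6 := characteristic_le_of_norm_le_exp dP (B := fun x ↦ CP * (1 + x) ^ (m + 1)) hPb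
      (zero_le_one.trans hr1) (by positivity)
    have h7 := characteristic_le_of_norm_le_exp dZ (B := fun x ↦ CZ * (1 + x) ^ (m + 1)) hZb
      (zero_le_one.trans hr1) (by positivity)
    have h8 := (abs_le.1 (characteristic_sub_characteristic_inv_le (R := r) mZ)).1
    rw [Pi.add_apply] at h4 h5
    have e1 : r ^ Bf ≤ r ^ (Bf + (m + 1)) := pow_le_pow_right₀ hr1 (by omega)
    have e2 : (1 + r) ^ (m + 1) ≤ 2 ^ (m + 1) * r ^ (Bf + (m + 1)) := by
      calc (1 + r) ^ (m + 1) ≤ (2 * r) ^ (m + 1) := by gcongr; linarith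
        _ = 2 ^ (m + 1) * r ^ (m + 1) := mul_pow _ _ _
        _ ≤ _ := mul_le_mul_of_nonneg_left (pow_le_pow_right₀ hr1 (by omega)) (by positivity)
    have e3 : 1 ≤ r ^ (Bf + (m + 1)) := one_le_pow₀ hr1
    have e4 := mul_le_mul_of_nonneg_left e1 hCf
    have e5 := mul_le_mul_of_nonneg_left e2 (add_nonneg hCP hCZ)
    have e6 := mul_le_mul_of_nonneg_left e3 hc0'
    rw [h1]
    refine h2.trans ?_
    rw [h3]
    linarith
  obtain ⟨p, hp'⟩ := exists_polynomial_eq_of_circleAverage_le hQ hbound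
  refine ⟨p, fun s hs0 ↦ ?_⟩
  have hZs : Z s ≠ 0 := weierstrassProduct_ne_zero hz (zeroMult_eq_zero hs0)
  have hev : H =ᶠ[𝓝[≠] s] f * P * Z⁻¹ :=
    (meromorphicOn_univ.2 mG).toMeromorphicNFOn_eq_self_on_nhdsNE (Set.mem_univ s)
  have hcG : ContinuousAt (f * P * Z⁻¹) s :=
    ((hf.analyticAt hne hs0).continuousAt.mul dP.continuous.continuousAt).mul
      (dZ.continuous.continuousAt.inv₀ hZs)
  have heq : H s = (f * P * Z⁻¹) s := tendsto_nhds_unique_of_eventuallyEq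
    (dH.continuous.continuousAt.tendsto.mono_left nhdsWithin_le_nhds)
    (hcG.tendsto.mono_left nhdsWithin_le_nhds) hev
  rw [hHQ, hp'] at heq
  rw [heq]
  simp only [Pi.mul_apply, Pi.inv_apply]
  field_simp

/-! ### The convergence exponent -/

lemma abs_mult_eq_zero_or (f : ℂ → ℂ) (ρ : ℂ) :
    |(mult f ρ : ℝ)| = 0 ∨ 1 ≤ |(mult f ρ : ℝ)| := by
  rcases eq_or_ne (mult f ρ) 0 with h | h
  · left; simp [h]
  · right; exact_mod_cast Int.one_le_abs h

/-- The extra term at `ρ = 0` is a division by `0 ^ (m + 1) = 0` and hence zero; the positive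
exponent is essential. -/
lemma summable_mult_iff_subtype {f : ℂ → ℂ} {m : ℕ} :
    (Summable fun ρ : {ρ : ℂ // ρ ≠ 0} ↦ |(mult f ρ : ℝ)| / ‖(ρ : ℂ)‖ ^ (m + 1)) ↔
      Summable fun ρ : ℂ ↦ |(mult f ρ : ℝ)| / ‖ρ‖ ^ (m + 1) := by
  refine (Subtype.val_injective (p := fun ρ : ℂ ↦ ρ ≠ 0)).summable_iff
    (f := fun ρ : ℂ ↦ |(mult f ρ : ℝ)| / ‖ρ‖ ^ (m + 1)) fun x hx ↦ ?_
  have : x = 0 := by simpa using hx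
  simp [this]

/-- Moving the centre is harmless: `‖ρ‖ ≤ 2‖ρ - σ‖` for all but finitely many points of the divisor.
-/
lemma summable_mult_sub {f : ℂ → ℂ} {m : ℕ}
    (h : Summable fun ρ : ℂ ↦ |(mult f ρ : ℝ)| / ‖ρ‖ ^ (m + 1)) (σ : ℂ) :
    Summable fun ρ : ℂ ↦ |(mult f ρ : ℝ)| / ‖ρ - σ‖ ^ (m + 1) := by
  refine Summable.of_norm_bounded_eventually (h.mul_left (2 ^ (m + 1))) ?_
  filter_upwards [eventually_le_norm_of_summable h ((2 * ‖σ‖) ^ (m + 1)),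
    (Set.finite_singleton (0 : ℂ)).compl_mem_cofinite] with ρ hρ hρ0
  rcases abs_mult_eq_zero_or f ρ with h0 | h1
  · simp [h0]
  have hρ := hρ.resolve_right hρ0
  have h2 : 2 * ‖σ‖ < ‖ρ‖ := by
    refine lt_of_pow_lt_pow_left₀ (m + 1) (norm_nonneg _) ?_
    exact (le_mul_of_one_le_left (by positivity) h1).trans_lt hρ
  have hpos : 0 < ‖ρ‖ := by linarith [norm_nonneg σ]
  have h3 : ‖ρ‖ ≤ 2 * ‖ρ - σ‖ := by linarith [norm_sub_norm_le ρ σ]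
  have h4 : 0 < ‖ρ - σ‖ := by linarith
  rw [Real.norm_of_nonneg (by positivity), mul_div_assoc', div_le_div_iff₀ (by positivity)
    (by positivity)]
  have : ‖ρ‖ ^ (m + 1) ≤ 2 ^ (m + 1) * ‖ρ - σ‖ ^ (m + 1) := by
    rw [← mul_pow]; gcongr
  nlinarith [mul_le_mul_of_nonneg_left this (abs_nonneg (mult f ρ : ℝ))]

lemma summable_convExponent {f : ℂ → ℂ} (h : 1 ≤ convExponent f) :
    Summable fun ρ : ℂ ↦ |(mult f ρ : ℝ)| / ‖ρ‖ ^ (convExponent f - 1 + 1) := by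
  rw [← summable_mult_iff_subtype, Nat.sub_add_cancel h]
  -- The infimum of the empty set is `0`, so a positive value guarantees that some exponent works
  -- and that the infimum is attained.
  have hne : {d : ℕ | Summable fun ρ : {ρ : ℂ // ρ ≠ 0} ↦
      |(mult f ρ : ℝ)| / ‖(ρ : ℂ)‖ ^ d}.Nonempty := by
    by_contra hne
    rw [Set.not_nonempty_iff_eq_empty] at hne
    rw [convExponent, hne, Nat.sInf_empty] at h
    omega
  exact Nat.sInf_mem hne

/-- An identically vanishing function has zero divisor, hence convergence exponent `0`. -/
lemma order_ne_top_of_one_le_convExponent {f : ℂ → ℂ} (hf : IsMeromorphic f)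
    (h : 1 ≤ convExponent f) (z : ℂ) : meromorphicOrderAt f z ≠ ⊤ := by
  intro hz
  have h0 := mult_eq_zero_of_order_top hf hz
  have : convExponent f ≤ 0 := Nat.sInf_le (by simp [h0])
  omega

/-- A function in normal form takes the value `0` at its poles as well as at its zeros, so
nonvanishing detects the complement of the divisor. -/
lemma mult_eq_zero_iff {f : ℂ → ℂ} (hf : IsMeromorphic f)
    (hne : ∀ z, meromorphicOrderAt f z ≠ ⊤) {z : ℂ} : mult f z = 0 ↔ f z ≠ 0 := by
  rw [← (hf (Set.mem_univ z)).meromorphicOrderAt_eq_zero_iff,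
    meromorphicOrderAt_eq_mult hf hne]
  norm_cast

lemma eventually_mult_eq_zero {f : ℂ → ℂ} (hf : IsMeromorphic f)
    (hne : ∀ z, meromorphicOrderAt f z ≠ ⊤) {z : ℂ} (hz : mult f z = 0) :
    ∀ᶠ s in 𝓝 z, mult f s = 0 := by
  filter_upwards [(hf.analyticAt hne hz).continuousAt.eventually_ne (hf.ne_zero hne hz)] with s hs
  exact (mult_eq_zero_iff hf hne).2 hs

/-! ### Hadamard polynomials and partial fractions -/

/-- The relation between `f` and its zeros and poles expressed by the factorization with the
polynomial `Q`, without denominators. -/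
def IsFactorizationPolynomial (f : ℂ → ℂ) (m : ℕ) (σ : ℂ) (Q : Polynomial ℂ) : Prop :=
  ∀ s, mult f s = 0 → f s * weierstrassProduct m σ (poleMult f) s =
    Complex.exp (Q.eval s) * weierstrassProduct m σ (zeroMult f) s

lemma hasProd_elemFactor_zpow {f : ℂ → ℂ} {m : ℕ} {σ : ℂ}
    (hs : Summable fun ρ : ℂ ↦ |(mult f ρ : ℝ)| / ‖ρ - σ‖ ^ (m + 1)) {s : ℂ}
    (h0 : mult f s = 0) :
    HasProd (fun ρ : {ρ : ℂ // ρ ≠ σ} ↦ elemFactor m ((s - σ) / (ρ - σ)) ^ mult f ρ)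
      (canonicalProduct m (fun ρ ↦ ρ - σ) (zeroMult f) (s - σ) /
        canonicalProduct m (fun ρ ↦ ρ - σ) (poleMult f) (s - σ)) := by
  have hz := hasProd_canonicalProduct (summable_zeroMult hs) (s - σ)
  have hp := hasProd_canonicalProduct (summable_poleMult hs) (s - σ)
  have hp0 : canonicalProduct m (fun ρ ↦ ρ - σ) (poleMult f) (s - σ) ≠ 0 :=
    canonicalProduct_ne_zero (summable_poleMult hs) fun ρ hk _ h ↦ hk (by
      rw [← sub_left_injective h]; exact poleMult_eq_zero h0)
  refine ((Subtype.val_injective (p := fun ρ : ℂ ↦ ρ ≠ σ)).hasProd_iff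
    (f := fun ρ : ℂ ↦ elemFactor m ((s - σ) / (ρ - σ)) ^ mult f ρ) fun x hx ↦ ?_).2 ?_
  · have : x = σ := by simpa using hx
    simp [this, elemFactor_zero_right]
  · refine (hz.div₀ hp hp0).congr_fun fun ρ ↦ ?_
    by_cases hρ : mult f ρ = 0
    · simp [hρ, zeroMult_eq_zero, poleMult_eq_zero]
    have hE : elemFactor m ((s - σ) / (ρ - σ)) ≠ 0 := by
      rw [Ne, elemFactor_eq_zero_iff]
      intro h
      have hρσ : ρ - σ ≠ 0 := by rintro h'; simp [h'] at h
      rw [div_eq_one_iff_eq hρσ] at h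
      rw [sub_left_injective h] at h0
      exact hρ h0
    rw [mult_eq_zeroMult_sub_poleMult, zpow_sub₀ hE, zpow_natCast, zpow_natCast]

lemma isHadamardPolynomial_iff {f : ℂ → ℂ} {σ : ℂ} {Q : Polynomial ℂ}
    (hs : Summable fun ρ : ℂ ↦ |(mult f ρ : ℝ)| / ‖ρ - σ‖ ^ (convExponent f - 1 + 1)) :
    IsHadamardPolynomial f σ Q ↔ IsFactorizationPolynomial f (convExponent f - 1) σ Q := by
  refine forall₂_congr fun s h0 ↦ ?_
  have hprod := hasProd_elemFactor_zpow hs h0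
  rw [hprod.tprod_eq, and_iff_right hprod.multipliable]
  have hp0 : weierstrassProduct (convExponent f - 1) σ (poleMult f) s ≠ 0 :=
    weierstrassProduct_ne_zero (summable_poleMult hs) (poleMult_eq_zero h0)
  have hpow : (s - σ) ^ mult f σ = (s - σ) ^ zeroMult f σ / (s - σ) ^ poleMult f σ := by
    rcases eq_or_ne s σ with rfl | h
    · simp [h0, zeroMult_eq_zero, poleMult_eq_zero]
    · rw [mult_eq_zeroMult_sub_poleMult, zpow_sub₀ (sub_ne_zero.2 h), zpow_natCast, zpow_natCast]
  rw [hpow, ← eq_div_iff hp0, weierstrassProduct, weierstrassProduct]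
  have : (s - σ) ^ zeroMult f σ / (s - σ) ^ poleMult f σ * Complex.exp (Polynomial.eval s Q) *
      (canonicalProduct (convExponent f - 1) (fun ρ ↦ ρ - σ) (zeroMult f) (s - σ) /
        canonicalProduct (convExponent f - 1) (fun ρ ↦ ρ - σ) (poleMult f) (s - σ)) =
      Complex.exp (Polynomial.eval s Q) * ((s - σ) ^ zeroMult f σ *
        canonicalProduct (convExponent f - 1) (fun ρ ↦ ρ - σ) (zeroMult f) (s - σ)) /
      ((s - σ) ^ poleMult f σ *
        canonicalProduct (convExponent f - 1) (fun ρ ↦ ρ - σ) (poleMult f) (s - σ)) := by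
    rw [div_mul_eq_mul_div, div_mul_div_comm]
    ring
  rw [this]

theorem isHadamardPolynomial_hadamardPolynomial {f : ℂ → ℂ} (hf : IsMeromorphic f)
    (hfo : HasFiniteOrder f) (h : 1 ≤ convExponent f) (τ : ℂ) :
    IsHadamardPolynomial f τ (hadamardPolynomial f τ) := by
  have hs := summable_mult_sub (summable_convExponent h) τ
  have hex : ∃ Q, IsHadamardPolynomial f τ Q := by
    obtain ⟨Q, hQ⟩ := exists_hadamard_factorization hf hfo
      (order_ne_top_of_one_le_convExponent hf h) hs
    exact ⟨Q, (isHadamardPolynomial_iff hs).2 hQ⟩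
  rw [hadamardPolynomial, dif_pos hex]
  exact hex.choose_spec

/-- The summands of the partial fraction expansion of the logarithmic derivative. -/
def partialFraction (m : ℕ) (σ s ρ : ℂ) : ℂ :=
  (s - σ) ^ (m + 1) / (ρ - σ) ^ (m + 1) / (s - ρ) - (s - σ) ^ m / (ρ - σ) ^ (m + 1)

lemma partialFraction_eq (m : ℕ) (σ : ℂ) {s ρ : ℂ} (h : s ≠ ρ) :
    partialFraction m σ s ρ = (s - σ) ^ m * ((ρ - σ) / (s - ρ)) / (ρ - σ) ^ (m + 1) := by
  rcases eq_or_ne ρ σ with rfl | hρ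
  · simp [partialFraction]
  have h1 := sub_ne_zero.2 h
  have h2 := sub_ne_zero.2 hρ
  rw [partialFraction]
  field_simp
  ring

lemma logDeriv_weierstrassProduct {m : ℕ} {σ : ℂ} {k : ℂ → ℕ}
    (h : Summable fun ρ : ℂ ↦ (k ρ : ℝ) / ‖ρ - σ‖ ^ (m + 1)) {s : ℂ} (hs : k s = 0) :
    logDeriv (weierstrassProduct m σ k) s =
      k σ / (s - σ) + ∑' ρ, k ρ * partialFraction m σ s ρ := by
  have hd := differentiable_canonicalProduct h
  have hz : ∀ ρ : ℂ, k ρ ≠ 0 → ρ - σ ≠ 0 → s - σ ≠ ρ - σ := fun ρ hk _ h0 ↦ hk (by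
    rw [← sub_left_injective h0, hs])
  have hpow : (s - σ) ^ k σ ≠ 0 := by
    rcases eq_or_ne s σ with rfl | hsσ
    · simp [hs]
    · exact pow_ne_zero _ (sub_ne_zero.2 hsσ)
  have h1 := logDeriv_mul (f := fun s ↦ (s - σ) ^ k σ)
    (g := fun s ↦ canonicalProduct m (fun ρ ↦ ρ - σ) k (s - σ)) s hpow
    (canonicalProduct_ne_zero h hz) (by fun_prop) (by fun_prop)
  have h2 : logDeriv (fun s ↦ (s - σ) ^ k σ) s = k σ / (s - σ) := by
    rw [logDeriv_fun_pow (by fun_prop), logDeriv_apply, deriv_sub_const]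
    simp [div_eq_mul_inv]
  have h3 : logDeriv (fun s ↦ canonicalProduct m (fun ρ ↦ ρ - σ) k (s - σ)) s =
      logDeriv (canonicalProduct m (fun ρ ↦ ρ - σ) k) (s - σ) := by
    simp only [logDeriv_apply]
    rw [deriv_comp_sub_const]
  rw [h2, h3, logDeriv_canonicalProduct h hz] at h1
  simp only [sub_sub_sub_cancel_right] at h1
  exact h1

/-- Logarithmic differentiation of the factorization, which holds near `s` because the complement of
the divisor is open. The sums over zeros and over poles converge separately and are subtracted. -/
theorem hasSum_partialFraction {f : ℂ → ℂ} (hf : IsMeromorphic f)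
    (hne : ∀ z, meromorphicOrderAt f z ≠ ⊤) {m : ℕ} {σ : ℂ}
    (hs : Summable fun ρ : ℂ ↦ |(mult f ρ : ℝ)| / ‖ρ - σ‖ ^ (m + 1)) {Q : Polynomial ℂ}
    (hQ : IsFactorizationPolynomial f m σ Q) {s : ℂ} (h0 : mult f s = 0) :
    HasSum (fun ρ : ℂ ↦ mult f ρ * partialFraction m σ s ρ)
      (logDeriv f s - mult f σ / (s - σ) - Q.derivative.eval s) := by
  have hz := summable_zeroMult hs
  have hp := summable_poleMult hs
  have dP := differentiable_weierstrassProduct hp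
  have dZ := differentiable_weierstrassProduct hz
  have h1 : logDeriv (fun s ↦ f s * weierstrassProduct m σ (poleMult f) s) s =
      logDeriv (fun s ↦ Complex.exp (Q.eval s) * weierstrassProduct m σ (zeroMult f) s) s := by
    have hev : (fun s ↦ f s * weierstrassProduct m σ (poleMult f) s) =ᶠ[𝓝 s]
        fun s ↦ Complex.exp (Q.eval s) * weierstrassProduct m σ (zeroMult f) s := by
      filter_upwards [eventually_mult_eq_zero hf hne h0] with t ht using hQ t ht
    exact (logDeriv_congr_nhds hev).eq_of_nhds
  rw [logDeriv_mul s (hf.ne_zero hne h0) (weierstrassProduct_ne_zero hp (poleMult_eq_zero h0))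
    (hf.analyticAt hne h0).differentiableAt (dP s), logDeriv_mul (f := fun s ↦ Complex.exp (Q.eval s)) s
    (Complex.exp_ne_zero _)
    (weierstrassProduct_ne_zero hz (zeroMult_eq_zero h0)) (by fun_prop) (dZ s),
    logDeriv_weierstrassProduct hp (poleMult_eq_zero h0),
    logDeriv_weierstrassProduct hz (zeroMult_eq_zero h0)] at h1
  have h2 : logDeriv (fun s ↦ Complex.exp (Q.eval s)) s = Q.derivative.eval s := by
    have := (Q.hasDerivAt s).cexp
    rw [logDeriv_apply, this.deriv, mul_div_cancel_left₀ _ (Complex.exp_ne_zero _)]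
  have hnat : ∀ k : ℕ, (k : ℂ) = 0 ∨ 1 ≤ ‖(k : ℂ)‖ := fun k ↦ by
    rcases Nat.eq_zero_or_pos k with hk | hk
    · simp [hk]
    · right; rw [Complex.norm_natCast]; exact_mod_cast hk
  have s1 : Summable fun ρ : ℂ ↦ (zeroMult f ρ : ℂ) * partialFraction m σ s ρ := by
    have := summable_logDeriv_terms (c := fun ρ ↦ (zeroMult f ρ : ℂ)) (w := fun ρ ↦ ρ - σ)
      (m := m) (fun ρ ↦ hnat _) (by simpa using hz) (s - σ)
    simp only [sub_sub_sub_cancel_right] at this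
    exact this
  have s2 : Summable fun ρ : ℂ ↦ (poleMult f ρ : ℂ) * partialFraction m σ s ρ := by
    have := summable_logDeriv_terms (c := fun ρ ↦ (poleMult f ρ : ℂ)) (w := fun ρ ↦ ρ - σ)
      (m := m) (fun ρ ↦ hnat _) (by simpa using hp) (s - σ)
    simp only [sub_sub_sub_cancel_right] at this
    exact this
  have h3 := s1.hasSum.sub s2.hasSum
  have e : logDeriv f s - mult f σ / (s - σ) - Q.derivative.eval s =
      (∑' ρ, (zeroMult f ρ : ℂ) * partialFraction m σ s ρ) -
        ∑' ρ, (poleMult f ρ : ℂ) * partialFraction m σ s ρ := by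
    rw [h2] at h1
    rw [mult_eq_zeroMult_sub_poleMult]
    push_cast
    linear_combination h1
  rw [e]
  refine h3.congr_fun fun ρ ↦ ?_
  rw [mult_eq_zeroMult_sub_poleMult]
  push_cast
  ring

/-! ### Divisors in a left half plane -/

/-- The multiplicity is the residue `lim (z - ρ) f'(z)/f(z)`, which is `0` under continuity.
Consequently a half plane on which `logDeriv f` is holomorphic contains no point of the divisor. -/
lemma mult_eq_zero_of_continuousAt_logDeriv {f : ℂ → ℂ} (hf : IsMeromorphic f)
    (hne : ∀ z, meromorphicOrderAt f z ≠ ⊤) {ρ : ℂ} (hc : ContinuousAt (logDeriv f) ρ) :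
    mult f ρ = 0 := by
  obtain ⟨g, hg, hg0, hfg⟩ := (meromorphicOrderAt_ne_top_iff (hf.meromorphic ρ)).1 (hne ρ)
  rw [meromorphicOrderAt_eq_mult hf hne, WithTop.untop₀_coe] at hfg
  have hcg : ContinuousAt (logDeriv g) ρ := hg.deriv.continuousAt.div hg.continuousAt hg0
  have h1 : ∀ᶠ z in 𝓝[≠] ρ, (z - ρ) * logDeriv f z = mult f ρ + (z - ρ) * logDeriv g z := by
    filter_upwards [logDeriv_congr_nhdsNE hfg, self_mem_nhdsWithin,
      (hg.continuousAt.eventually_ne hg0).filter_mono nhdsWithin_le_nhds,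
      hg.eventually_analyticAt.filter_mono nhdsWithin_le_nhds] with z hz hzρ hgz hga
    have hzρ : z - ρ ≠ 0 := sub_ne_zero.2 hzρ
    have hd : DifferentiableAt ℂ (fun z ↦ (z - ρ) ^ mult f ρ) z :=
      DifferentiableAt.zpow (by fun_prop) (.inl hzρ)
    have h2 := logDeriv_mul (f := fun z ↦ (z - ρ) ^ mult f ρ) (g := g) z (zpow_ne_zero _ hzρ) hgz
      hd hga.differentiableAt
    have h3 : logDeriv (fun z ↦ (z - ρ) ^ mult f ρ) z = mult f ρ / (z - ρ) := by
      rw [logDeriv_fun_zpow (by fun_prop), logDeriv_apply, deriv_sub_const]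
      simp [div_eq_mul_inv]
    simp only [smul_eq_mul] at hz
    rw [hz, h2, h3, mul_add, mul_div_cancel₀ _ hzρ]
  have t0 : Tendsto (fun z ↦ z - ρ) (𝓝[≠] ρ) (𝓝 0) := by
    have : ContinuousAt (fun z : ℂ ↦ z - ρ) ρ := by fun_prop
    simpa using this.tendsto.mono_left nhdsWithin_le_nhds
  have t1 : Tendsto (fun z ↦ (z - ρ) * logDeriv f z) (𝓝[≠] ρ) (𝓝 0) := by
    simpa using t0.mul (hc.tendsto.mono_left nhdsWithin_le_nhds)
  have t2 : Tendsto (fun z ↦ mult f ρ + (z - ρ) * logDeriv g z) (𝓝[≠] ρ) (𝓝 (mult f ρ)) := by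
    simpa using (t0.mul (hcg.tendsto.mono_left nhdsWithin_le_nhds)).const_add (mult f ρ : ℂ)
  have := tendsto_nhds_unique (t1.congr' h1) t2
  exact_mod_cast this.symm

lemma mult_eq_zero_of_differentiableOn {f : ℂ → ℂ} (hf : IsMeromorphic f)
    (hne : ∀ z, meromorphicOrderAt f z ≠ ⊤) {σ₂ : ℝ}
    (hd : DifferentiableOn ℂ (logDeriv f) {s | σ₂ < s.re}) {ρ : ℂ} (hρ : σ₂ < ρ.re) :
    mult f ρ = 0 := by
  have hopen : IsOpen {s : ℂ | σ₂ < s.re} := isOpen_lt continuous_const Complex.continuous_re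
  exact mult_eq_zero_of_continuousAt_logDeriv hf hne
    (hd.differentiableAt (hopen.mem_nhds hρ)).continuousAt

lemma norm_polynomial_eval_le (p : Polynomial ℂ) {s : ℂ} (hs : 1 ≤ ‖s‖) :
    ‖p.eval s‖ ≤ (∑ i ∈ Finset.range (p.natDegree + 1), ‖p.coeff i‖) * ‖s‖ ^ p.natDegree := by
  rw [Polynomial.eval_eq_sum_range, Finset.sum_mul]
  refine (norm_sum_le _ _).trans (Finset.sum_le_sum fun i hi ↦ ?_)
  rw [norm_mul, norm_pow]
  gcongr
  have := Finset.mem_range.1 hi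
  omega

lemma norm_div_sub_le {s ρ σ : ℂ} (h : s ≠ ρ) :
    ‖(ρ - σ) / (s - ρ)‖ ≤ 1 + ‖s - σ‖ / ‖s - ρ‖ := by
  have h0 : 0 < ‖s - ρ‖ := norm_pos_iff.2 (sub_ne_zero.2 h)
  rw [norm_div, div_le_iff₀ h0, add_mul, div_mul_cancel₀ _ h0.ne', one_mul]
  have := norm_sub_le (s - σ) (s - ρ)
  rw [sub_sub_sub_cancel_left] at this
  linarith

lemma norm_mult_mul_partialFraction_le {f : ℂ → ℂ} {m : ℕ} {σ s ρ : ℂ} {A : ℝ} (h : s ≠ ρ)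
    (hA : ‖(ρ - σ) / (s - ρ)‖ ≤ A) :
    ‖mult f ρ * partialFraction m σ s ρ‖ ≤
      ‖s - σ‖ ^ m * A * (|(mult f ρ : ℝ)| / ‖ρ - σ‖ ^ (m + 1)) := by
  rw [partialFraction_eq m σ h, norm_mul, Complex.norm_intCast, norm_div, norm_mul, norm_pow,
    norm_pow, mul_div_assoc', mul_div_assoc', mul_comm |(mult f ρ : ℝ)|]
  gcongr

/-- At distance at least `1` from the divisor, `‖ρ/(s-ρ)‖ ≤ 1 + ‖s‖`, so the partial fraction series
is `O(‖s‖^(m+1))`; the polynomial `Q'` is added. -/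
theorem exists_laplaceAdmissible {f : ℂ → ℂ} (hf : IsMeromorphic f)
    (hne : ∀ z, meromorphicOrderAt f z ≠ ⊤) {m : ℕ}
    (hs : Summable fun ρ : ℂ ↦ |(mult f ρ : ℝ)| / ‖ρ‖ ^ (m + 1)) {Q : Polynomial ℂ}
    (hQ : IsFactorizationPolynomial f m 0 Q) (hl : DivisorInLeftHalfPlane f) :
    ∃ (N : ℕ) (c : ℝ), LaplaceAdmissible (logDeriv f) N c := by
  obtain ⟨σ₁, hσ₁⟩ := hl
  set p := Q.derivative with hp
  set S := ∑' ρ : ℂ, |(mult f ρ : ℝ)| / ‖ρ‖ ^ (m + 1) with hS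
  set A := ∑ i ∈ Finset.range (p.natDegree + 1), ‖p.coeff i‖ with hA
  have hA0 : 0 ≤ A := Finset.sum_nonneg fun _ _ ↦ norm_nonneg _
  have hS0 : 0 ≤ S := tsum_nonneg fun _ ↦ by positivity
  set N := m + 1 + p.natDegree with hN
  have hσ₂ : σ₁ + 1 ≤ max σ₁ 0 + 1 := by linarith [le_max_left σ₁ 0]
  have hσ₂' : 1 ≤ max σ₁ 0 + 1 := by linarith [le_max_right σ₁ 0]
  have h0 : ∀ s : ℂ, max σ₁ 0 + 1 < s.re → mult f s = 0 := fun s hs ↦ by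
    by_contra h
    linarith [hσ₁ s h]
  -- The half plane starts one unit to the right of both the divisor bound and `0`, so that `‖s - ρ‖
  -- ≥ 1` and `‖s‖ ≥ 1`. The exponent `N + 2` compensates the factor `‖s‖^(-2)` in the growth
  -- condition.
  refine ⟨N + 2, max σ₁ 0 + 2, max σ₁ 0 + 1, |(mult f 0 : ℝ)| + A + S * 2, by positivity,
    by linarith, fun s hs' ↦ ?_, fun s hs' ↦ ?_⟩
  · have ha := hf.analyticAt hne (h0 s hs')
    exact (ha.deriv.differentiableAt.div ha.differentiableAt
      (hf.ne_zero hne (h0 s hs'))).differentiableWithinAt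
  · have hre := Complex.re_le_norm s
    have hs1 : 1 ≤ ‖s‖ := by linarith
    have hsum := hasSum_partialFraction hf hne (σ := 0) (by simpa using hs) hQ (h0 s hs')
    have hb : ∀ ρ : ℂ, ‖mult f ρ * partialFraction m 0 s ρ‖ ≤
        ‖s‖ ^ m * (1 + ‖s‖) * (|(mult f ρ : ℝ)| / ‖ρ‖ ^ (m + 1)) := by
      intro ρ
      by_cases hρ : mult f ρ = 0
      · simp [hρ]
      have h1 : 1 ≤ ‖s - ρ‖ := by
        have := Complex.re_le_norm (s - ρ)
        rw [Complex.sub_re] at this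
        linarith [hσ₁ ρ hρ]
      have h2 : s ≠ ρ := by rintro rfl; simp at h1; linarith
      have := norm_mult_mul_partialFraction_le (f := f) (m := m) (σ := 0) h2
        ((norm_div_sub_le h2).trans (add_le_add_right (div_le_self (norm_nonneg _) h1) 1))
      simpa using this
    have hb2 := hsum.tsum_eq ▸ tsum_of_norm_bounded
      (hs.hasSum.mul_left (‖s‖ ^ m * (1 + ‖s‖))) hb
    have hb3 := norm_polynomial_eval_le p hs1
    have hb4 : ‖(mult f 0 : ℂ) / (s - 0)‖ ≤ |(mult f 0 : ℝ)| := by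
      rw [sub_zero, norm_div, Complex.norm_intCast]
      exact div_le_self (abs_nonneg _) hs1
    have hb5 : ‖logDeriv f s‖ ≤ ‖s‖ ^ m * (1 + ‖s‖) * S + |(mult f 0 : ℝ)| +
        A * ‖s‖ ^ p.natDegree := by
      have e : logDeriv f s = (logDeriv f s - mult f 0 / (s - 0) - p.eval s) +
        mult f 0 / (s - 0) + p.eval s := by ring
      rw [e]
      refine (norm_add₃_le).trans ?_
      linarith
    refine hb5.trans ?_
    have hpos : (0 : ℝ) < ‖s‖ ^ 2 := by positivity
    rw [le_div_iff₀ hpos, pow_add ‖s‖ N 2, ← mul_assoc]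
    gcongr
    have e1 : ‖s‖ ^ p.natDegree ≤ ‖s‖ ^ N := pow_le_pow_right₀ hs1 (by omega)
    have e2 : ‖s‖ ^ m * (1 + ‖s‖) ≤ 2 * ‖s‖ ^ N := by
      calc ‖s‖ ^ m * (1 + ‖s‖) ≤ ‖s‖ ^ m * (2 * ‖s‖) := by gcongr; linarith
        _ = 2 * ‖s‖ ^ (m + 1) := by ring
        _ ≤ 2 * ‖s‖ ^ N := by
          gcongr 2 * ?_
          exact pow_le_pow_right₀ hs1 (by omega)
    have e3 : 1 ≤ ‖s‖ ^ N := one_le_pow₀ hs1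
    nlinarith [mul_le_mul_of_nonneg_right e2 hS0, mul_le_mul_of_nonneg_left e1 hA0,
      mul_le_mul_of_nonneg_left e3 (abs_nonneg (mult f 0 : ℝ))]

/-! ### Asymptotics on the real axis and the degree of the discrepancy polynomial -/

lemma tendsto_polynomial_div_pow (p : Polynomial ℂ) :
    Tendsto (fun x : ℝ ↦ p.eval (x : ℂ) / (x : ℂ) ^ p.natDegree) atTop (𝓝 p.leadingCoeff) := by
  have h1 : ∀ i ∈ Finset.range (p.natDegree + 1),
      Tendsto (fun x : ℝ ↦ p.coeff i * (x : ℂ) ^ i / (x : ℂ) ^ p.natDegree) atTop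
        (𝓝 (if i = p.natDegree then p.coeff i else 0)) := by
    intro i hi
    split_ifs with h
    · refine tendsto_const_nhds.congr' ?_
      filter_upwards [eventually_gt_atTop 0] with x hx
      have : (x : ℂ) ≠ 0 := by exact_mod_cast hx.ne'
      rw [h, mul_div_cancel_right₀ _ (pow_ne_zero _ this)]
    · have hi' : i < p.natDegree := by
        have := Finset.mem_range.1 hi
        omega
      have := tendsto_pow_div_pow_atTop_zero (𝕜 := ℝ) hi'
      have := (Complex.continuous_ofReal.tendsto 0).comp this
      have := this.const_mul (p.coeff i)
      simp only [Complex.ofReal_zero, mul_zero] at this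
      refine this.congr fun x ↦ ?_
      simp [mul_div_assoc]
  have h2 := tendsto_finsetSum _ h1
  simp only [Finset.sum_ite_eq', Finset.mem_range, Nat.lt_succ_self, if_true] at h2
  refine h2.congr fun x ↦ ?_
  rw [Polynomial.eval_eq_sum_range, Finset.sum_div]

lemma coeff_eq_zero_of_tendsto {p : Polynomial ℂ} {m : ℕ}
    (h : Tendsto (fun x : ℝ ↦ p.eval (x : ℂ) / (x : ℂ) ^ m) atTop (𝓝 0)) {j : ℕ} (hj : m ≤ j) :
    p.coeff j = 0 := by
  by_contra hc
  have hn : m ≤ p.natDegree := hj.trans (Polynomial.le_natDegree_of_ne_zero hc)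
  have h1 := tendsto_polynomial_div_pow p
  have h2 : Tendsto (fun x : ℝ ↦ p.eval (x : ℂ) / (x : ℂ) ^ p.natDegree) atTop (𝓝 0) := by
    rw [tendsto_zero_iff_norm_tendsto_zero] at h ⊢
    refine squeeze_zero' (.of_forall fun _ ↦ norm_nonneg _) ?_ h
    filter_upwards [eventually_ge_atTop 1] with x hx
    simp only [norm_div, norm_pow, Complex.norm_real, Real.norm_of_nonneg (zero_le_one.trans hx)]
    gcongr
  have h3 := tendsto_nhds_unique h1 h2
  rw [Polynomial.leadingCoeff_eq_zero] at h3
  simp [h3] at hc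

/-- After division by `x^m` each partial fraction is `O(1/|x-ρ|)`. The divisor lies in a left half
plane, so `|x-ρ| ≥ x/2`; with `|x-σ| ≤ 2x` this gives `|(ρ-σ)/(x-ρ)| ≤ 1 + 4 = 5` and a summable
majorant. -/
lemma tendsto_logDeriv_sub_div_pow {f : ℂ → ℂ} (hf : IsMeromorphic f)
    (hne : ∀ z, meromorphicOrderAt f z ≠ ⊤) {m : ℕ} {σ : ℂ}
    (hs : Summable fun ρ : ℂ ↦ |(mult f ρ : ℝ)| / ‖ρ - σ‖ ^ (m + 1)) {Q : Polynomial ℂ}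
    (hQ : IsFactorizationPolynomial f m σ Q) (hl : DivisorInLeftHalfPlane f) :
    Tendsto (fun x : ℝ ↦ (logDeriv f x - Q.derivative.eval (x : ℂ)) / (x : ℂ) ^ m) atTop
      (𝓝 0) := by
  obtain ⟨σ₁, hσ₁⟩ := hl
  have hlarge : ∀ᶠ x : ℝ in atTop, 1 ≤ x ∧ ‖σ‖ ≤ x ∧ 2 * |σ₁| + 1 ≤ x :=
    (eventually_ge_atTop _).and ((eventually_ge_atTop _).and (eventually_ge_atTop _))
  have hinv : ∀ ρ : ℂ, Tendsto (fun x : ℝ ↦ ‖(x : ℂ) - ρ‖⁻¹) atTop (𝓝 0) := fun ρ ↦ by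
    refine Tendsto.inv_tendsto_atTop (tendsto_atTop_mono (f := fun x : ℝ ↦ x - ‖ρ‖) (fun x ↦ ?_)
      (tendsto_atTop_add_const_right _ _ tendsto_id))
    have := norm_sub_norm_le (x : ℂ) ρ
    rw [Complex.norm_real] at this
    linarith [le_abs_self x, Real.norm_eq_abs x]
  have hratio : ∀ x : ℝ, 1 ≤ x → ‖σ‖ ≤ x → ‖(x : ℂ) - σ‖ ≤ 2 * x := fun x hx hxσ ↦ by
    have := norm_sub_le (x : ℂ) σ
    rw [Complex.norm_real, Real.norm_of_nonneg (by linarith)] at this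
    linarith
  have hxn : ∀ x : ℝ, 1 ≤ x → ‖(x : ℂ)‖ = x := fun x hx ↦ by
    rw [Complex.norm_real, Real.norm_of_nonneg (by linarith)]
  have hT : Tendsto (fun x : ℝ ↦ ∑' ρ : ℂ, mult f ρ * partialFraction m σ x ρ / (x : ℂ) ^ m)
      atTop (𝓝 (∑' _ : ℂ, (0 : ℂ))) := by
    refine tendsto_tsum_of_dominated_convergence
      (bound := fun ρ ↦ 2 ^ m * 5 * (|(mult f ρ : ℝ)| / ‖ρ - σ‖ ^ (m + 1)))
      (hs.mul_left _) (fun ρ ↦ ?_) ?_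
    · refine squeeze_zero_norm' (a := fun x : ℝ ↦ 2 ^ m * (‖ρ - σ‖ * ‖(x : ℂ) - ρ‖⁻¹) *
        (|(mult f ρ : ℝ)| / ‖ρ - σ‖ ^ (m + 1))) ?_ ?_
      · filter_upwards [hlarge, eventually_gt_atTop ‖ρ‖] with x hx hxρ
        have h2 : (x : ℂ) ≠ ρ := by
          rintro rfl
          rw [hxn x hx.1] at hxρ
          exact lt_irrefl _ hxρ
        have h3 := norm_mult_mul_partialFraction_le (f := f) (m := m) (σ := σ) h2 le_rfl
        rw [norm_div (ρ - σ), div_eq_mul_inv ‖ρ - σ‖] at h3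
        rw [norm_div, norm_pow, hxn x hx.1, div_le_iff₀ (by have := hx.1; positivity)]
        refine h3.trans ?_
        have h4 : ‖(x : ℂ) - σ‖ ^ m ≤ 2 ^ m * x ^ m := by
          rw [← mul_pow]; gcongr; exact hratio x hx.1 hx.2.1
        calc _ ≤ 2 ^ m * x ^ m * (‖ρ - σ‖ * ‖(x : ℂ) - ρ‖⁻¹) *
              (|(mult f ρ : ℝ)| / ‖ρ - σ‖ ^ (m + 1)) := by gcongr
          _ = _ := by ring
      · simpa using (((hinv ρ).const_mul ‖ρ - σ‖).const_mul (2 ^ m)).mul_const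
          (|(mult f ρ : ℝ)| / ‖ρ - σ‖ ^ (m + 1))
    · filter_upwards [hlarge] with x hx ρ
      by_cases hρ : mult f ρ = 0
      · simp [hρ]
      have h1 : x / 2 ≤ ‖(x : ℂ) - ρ‖ := by
        have := Complex.re_le_norm ((x : ℂ) - ρ)
        rw [Complex.sub_re, Complex.ofReal_re] at this
        linarith [hσ₁ ρ hρ, le_abs_self σ₁, hx.2.2]
      have hx0 : 0 < x := by linarith [hx.1]
      have h2 : (x : ℂ) ≠ ρ := by
        intro h; rw [h, sub_self, norm_zero] at h1; linarith
      have h5 : ‖(ρ - σ) / ((x : ℂ) - ρ)‖ ≤ 5 := by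
        refine (norm_div_sub_le h2).trans ?_
        have : ‖(x : ℂ) - σ‖ / ‖(x : ℂ) - ρ‖ ≤ 4 := by
          rw [div_le_iff₀ (by linarith)]
          linarith [hratio x hx.1 hx.2.1]
        linarith
      have h3 := norm_mult_mul_partialFraction_le (f := f) (m := m) (σ := σ) h2 h5
      rw [norm_div, norm_pow, hxn x hx.1, div_le_iff₀ (by positivity)]
      refine h3.trans ?_
      have h4 : ‖(x : ℂ) - σ‖ ^ m ≤ 2 ^ m * x ^ m := by
        rw [← mul_pow]; gcongr; exact hratio x hx.1 hx.2.1
      calc _ ≤ 2 ^ m * x ^ m * 5 * (|(mult f ρ : ℝ)| / ‖ρ - σ‖ ^ (m + 1)) := by gcongr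
        _ = _ := by ring
  rw [tsum_zero] at hT
  have hn : Tendsto (fun x : ℝ ↦ (mult f σ : ℂ) / ((x : ℂ) - σ) / (x : ℂ) ^ m) atTop (𝓝 0) := by
    refine squeeze_zero_norm' (a := fun x : ℝ ↦ |(mult f σ : ℝ)| * ‖(x : ℂ) - σ‖⁻¹) ?_ ?_
    · filter_upwards [hlarge] with x hx
      rw [norm_div, norm_div, Complex.norm_intCast, norm_pow, hxn x hx.1, ← div_eq_mul_inv]
      exact div_le_self (by positivity) (one_le_pow₀ hx.1)
    · simpa using (hinv σ).const_mul |(mult f σ : ℝ)|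
  have hsum := hT.add hn
  rw [add_zero] at hsum
  refine hsum.congr' ?_
  filter_upwards [hlarge] with x hx
  have h0 : mult f x = 0 := by
    by_contra h
    have := hσ₁ x h
    rw [Complex.ofReal_re] at this
    linarith [hx.2.2, le_abs_self σ₁, abs_nonneg σ₁]
  rw [tsum_div_const, (hasSum_partialFraction hf hne hs hQ h0).tsum_eq]
  ring

/-- The genus refers to the centre `0`. On the real axis `Q_0'` and `Q_σ'` both approximate `f'/f`
up to `o(x^m)`, so their difference has no coefficient of index `m ≤ g` or more, and neither has
`Q_0'` from index `g` on. -/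
theorem discrepancyPolynomial_coeff_eq_zero {f : ℂ → ℂ} (hf : IsMeromorphic f)
    (hfo : HasFiniteOrder f) (h : 1 ≤ convExponent f) (hl : DivisorInLeftHalfPlane f) (σ : ℂ)
    {j : ℕ} (hj : genus f ≤ j) : (discrepancyPolynomial f σ).coeff j = 0 := by
  have hne := order_ne_top_of_one_le_convExponent hf h
  have hs := summable_convExponent h
  have key : ∀ τ, Tendsto (fun x : ℝ ↦
      (logDeriv f x - (hadamardPolynomial f τ).derivative.eval (x : ℂ)) /
        (x : ℂ) ^ (convExponent f - 1)) atTop (𝓝 0) := fun τ ↦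
    tendsto_logDeriv_sub_div_pow hf hne (summable_mult_sub hs τ)
      ((isHadamardPolynomial_iff (summable_mult_sub hs τ)).1
        (isHadamardPolynomial_hadamardPolynomial hf hfo h τ)) hl
  have h1 := (key 0).sub (key σ)
  rw [sub_zero] at h1
  have h2 := coeff_eq_zero_of_tendsto (m := convExponent f - 1) (j := j)
    (p := (hadamardPolynomial f σ).derivative - (hadamardPolynomial f 0).derivative)
    (h1.congr fun x ↦ by rw [Polynomial.eval_sub]; ring) ((le_max_right _ _).trans hj)
  have h3 : (hadamardPolynomial f 0).derivative.coeff j = 0 := by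
    rw [Polynomial.coeff_derivative, Polynomial.coeff_eq_zero_of_natDegree_lt, zero_mul]
    exact Nat.lt_succ_of_le ((le_max_left _ _).trans hj)
  rw [Polynomial.coeff_sub, h3, sub_zero] at h2
  rw [discrepancyPolynomial, Polynomial.coeff_neg, h2, neg_zero]

/-! ### Laplace transforms of smooth functions with compact support -/

/-- The two-sided Laplace transform `∫ e^{zt} ψ(t) dt`. -/
def laplace (ψ : ℝ → ℂ) (z : ℂ) : ℂ := ∫ t : ℝ, Complex.exp (z * t) * ψ t

lemma hasCompactSupport_iterate_deriv {ψ : ℝ → ℂ} (hc : HasCompactSupport ψ) (k : ℕ) :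
    HasCompactSupport (deriv^[k] ψ) := by
  induction k with
  | zero => exact hc
  | succ k ih => rw [Function.iterate_succ_apply']; exact ih.deriv

lemma contDiff_deriv {ψ : ℝ → ℂ} (hψ : ContDiff ℝ ∞ ψ) : ContDiff ℝ ∞ (deriv ψ) := by
  simpa using ContDiff.iterate_deriv 1 hψ

lemma contDiff_differentiable {ψ : ℝ → ℂ} (hψ : ContDiff ℝ ∞ ψ) : Differentiable ℝ ψ :=
  hψ.differentiable (by simp)

lemma hasDerivAt_exp_mul_ofReal (z : ℂ) (t : ℝ) :
    HasDerivAt (fun t : ℝ ↦ Complex.exp (z * t)) (z * Complex.exp (z * t)) t := by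
  have h := (((hasDerivAt_id (t : ℂ)).const_mul z).cexp).comp_ofReal
  simpa [mul_comm] using h

lemma integrable_exp_mul {ψ : ℝ → ℂ} (hψ : Continuous ψ) (hc : HasCompactSupport ψ) (z : ℂ) :
    Integrable fun t : ℝ ↦ Complex.exp (z * t) * ψ t :=
  (Continuous.mul (by fun_prop) hψ).integrable_of_hasCompactSupport hc.mul_left

lemma laplace_deriv {ψ : ℝ → ℂ} (hψ : ContDiff ℝ ∞ ψ) (hc : HasCompactSupport ψ) (z : ℂ) :
    laplace (deriv ψ) z = -z * laplace ψ z := by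
  have h := integral_mul_deriv_eq_deriv_mul_of_integrable
    (u := fun t : ℝ ↦ Complex.exp (z * t)) (v := ψ)
    (fun t _ ↦ hasDerivAt_exp_mul_ofReal z t)
    (fun t _ ↦ (contDiff_differentiable hψ t).hasDerivAt)
    (integrable_exp_mul (contDiff_deriv hψ).continuous hc.deriv z)
    (by
      have := (integrable_exp_mul hψ.continuous hc z).const_mul z
      refine this.congr (.of_forall fun t ↦ ?_)
      simp only [Pi.mul_apply]
      ring)
    (integrable_exp_mul hψ.continuous hc z)
  rw [laplace, h, laplace, neg_mul, ← integral_const_mul]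
  simp only [mul_assoc]

lemma laplace_iterate_deriv {ψ : ℝ → ℂ} (hψ : ContDiff ℝ ∞ ψ) (hc : HasCompactSupport ψ) (k : ℕ)
    (z : ℂ) : laplace (deriv^[k] ψ) z = (-z) ^ k * laplace ψ z := by
  induction k with
  | zero => simp
  | succ k ih =>
    rw [Function.iterate_succ_apply', laplace_deriv (ContDiff.iterate_deriv k hψ)
      (hasCompactSupport_iterate_deriv hc k), ih]
    ring

lemma norm_exp_mul_ofReal (z : ℂ) (t : ℝ) : ‖Complex.exp (z * t)‖ = Real.exp (z.re * t) := by
  rw [Complex.norm_exp, Complex.re_mul_ofReal]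

/-- The point `x + iu` of the vertical line through `x`. -/
abbrev vert (x u : ℝ) : ℂ := x + Complex.I * u

lemma vert_re (x u : ℝ) : (vert x u).re = x := by simp [vert]

lemma vert_im (x u : ℝ) : (vert x u).im = u := by simp [vert]

lemma continuous_vert (x : ℝ) : Continuous (vert x) := by unfold vert; fun_prop

lemma exists_norm_laplace_le {ψ : ℝ → ℂ} (x : ℝ) :
    ∃ C, ∀ u : ℝ, ‖laplace ψ (vert x u)‖ ≤ C :=
  ⟨∫ t : ℝ, ‖Complex.exp (x * t)‖ * ‖ψ t‖, fun u ↦ by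
    refine (norm_integral_le_integral_norm _).trans (le_of_eq ?_)
    simp only [norm_mul, norm_exp_mul_ofReal, vert_re, Complex.ofReal_re]⟩

/-- Differentiating `ψ` multiplies its transform by `-z`; two derivatives beyond the `k`-th supply
the integrable factor `(1 + u²)⁻¹`. -/
lemma exists_norm_pow_mul_laplace_le {ψ : ℝ → ℂ} (hψ : ContDiff ℝ ∞ ψ)
    (hc : HasCompactSupport ψ) (x : ℝ) (k : ℕ) :
    ∃ C, ∀ u : ℝ, ‖vert x u‖ ^ k * ‖laplace ψ (vert x u)‖ ≤ C * (1 + u ^ 2)⁻¹ := by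
  obtain ⟨C, hC⟩ := exists_norm_laplace_le (ψ := deriv^[k] ψ) x
  obtain ⟨C', hC'⟩ := exists_norm_laplace_le (ψ := deriv^[k + 2] ψ) x
  refine ⟨C + C', fun u ↦ ?_⟩
  have h1 := hC u
  have h2 := hC' u
  rw [laplace_iterate_deriv hψ hc, norm_mul, norm_pow, norm_neg] at h1 h2
  have h3 : u ^ 2 ≤ ‖vert x u‖ ^ 2 := by
    have := Complex.abs_im_le_norm (vert x u)
    rw [vert_im] at this
    rw [← sq_abs]
    gcongr
  rw [← div_eq_mul_inv, le_div_iff₀ (by positivity), mul_add, mul_one]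
  refine add_le_add h1 (le_trans ?_ h2)
  rw [pow_add, mul_right_comm]
  gcongr

lemma continuous_laplace_vert {ψ : ℝ → ℂ} (hψ : ContDiff ℝ ∞ ψ) (hc : HasCompactSupport ψ)
    (x : ℝ) : Continuous fun u : ℝ ↦ laplace ψ (vert x u) := by
  refine continuous_of_dominated (bound := fun t : ℝ ↦ ‖Complex.exp (x * t) * ψ t‖)
    (fun u ↦ (integrable_exp_mul hψ.continuous hc _).aestronglyMeasurable) (fun u ↦ ?_)
    (integrable_exp_mul hψ.continuous hc x).norm (.of_forall fun t ↦ ?_)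
  · refine .of_forall fun t ↦ ?_
    simp only [norm_mul, norm_exp_mul_ofReal, vert_re, Complex.ofReal_re, le_refl]
  · have := continuous_vert x
    fun_prop

lemma integrable_laplace_mul {ψ : ℝ → ℂ} (hψ : ContDiff ℝ ∞ ψ) (hc : HasCompactSupport ψ)
    (x : ℝ) {G : ℝ → ℂ} (hG : AEStronglyMeasurable G) {A : ℝ} {k : ℕ}
    (hA : ∀ u, ‖G u‖ ≤ A * ‖vert x u‖ ^ k) :
    Integrable fun u : ℝ ↦ G u * laplace ψ (vert x u) := by
  obtain ⟨C, hC⟩ := exists_norm_pow_mul_laplace_le hψ hc x k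
  refine (integrable_inv_one_add_sq.const_mul (|A| * C)).mono'
    (hG.mul (continuous_laplace_vert hψ hc x).aestronglyMeasurable) (.of_forall fun u ↦ ?_)
  rw [norm_mul]
  calc ‖G u‖ * ‖laplace ψ (vert x u)‖ ≤ |A| * ‖vert x u‖ ^ k * ‖laplace ψ (vert x u)‖ := by
        gcongr
        exact (hA u).trans (by gcongr; exact le_abs_self A)
    _ ≤ |A| * (C * (1 + u ^ 2)⁻¹) := by
        rw [mul_assoc]
        exact mul_le_mul_of_nonneg_left (hC u) (abs_nonneg A)
    _ = _ := by ring

lemma integrable_laplace_vert {ψ : ℝ → ℂ} (hψ : ContDiff ℝ ∞ ψ) (hc : HasCompactSupport ψ)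
    (x : ℝ) : Integrable fun u : ℝ ↦ laplace ψ (vert x u) := by
  simpa using integrable_laplace_mul hψ hc x (G := fun _ ↦ 1) (A := 1) (k := 0)
    aestronglyMeasurable_const (by simp)

/-- On the line `Re z = x` the transform is the Fourier transform of `e^{xt} ψ(t)` with `u = -2πw`,
so this is Fourier inversion. -/
lemma integral_laplace_mul_exp {ψ : ℝ → ℂ} (hψ : ContDiff ℝ ∞ ψ) (hc : HasCompactSupport ψ)
    (x t : ℝ) :
    (1 / (2 * Real.pi) : ℂ) * ∫ u : ℝ, laplace ψ (vert x u) * Complex.exp (-vert x u * t) =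
      ψ t := by
  set g : ℝ → ℂ := fun t ↦ Complex.exp (x * t) * ψ t with hg
  have hgc : Continuous g := Continuous.mul (by fun_prop) hψ.continuous
  have hgi : Integrable g := integrable_exp_mul hψ.continuous hc x
  have hF : ∀ w : ℝ, FourierTransform.fourier g w = laplace ψ (vert x (-2 * Real.pi * w)) := by
    intro w
    rw [Real.fourier_real_eq_integral_exp_smul, laplace]
    congr 1 with v
    rw [hg, smul_eq_mul, ← mul_assoc, ← Complex.exp_add]
    congr 2
    simp only [vert]
    push_cast
    ring
  have hpi : (-2 * Real.pi) ≠ 0 := by simp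
  have hFi : Integrable (FourierTransform.fourier g) := by
    simp_rw [funext hF]
    exact (integrable_laplace_vert hψ hc x).comp_mul_left' hpi
  have hinv := congrFun (hgc.fourierInv_fourier_eq hgi hFi) t
  rw [Real.fourierInv_eq'] at hinv
  simp only [RCLike.inner_apply, conj_trivial, smul_eq_mul, hF] at hinv
  have hsub := Measure.integral_comp_mul_left
    (fun u : ℝ ↦ Complex.exp (-(Complex.I * u * t)) * laplace ψ (vert x u)) (-2 * Real.pi)
  have hcong : ∀ w : ℝ, Complex.exp (↑(2 * Real.pi * (t * w)) * Complex.I) *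
      laplace ψ (vert x (-2 * Real.pi * w)) =
      Complex.exp (-(Complex.I * ((-2 * Real.pi * w : ℝ) : ℂ) * t)) *
        laplace ψ (vert x (-2 * Real.pi * w)) := fun w ↦ by
    congr 2
    push_cast
    ring
  simp only [hcong] at hinv
  rw [hsub] at hinv
  have habs : |(-2 * Real.pi)⁻¹| = 1 / (2 * Real.pi) := by
    rw [abs_inv, abs_mul, abs_neg, abs_of_pos Real.pi_pos]
    norm_num
  rw [habs] at hinv
  have hfin : ∀ u : ℝ, laplace ψ (vert x u) * Complex.exp (-vert x u * t) =
      Complex.exp (-(x * t)) * (Complex.exp (-(Complex.I * u * t)) * laplace ψ (vert x u)) := by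
    intro u
    rw [← mul_assoc, ← Complex.exp_add, mul_comm]
    congr 2
    simp only [vert]
    ring
  simp only [hfin]
  rw [integral_const_mul, ← mul_assoc, mul_comm _ (Complex.exp _), mul_assoc]
  have e : ((1 / (2 * Real.pi) : ℝ) • ∫ u : ℝ, Complex.exp (-(Complex.I * u * t)) *
      laplace ψ (vert x u)) = (1 / (2 * Real.pi) : ℂ) * ∫ u : ℝ,
        Complex.exp (-(Complex.I * u * t)) * laplace ψ (vert x u) := by
    rw [Complex.real_smul]
    push_cast
    rfl
  rw [← e, hinv, hg, ← mul_assoc, ← Complex.exp_add]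
  simp

lemma integral_pow_mul_laplace {ψ : ℝ → ℂ} (hψ : ContDiff ℝ ∞ ψ) (hc : HasCompactSupport ψ)
    (x : ℝ) (j : ℕ) :
    (1 / (2 * Real.pi) : ℂ) * ∫ u : ℝ, vert x u ^ j * laplace ψ (vert x u) =
      (-1) ^ j * (deriv^[j] ψ) 0 := by
  have h := integral_laplace_mul_exp (ContDiff.iterate_deriv j hψ)
    (hasCompactSupport_iterate_deriv hc j) x 0
  rw [← h, mul_left_comm, ← integral_const_mul ((-1) ^ j)]
  congr 1
  refine integral_congr_ae (.of_forall fun u ↦ ?_)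
  simp only
  rw [laplace_iterate_deriv hψ hc]
  simp only [Complex.ofReal_zero, mul_zero, Complex.exp_zero, mul_one]
  rw [← mul_assoc, ← mul_pow]
  simp

/-- For `Re a < x` the kernel `1/(z - a)` equals `∫_0^∞ e^{(a-z)t} dt`. Exchanging the integrals and
inverting for each `t` avoids any residue computation. -/
lemma integral_laplace_div_sub {ψ : ℝ → ℂ} (hψ : ContDiff ℝ ∞ ψ) (hc : HasCompactSupport ψ)
    {x : ℝ} {a : ℂ} (ha : a.re < x) :
    (1 / (2 * Real.pi) : ℂ) * ∫ u : ℝ, laplace ψ (vert x u) / (vert x u - a) =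
      ∫ t in Set.Ioi (0 : ℝ), Complex.exp (a * t) * ψ t := by
  have hneg : ∀ u : ℝ, (a - vert x u).re < 0 := fun u ↦ by
    rw [Complex.sub_re, vert_re]; linarith
  have h1 : ∀ u : ℝ, laplace ψ (vert x u) / (vert x u - a) =
      ∫ t in Set.Ioi (0 : ℝ), laplace ψ (vert x u) * Complex.exp ((a - vert x u) * t) := by
    intro u
    rw [integral_const_mul, integral_exp_mul_complex_Ioi (hneg u)]
    simp only [Complex.ofReal_zero, mul_zero, Complex.exp_zero]
    rw [neg_div, ← div_neg, neg_sub, mul_one_div]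
  have h2 : ∀ t : ℝ, Complex.exp (a * t) * ψ t = (1 / (2 * Real.pi) : ℂ) * ∫ u : ℝ,
      laplace ψ (vert x u) * Complex.exp ((a - vert x u) * t) := by
    intro t
    rw [← integral_laplace_mul_exp hψ hc x t, mul_left_comm, ← integral_const_mul]
    congr 2 with u
    rw [mul_left_comm, ← Complex.exp_add]
    congr 2
    ring
  simp only [h1, h2]
  rw [integral_const_mul, integral_integral_swap]
  have hi1 := integrable_laplace_vert hψ hc x
  have hi2 : IntegrableOn (fun t : ℝ ↦ Complex.exp ((a - x) * t)) (Set.Ioi 0) :=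
    integrableOn_exp_mul_complex_Ioi (by simpa using ha) 0
  refine (hi1.mul_prod hi2).mono ?_ (.of_forall fun p ↦ le_of_eq ?_)
  · have hcont : Continuous fun p : ℝ × ℝ ↦
        laplace ψ (vert x p.1) * Complex.exp ((a - vert x p.1) * p.2) := by
      have h3 := (continuous_laplace_vert hψ hc x).comp continuous_fst (X := ℝ × ℝ)
      have h4 := (continuous_vert x).comp continuous_fst (X := ℝ × ℝ)
      simp only [Function.comp_def] at h3 h4
      fun_prop
    exact hcont.aestronglyMeasurable
  · simp only [Function.uncurry, norm_mul, norm_exp_mul_ofReal]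
    simp [vert]

lemma laplace_exp_mul (ψ : ℝ → ℂ) (σ z : ℂ) :
    laplace (fun t : ℝ ↦ Complex.exp (σ * t) * ψ t) z = laplace ψ (z + σ) := by
  simp only [laplace]
  congr 1 with t
  rw [← mul_assoc, ← Complex.exp_add, add_mul]

/-- Dominated interchange of a sum and an integral over an arbitrary index set. -/
lemma hasSum_integral_of_norm_le {α ι : Type*} [MeasurableSpace α] {μ : Measure α}
    {F : ι → α → ℂ} {f : α → ℂ} {b : ι → ℝ} {g : α → ℝ}
    (hF : ∀ i, AEStronglyMeasurable (F i) μ) (hb : Summable b) (hg : Integrable g μ)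
    (hFb : ∀ i, ∀ᵐ x ∂μ, ‖F i x‖ ≤ b i * g x) (h0 : ∀ i, b i = 0 → F i = 0)
    (hf : ∀ᵐ x ∂μ, HasSum (fun i ↦ F i x) (f x)) :
    HasSum (fun i ↦ ∫ x, F i x ∂μ) (∫ x, f x ∂μ) := by
  -- Sums over the divisor are indexed by all of `ℂ`, whereas dominated convergence needs a
  -- countable index; the support of the summable majorant is countable and carries every nonzero
  -- term.
  have hcount : Countable (Function.support b) := hb.countable_support
  have hsub : ∀ x, Function.support (fun i ↦ F i x) ⊆ Function.support b := by
    intro x i hi hbi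
    exact hi (by simp [h0 i hbi])
  have hsub' : Function.support (fun i ↦ ∫ x, F i x ∂μ) ⊆ Function.support b := by
    intro i hi hbi
    exact hi (by simp [h0 i hbi])
  rw [← hasSum_subtype_iff_of_support_subset hsub']
  refine hasSum_integral_of_dominated_convergence (fun i x ↦ b i * g x) (fun i ↦ hF i)
    (fun i ↦ hFb i) (.of_forall fun x ↦ (hb.subtype _).mul_right _) ?_ ?_
  · simp only [tsum_mul_right]
    exact hg.const_mul _
  · filter_upwards [hf] with x hx
    exact (hasSum_subtype_iff_of_support_subset (hsub x)).2 hx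

lemma integral_vert_sub (G : ℂ → ℂ) (c : ℝ) (σ : ℂ) :
    ∫ u : ℝ, G (vert c u - σ) = ∫ u : ℝ, G (vert (c - σ.re) u) := by
  rw [← integral_sub_right_eq_self (fun u : ℝ ↦ G (vert (c - σ.re) u)) σ.im]
  congr 1 with u
  congr 1
  apply Complex.ext <;> simp [vert]

/-! ### Evaluation of distributions on test functions -/

/-- The complexification of a real test function. -/
def complexify (φ : Test) (t : ℝ) : ℂ := (φ t : ℂ)

lemma contDiff_complexify (φ : Test) : ContDiff ℝ ∞ (complexify φ) :=
  Complex.ofRealCLM.contDiff.comp φ.contDiff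

lemma hasCompactSupport_complexify (φ : Test) : HasCompactSupport (complexify φ) :=
  φ.hasCompactSupport.comp_left (g := Complex.ofReal) Complex.ofReal_zero

lemma complexify_lineDerivOp (φ : Test) :
    complexify (LineDeriv.lineDerivOp (1 : ℝ) φ) = deriv (complexify φ) := by
  funext t
  have h : HasDerivAt φ (deriv φ t) t := by
    have : Differentiable ℝ φ := φ.contDiff.differentiable (by simp)
    exact (this t).hasDerivAt
  have h' : HasDerivAt (complexify φ) (deriv φ t : ℝ) t := h.ofReal_comp
  rw [h'.deriv, complexify,
    TestFunction.lineDerivOp_eq_lineDerivCLM ℝ, TestFunction.lineDerivCLM_apply]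
  simp [h.hasFDerivAt.differentiableAt.lineDeriv_eq_fderiv]

lemma complexify_iterate_lineDerivOp (φ : Test) (j : ℕ) :
    complexify ((fun ψ : Test ↦ LineDeriv.lineDerivOp (1 : ℝ) ψ)^[j] φ) =
      deriv^[j] (complexify φ) := by
  induction j with
  | zero => rfl
  | succ j ih => rw [Function.iterate_succ_apply', Function.iterate_succ_apply',
      complexify_lineDerivOp, ih]

lemma distDeriv_apply (j : ℕ) (T : Distr) (φ : Test) :
    distDeriv j T φ = (-1) ^ j * T ((fun ψ : Test ↦ LineDeriv.lineDerivOp (1 : ℝ) ψ)^[j] φ) := by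
  induction j generalizing φ with
  | zero => simp [distDeriv]
  | succ j ih =>
    rw [distDeriv, Function.iterate_succ_apply', Distribution.lineDerivOp_apply_apply, map_neg]
    have := ih (LineDeriv.lineDerivOp (1 : ℝ) φ)
    rw [distDeriv] at this
    rw [this, Function.iterate_succ_apply]
    ring

lemma ofFun_apply {u : ℝ → ℂ} (hu : LocallyIntegrable u) (φ : Test) :
    ofFun u φ = ∫ t, u t * complexify φ t := by
  refine (TestFunction.integralAgainstBilinCLM_eq_integral
    (hu.locallyIntegrableOn _)).trans ?_
  refine integral_congr_ae (.of_forall fun t ↦ ?_)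
  simp [complexify, mul_comm]

lemma distDeriv_ofFun_apply {u : ℝ → ℂ} (hu : LocallyIntegrable u) (j : ℕ) (φ : Test) :
    distDeriv j (ofFun u) φ = (-1) ^ j * ∫ t, u t * (deriv^[j] (complexify φ)) t := by
  rw [distDeriv_apply, ofFun_apply hu, complexify_iterate_lineDerivOp]

lemma dirac_apply (x : ℝ) (φ : Test) : dirac x φ = complexify φ x := by
  simp [dirac, complexify, Distribution.delta_apply]

lemma distDeriv_dirac_apply (j : ℕ) (φ : Test) :
    distDeriv j (dirac 0) φ = (-1) ^ j * (deriv^[j] (complexify φ)) 0 := by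
  rw [distDeriv_apply, dirac_apply, complexify_iterate_lineDerivOp]

lemma reflect_apply (T : Distr) (φ : Test) : reflect T φ = T (testReflect φ) := rfl

lemma reflect_distDeriv_dirac (j : ℕ) :
    reflect (distDeriv j (dirac 0)) = (-1 : ℂ) ^ j • distDeriv j (dirac 0) := by
  ext φ
  have h : complexify (testReflect φ) = fun t ↦ complexify φ (-t) := rfl
  have h2 := iteratedDeriv_comp_neg j (complexify φ) 0
  rw [iteratedDeriv_eq_iterate, iteratedDeriv_eq_iterate] at h2
  rw [reflect_apply, distDeriv_dirac_apply, h, h2]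
  change _ = (-1 : ℂ) ^ j * distDeriv j (dirac 0) φ
  rw [distDeriv_dirac_apply]
  simp

lemma reflect_add (S T : Distr) : reflect (S + T) = reflect S + reflect T := map_add _ S T

lemma reflect_smul (z : ℂ) (T : Distr) : reflect (z • T) = z • reflect T := by
  ext φ
  rfl

lemma reflect_sum {ι : Type*} (s : Finset ι) (T : ι → Distr) :
    reflect (∑ i ∈ s, T i) = ∑ i ∈ s, reflect (T i) := map_sum _ T s

/-- Distributions are tested on real functions only, so `e^{σt} φ` enters through its real and
imaginary parts; here they are reassembled into one complex test function. -/
lemma expMul_distDeriv_ofFun_apply {u : ℝ → ℂ} (hu : LocallyIntegrable u) (σ : ℂ) (j : ℕ)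
    (φ : Test) :
    expMul σ (distDeriv j (ofFun u)) φ = (-1) ^ j * ∫ t, u t *
      (deriv^[j] fun t : ℝ ↦ Complex.exp (σ * t) * complexify φ t) t := by
  set φ₁ : Test := testMul (fun t ↦ (Complex.exp (σ * t)).re)
        (Complex.reCLM.contDiff.comp (contDiff_exp_mul σ)) φ with h1
  set φ₂ : Test := testMul (fun t ↦ (Complex.exp (σ * t)).im)
        (Complex.imCLM.contDiff.comp (contDiff_exp_mul σ)) φ with h2
  have hsplit : (fun t : ℝ ↦ Complex.exp (σ * t) * complexify φ t) =
      complexify φ₁ + fun t ↦ Complex.I * complexify φ₂ t := by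
    funext t
    change _ = ((φ t * (Complex.exp (σ * t)).re : ℝ) : ℂ) +
      Complex.I * ((φ t * (Complex.exp (σ * t)).im : ℝ) : ℂ)
    rw [complexify]
    conv_lhs => rw [← Complex.re_add_im (Complex.exp (σ * t))]
    push_cast
    ring
  have hderiv : (deriv^[j] fun t : ℝ ↦ Complex.exp (σ * t) * complexify φ t) =
      fun t ↦ (deriv^[j] (complexify φ₁)) t + Complex.I * (deriv^[j] (complexify φ₂)) t := by
    rw [hsplit]
    clear hsplit
    induction j with
    | zero => rfl
    | succ j ih =>
      simp only [Function.iterate_succ_apply', ih]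
      funext t
      have e1 := contDiff_differentiable (ContDiff.iterate_deriv j (contDiff_complexify φ₁)) t
      have e2 := contDiff_differentiable (ContDiff.iterate_deriv j (contDiff_complexify φ₂)) t
      exact (e1.hasDerivAt.add (e2.hasDerivAt.const_mul Complex.I)).deriv
  have hint : ∀ ψ : Test, Integrable fun t ↦ u t * (deriv^[j] (complexify ψ)) t := fun ψ ↦
    hu.integrable_smul_right_of_hasCompactSupport
      (ContDiff.iterate_deriv j (contDiff_complexify ψ)).continuous
      (hasCompactSupport_iterate_deriv (hasCompactSupport_complexify ψ) j)
  change distDeriv j (ofFun u) φ₁ + Complex.I * distDeriv j (ofFun u) φ₂ = _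
  rw [distDeriv_ofFun_apply hu, distDeriv_ofFun_apply hu, hderiv, mul_left_comm, ← mul_add,
    ← integral_const_mul, ← integral_add (hint φ₁) ((hint φ₂).const_mul _)]
  congr 2 with t
  ring

/-! ### The inverse Laplace transform on test functions -/

lemma LaplaceAdmissible.pos {F : ℂ → ℂ} {m : ℕ} {c : ℝ} (h : LaplaceAdmissible F m c) : 0 < c := by
  obtain ⟨σ₂, C, h0, h1, -⟩ := h
  exact h0.trans h1

lemma LaplaceAdmissible.continuous_vert {F : ℂ → ℂ} {m : ℕ} {c : ℝ}
    (h : LaplaceAdmissible F m c) : Continuous fun u ↦ F (vert c u) := by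
  obtain ⟨σ₂, C, h0, h1, h2, -⟩ := h
  exact h2.continuousOn.comp_continuous (PoissonNewton.continuous_vert c) fun u ↦ by
    simpa [vert_re] using h1

lemma vert_ne_zero {c : ℝ} (hc : 0 < c) (u : ℝ) : vert c u ≠ 0 := fun h ↦ by
  have := vert_re c u
  rw [h] at this
  simp at this
  exact hc.ne this

lemma LaplaceAdmissible.integrable {F : ℂ → ℂ} {m : ℕ} {c : ℝ} (h : LaplaceAdmissible F m c) :
    Integrable fun u : ℝ ↦ F (vert c u) / vert c u ^ m := by
  have hcont := h.continuous_vert.div ((PoissonNewton.continuous_vert c).pow m)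
    fun u ↦ pow_ne_zero _ (vert_ne_zero h.pos u)
  have hc := h.pos
  obtain ⟨σ₂, C, h0, h1, h2, h3⟩ := h
  -- The constant comes from `1/(c² + u²) ≤ (1 + c⁻²)/(1 + u²)`.
  have hb : Integrable fun u : ℝ ↦ |C| * ((1 + (1 / c) ^ 2) * (1 + u ^ 2)⁻¹) :=
    (integrable_inv_one_add_sq.const_mul _).const_mul _
  refine hb.mono' hcont.aestronglyMeasurable (.of_forall fun u ↦ ?_)
  have hv := norm_pos_iff.2 (vert_ne_zero hc u)
  have h4 := h3 (vert c u) (by rwa [vert_re])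
  rw [norm_div, norm_pow, div_le_iff₀ (by positivity)]
  refine h4.trans ?_
  have h5 : ‖vert c u‖ ^ 2 = c ^ 2 + u ^ 2 := by
    rw [← Complex.normSq_eq_norm_sq, Complex.normSq_apply, vert_re, vert_im]; ring
  have h6 : (1 : ℝ) / ‖vert c u‖ ^ 2 ≤ (1 + (1 / c) ^ 2) * (1 + u ^ 2)⁻¹ := by
    rw [h5, ← div_eq_mul_inv, div_le_div_iff₀ (by positivity) (by positivity), one_mul]
    have : (1 + (1 / c) ^ 2) * (c ^ 2 + u ^ 2) = c ^ 2 + u ^ 2 + 1 + (u / c) ^ 2 := by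
      field_simp
      ring
    rw [this]
    nlinarith [sq_nonneg (u / c), sq_nonneg c]
  calc C * ‖vert c u‖ ^ m / ‖vert c u‖ ^ 2 ≤ |C| * ‖vert c u‖ ^ m / ‖vert c u‖ ^ 2 := by
        gcongr; exact le_abs_self C
    _ = |C| * (1 / ‖vert c u‖ ^ 2) * ‖vert c u‖ ^ m := by ring
    _ ≤ |C| * ((1 + (1 / c) ^ 2) * (1 + u ^ 2)⁻¹) * ‖vert c u‖ ^ m := by gcongr

lemma LaplaceAdmissible.integrable_mul {F : ℂ → ℂ} {m : ℕ} {c : ℝ}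
    (h : LaplaceAdmissible F m c) {ψ : ℝ → ℂ} (hψ : ContDiff ℝ ∞ ψ) (hc : HasCompactSupport ψ) :
    Integrable fun u : ℝ ↦ F (vert c u) * laplace ψ (vert c u) := by
  have hcont := h.continuous_vert
  have hpos := h.pos
  obtain ⟨σ₂, C, h0, h1, h2, h3⟩ := h
  refine integrable_laplace_mul hψ hc c hcont.aestronglyMeasurable (A := |C| * (1 / c) ^ 2)
    (k := m) fun u ↦ ?_
  refine (h3 (vert c u) (by rwa [vert_re])).trans ?_
  have h4 : c ≤ ‖vert c u‖ := by
    have := Complex.re_le_norm (vert c u)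
    rwa [vert_re] at this
  calc C * ‖vert c u‖ ^ m / ‖vert c u‖ ^ 2 ≤ |C| * ‖vert c u‖ ^ m / c ^ 2 := by
        gcongr; exact le_abs_self C
    _ = _ := by ring

/-- By Fubini the `m` derivatives fall on `φ`, whose transform acquires the factor `(-s)^m`; with
the sign `(-1)^m` of the distributional derivative this cancels `s^(-m)`. The exponent `m` has
disappeared from the result. -/
theorem invLaplace_apply {F : ℂ → ℂ} {m : ℕ} {c : ℝ} (h : LaplaceAdmissible F m c) (φ : Test) :
    invLaplace F m c φ = (1 / (2 * Real.pi) : ℂ) *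
      ∫ u : ℝ, F (vert c u) * laplace (complexify φ) (vert c u) := by
  have hi := h.integrable
  have hb : ∀ u t : ℝ, ‖F (vert c u) / vert c u ^ m * Complex.exp (vert c u * t)‖ =
      ‖F (vert c u) / vert c u ^ m‖ * Real.exp (c * t) := fun u t ↦ by
    rw [norm_mul, norm_exp_mul_ofReal, vert_re]
  have hexp : Continuous fun p : ℝ × ℝ ↦ Complex.exp (vert c p.1 * p.2) := by
    have := (PoissonNewton.continuous_vert c).comp continuous_fst (X := ℝ × ℝ)
    simp only [Function.comp_def] at this
    fun_prop
  have hLc : Continuous fun t : ℝ ↦ (1 / (2 * Real.pi) : ℂ) *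
      ∫ u : ℝ, F (vert c u) / vert c u ^ m * Complex.exp (vert c u * t) := by
    refine continuous_const.mul (continuous_iff_continuousAt.2 fun t₀ ↦ ?_)
    refine continuousAt_of_dominated
      (bound := fun u ↦ ‖F (vert c u) / vert c u ^ m‖ * Real.exp (c * (t₀ + 1)))
      (.of_forall fun t ↦ hi.aestronglyMeasurable.mul ?_) ?_ (hi.norm.mul_const _)
      (.of_forall fun u ↦ ?_)
    · exact (hexp.comp (by fun_prop : Continuous fun u : ℝ ↦ (u, t))).aestronglyMeasurable
    · filter_upwards [Iio_mem_nhds (lt_add_one t₀)] with t ht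
      refine .of_forall fun u ↦ ?_
      rw [hb]
      have := h.pos
      have : t ≤ t₀ + 1 := le_of_lt ht
      gcongr
    · exact Continuous.continuousAt (by fun_prop)
  set ψ := deriv^[m] (complexify φ) with hψ
  have hψc : Continuous ψ := (ContDiff.iterate_deriv m (contDiff_complexify φ)).continuous
  have hψs : HasCompactSupport ψ :=
    hasCompactSupport_iterate_deriv (hasCompactSupport_complexify φ) m
  have hprod : Integrable (Function.uncurry fun t u : ℝ ↦
      F (vert c u) / vert c u ^ m * Complex.exp (vert c u * t) * ψ t) (volume.prod volume) := by
    refine ((integrable_exp_mul hψc hψs (c : ℂ)).mul_prod hi).mono ?_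
      (.of_forall fun p ↦ le_of_eq ?_)
    · have e1 : AEStronglyMeasurable (fun p : ℝ × ℝ ↦ F (vert c p.2) / vert c p.2 ^ m)
          (volume.prod volume) := hi.aestronglyMeasurable.comp_snd
      have e2 : Continuous fun p : ℝ × ℝ ↦ Complex.exp (vert c p.2 * p.1) :=
        hexp.comp continuous_swap
      exact (e1.mul e2.aestronglyMeasurable).mul (hψc.comp continuous_fst).aestronglyMeasurable
    · simp only [Function.uncurry, norm_mul, norm_exp_mul_ofReal, vert_re, Complex.ofReal_re]
      ring
  have e0 : invLaplace F m c = distDeriv m (ofFun fun t : ℝ ↦ (1 / (2 * Real.pi) : ℂ) *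
      ∫ u : ℝ, F (vert c u) / vert c u ^ m * Complex.exp (vert c u * t)) := rfl
  rw [e0, distDeriv_ofFun_apply hLc.locallyIntegrable]
  simp only [mul_assoc (1 / (2 * Real.pi) : ℂ)]
  rw [integral_const_mul, mul_left_comm]
  congr 1
  simp only [← integral_mul_const]
  rw [integral_integral_swap hprod, ← integral_const_mul ((-1) ^ m)]
  refine integral_congr_ae (.of_forall fun u ↦ ?_)
  have hl := laplace_iterate_deriv (contDiff_complexify φ) (hasCompactSupport_complexify φ) m
    (vert c u)
  rw [← hψ, laplace] at hl
  simp only [mul_assoc]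
  rw [integral_const_mul, hl, ← mul_assoc, ← mul_assoc, mul_comm ((-1) ^ m), mul_assoc (_ / _),
    ← mul_pow, neg_one_mul, neg_neg, div_mul_cancel₀ _ (pow_ne_zero m (vert_ne_zero h.pos u))]

/-! ### The Newton–Cramer distribution on test functions -/

/-- The `k`-th derivative of `t^k/k!` on `[0,∞)` is the Heaviside function: the powers of `t` kill
the boundary terms in each integration by parts. This handles the term `n_σ t^d/d!` of the kernel.
-/
lemma integral_Ioi_pow_mul_iterate_deriv {χ : ℝ → ℂ} (hχ : ContDiff ℝ ∞ χ)
    (hc : HasCompactSupport χ) (k : ℕ) :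
    (-1) ^ k * ∫ t in Set.Ioi (0 : ℝ), (t : ℂ) ^ k * (deriv^[k] χ) t =
      k.factorial * ∫ t in Set.Ioi (0 : ℝ), χ t := by
  induction k with
  | zero => simp
  | succ k ih =>
    set η := deriv^[k] χ with hη
    have hη1 : ContDiff ℝ ∞ η := ContDiff.iterate_deriv k hχ
    have hη2 : HasCompactSupport η := hasCompactSupport_iterate_deriv hc k
    have hp : ContDiff ℝ ∞ fun t : ℝ ↦ (t : ℂ) ^ (k + 1) := Complex.ofRealCLM.contDiff.pow _
    have h0 := HasCompactSupport.integral_Ioi_deriv_eq (f := fun t : ℝ ↦ (t : ℂ) ^ (k + 1) * η t)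
      ((hp.mul hη1).of_le (by simp)) hη2.mul_left 0
    have hd : ∀ t : ℝ, deriv (fun t : ℝ ↦ (t : ℂ) ^ (k + 1) * η t) t =
        (k + 1) * ((t : ℂ) ^ k * η t) + (t : ℂ) ^ (k + 1) * deriv η t := fun t ↦ by
      have e1 : HasDerivAt (fun t : ℝ ↦ (t : ℂ) ^ (k + 1)) ((k + 1) * (t : ℂ) ^ k) t := by
        have := (hasDerivAt_pow (k + 1) (t : ℂ)).comp_ofReal
        simpa using this
      refine (e1.mul (contDiff_differentiable hη1 t).hasDerivAt).deriv.trans ?_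
      ring
    have i1 : Integrable fun t : ℝ ↦ ((k : ℂ) + 1) * ((t : ℂ) ^ k * η t) :=
      ((Continuous.mul (by fun_prop) hη1.continuous).integrable_of_hasCompactSupport
        hη2.mul_left).const_mul _
    have i2 : Integrable fun t : ℝ ↦ (t : ℂ) ^ (k + 1) * deriv η t :=
      (Continuous.mul (by fun_prop) (contDiff_deriv hη1).continuous).integrable_of_hasCompactSupport
        hη2.deriv.mul_left
    simp only [hd] at h0
    rw [integral_add i1.integrableOn i2.integrableOn, integral_const_mul] at h0
    simp only [Complex.ofReal_zero, ne_eq, Nat.add_eq_zero_iff, one_ne_zero, and_false,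
      not_false_eq_true, zero_pow, zero_mul, neg_zero] at h0
    rw [Function.iterate_succ_apply', ← hη, eq_neg_of_add_eq_zero_right h0, Nat.factorial_succ]
    push_cast
    rw [mul_assoc, ← ih]
    ring

lemma contDiff_exp_mul_mul {ψ : ℝ → ℂ} (hψ : ContDiff ℝ ∞ ψ) (σ : ℂ) :
    ContDiff ℝ ∞ fun t : ℝ ↦ Complex.exp (σ * t) * ψ t := (contDiff_exp_mul σ).mul hψ

/-- The Laplace transform of a single term of the kernel. The exponential is treated by
`integral_laplace_div_sub`; the constant `1` leaves a boundary derivative at `0`, which is the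
integral of `s^m` against the transform. The factor `e^{σt}` moves the line to `Re z = c - Re σ`. -/
lemma integral_Ioi_exp_sub_one_mul {ψ : ℝ → ℂ} (hψ : ContDiff ℝ ∞ ψ)
    (hc : HasCompactSupport ψ) {c : ℝ} (σ : ℂ) {ρ : ℂ} (hρ : ρ.re < c) (m : ℕ) :
    (-1) ^ (m + 1) * ∫ t in Set.Ioi (0 : ℝ), (Complex.exp ((ρ - σ) * t) - 1) *
        (deriv^[m + 1] fun t : ℝ ↦ Complex.exp (σ * t) * ψ t) t =
      (1 / (2 * Real.pi) : ℂ) * ∫ u : ℝ,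
        ((vert c u - σ) ^ (m + 1) / (vert c u - ρ) - (vert c u - σ) ^ m) *
          laplace ψ (vert c u) := by
  set χ : ℝ → ℂ := fun t ↦ Complex.exp (σ * t) * ψ t with hχ
  have hχ1 : ContDiff ℝ ∞ χ := contDiff_exp_mul_mul hψ σ
  have hχ2 : HasCompactSupport χ := hc.mul_left
  set η := deriv^[m + 1] χ with hη
  have hη1 : ContDiff ℝ ∞ η := ContDiff.iterate_deriv _ hχ1
  have hη2 : HasCompactSupport η := hasCompactSupport_iterate_deriv hχ2 _
  set x := c - σ.re with hx
  have ha : (ρ - σ).re < x := by rw [Complex.sub_re]; linarith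
  have hne : ∀ u, vert x u - (ρ - σ) ≠ 0 := fun u h ↦ by
    have := congrArg Complex.re h
    rw [Complex.sub_re, vert_re, Complex.zero_re] at this
    linarith
  have hG := integral_vert_sub (fun z ↦ (z ^ (m + 1) / (z - (ρ - σ)) - z ^ m) *
    laplace χ z) c σ
  have hL : ∀ z, laplace χ z = laplace ψ (z + σ) := laplace_exp_mul ψ σ
  have hrhs : ∫ u : ℝ, ((vert c u - σ) ^ (m + 1) / (vert c u - ρ) - (vert c u - σ) ^ m) *
      laplace ψ (vert c u) = ∫ u : ℝ, (vert x u ^ (m + 1) / (vert x u - (ρ - σ)) - vert x u ^ m) *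
        laplace χ (vert x u) := by
    rw [← hG]
    refine integral_congr_ae (.of_forall fun u ↦ ?_)
    simp only [hL]
    ring_nf
  rw [hrhs]
  have j1 : ∫ t in Set.Ioi (0 : ℝ), (Complex.exp ((ρ - σ) * t) - 1) * η t =
      (∫ t in Set.Ioi (0 : ℝ), Complex.exp ((ρ - σ) * t) * η t) -
        ∫ t in Set.Ioi (0 : ℝ), η t := by
    simp only [sub_mul, one_mul]
    refine integral_sub ?_ ?_
    · have := (integrable_exp_mul hη1.continuous hη2 (ρ - σ)).integrableOn (s := Set.Ioi 0)
      simpa only [sub_mul, IntegrableOn] using this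
    · exact (hη1.continuous.integrable_of_hasCompactSupport hη2).integrableOn
  have j2 : ∫ t in Set.Ioi (0 : ℝ), η t = -(deriv^[m] χ) 0 := by
    rw [hη, Function.iterate_succ']
    exact HasCompactSupport.integral_Ioi_deriv_eq ((ContDiff.iterate_deriv m hχ1).of_le (by simp))
      (hasCompactSupport_iterate_deriv hχ2 m) 0
  have j3 := integral_pow_mul_laplace hχ1 hχ2 x m
  have i1 : Integrable fun u : ℝ ↦ vert x u ^ m * laplace χ (vert x u) :=
    integrable_laplace_mul hχ1 hχ2 x ((continuous_vert x).pow m).aestronglyMeasurable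
      (A := 1) (k := m) fun u ↦ by simp
  have i2 : Integrable fun u : ℝ ↦ vert x u ^ (m + 1) / (vert x u - (ρ - σ)) *
      laplace χ (vert x u) := by
    refine integrable_laplace_mul hχ1 hχ2 x (Continuous.aestronglyMeasurable
      (((continuous_vert x).pow _).div ((continuous_vert x).sub continuous_const) hne))
      (A := 1 / (x - (ρ - σ).re)) (k := m + 1) fun u ↦ ?_
    have h1 := Complex.re_le_norm (vert x u - (ρ - σ))
    rw [Complex.sub_re, vert_re] at h1
    have h2 : 0 < x - (ρ - σ).re := by linarith
    rw [norm_div, norm_pow, one_div, div_eq_inv_mul]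
    gcongr
  have hsplit : ∫ u : ℝ, (vert x u ^ (m + 1) / (vert x u - (ρ - σ)) - vert x u ^ m) *
      laplace χ (vert x u) = (∫ u : ℝ, vert x u ^ (m + 1) / (vert x u - (ρ - σ)) *
        laplace χ (vert x u)) - ∫ u : ℝ, vert x u ^ m * laplace χ (vert x u) := by
    simp only [sub_mul _ (vert x _ ^ m)]
    exact integral_sub i2 i1
  rw [hsplit, mul_sub, j3, j1, j2, ← integral_laplace_div_sub hη1 hη2 ha, mul_sub]
  have hterm : ∀ u : ℝ, laplace η (vert x u) / (vert x u - (ρ - σ)) = (-1) ^ (m + 1) *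
      (vert x u ^ (m + 1) / (vert x u - (ρ - σ)) * laplace χ (vert x u)) := fun u ↦ by
    rw [hη, laplace_iterate_deriv hχ1 hχ2, neg_pow]
    ring
  simp only [hterm]
  rw [integral_const_mul, mul_left_comm, ← mul_assoc ((-1) ^ (m + 1)) ((-1) ^ (m + 1)), ← mul_pow,
    pow_succ (-1 : ℂ) m]
  simp

lemma integrable_polynomial_mul_laplace {ψ : ℝ → ℂ} (hψ : ContDiff ℝ ∞ ψ)
    (hc : HasCompactSupport ψ) (x : ℝ) (p : Polynomial ℂ) :
    Integrable fun u : ℝ ↦ p.eval (vert x u) * laplace ψ (vert x u) := by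
  simp only [Polynomial.eval_eq_sum_range, Finset.sum_mul]
  refine integrable_finsetSum _ fun i _ ↦ ?_
  exact integrable_laplace_mul hψ hc x
    (continuous_const.mul ((continuous_vert x).pow i)).aestronglyMeasurable
    (A := ‖p.coeff i‖) (k := i) fun u ↦ by simp

lemma integral_polynomial_mul_laplace {ψ : ℝ → ℂ} (hψ : ContDiff ℝ ∞ ψ)
    (hc : HasCompactSupport ψ) (x : ℝ) (p : Polynomial ℂ) {N : ℕ} (hN : p.natDegree < N) :
    (1 / (2 * Real.pi) : ℂ) * ∫ u : ℝ, p.eval (vert x u) * laplace ψ (vert x u) =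
      ∑ j ∈ Finset.range N, p.coeff j * ((-1) ^ j * (deriv^[j] ψ) 0) := by
  simp only [Polynomial.eval_eq_sum_range' hN, Finset.sum_mul]
  rw [integral_finsetSum, Finset.mul_sum]
  · refine Finset.sum_congr rfl fun j _ ↦ ?_
    rw [← integral_pow_mul_laplace hψ hc x j, mul_left_comm, ← integral_const_mul (p.coeff j)]
    simp only [mul_assoc]
  · intro i _
    exact integrable_laplace_mul hψ hc x
      (continuous_const.mul ((continuous_vert x).pow i)).aestronglyMeasurable
      (A := ‖p.coeff i‖) (k := i) fun u ↦ by simp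

/-- The term of index `ρ` in `K(t) - K(0)`, extended to negative `t` by `0`. -/
def kernelTerm (f : ℂ → ℂ) (σ ρ : ℂ) (t : ℝ) : ℂ :=
  mult f ρ / (ρ - σ) ^ convExponent f * (Complex.exp ((ρ - σ) * (max t 0 : ℝ)) - 1)

lemma norm_kernelTerm_le {f : ℂ → ℂ} {c : ℝ} (hdiv : ∀ ρ, mult f ρ ≠ 0 → ρ.re < c) {σ ρ : ℂ}
    {t T : ℝ} (hT : max t 0 ≤ T) :
    ‖kernelTerm f σ ρ t‖ ≤ |(mult f ρ : ℝ)| / ‖ρ - σ‖ ^ convExponent f *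
      (Real.exp (|c - σ.re| * T) + 1) := by
  rw [kernelTerm, norm_mul, norm_div, Complex.norm_intCast, norm_pow]
  by_cases h : mult f ρ = 0
  · simp [h]
  gcongr
  refine (norm_sub_le _ _).trans ?_
  rw [norm_exp_mul_ofReal, norm_one, Complex.sub_re]
  gcongr
  have := hdiv ρ h
  exact (by linarith : ρ.re - σ.re ≤ c - σ.re).trans (le_abs_self _)

lemma continuous_tsum_kernelTerm {f : ℂ → ℂ} {c : ℝ} (hdiv : ∀ ρ, mult f ρ ≠ 0 → ρ.re < c)
    {σ : ℂ} (hs : Summable fun ρ : ℂ ↦ |(mult f ρ : ℝ)| / ‖ρ - σ‖ ^ convExponent f) :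
    Continuous fun t ↦ ∑' ρ, kernelTerm f σ ρ t := by
  refine continuous_iff_continuousAt.2 fun t₀ ↦ ?_
  have : ContinuousOn (fun t ↦ ∑' ρ, kernelTerm f σ ρ t) (Set.Iio (t₀ + 1)) := by
    refine continuousOn_tsum (fun ρ ↦ Continuous.continuousOn ?_)
      (hs.mul_right (Real.exp (|c - σ.re| * max (t₀ + 1) 0) + 1)) fun ρ t ht ↦ ?_
    · unfold kernelTerm
      fun_prop
    · exact norm_kernelTerm_le hdiv (max_le_max_right 0 (le_of_lt ht))
  exact this.continuousAt (Iio_mem_nhds (lt_add_one t₀))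

/-- Subtracting `K(0)` makes every term vanish at `t = 0`, so the cut-off amounts to replacing `t`
by `max t 0`, which is visibly continuous. As `d ≥ 1`, the index `ρ = σ` contributes `0` to the sum.
-/
lemma newtonCramerKernel_sub {f : ℂ → ℂ} {c : ℝ} (hdiv : ∀ ρ, mult f ρ ≠ 0 → ρ.re < c)
    {σ : ℂ} (hs : Summable fun ρ : ℂ ↦ |(mult f ρ : ℝ)| / ‖ρ - σ‖ ^ convExponent f)
    (hd : 1 ≤ convExponent f) :
    (Set.indicator (Set.Ici 0) fun t ↦ newtonCramerKernel f σ t - newtonCramerKernel f σ 0) =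
      fun t ↦ mult f σ * (((max t 0 : ℝ) : ℂ) ^ convExponent f / (convExponent f).factorial) +
        ∑' ρ, kernelTerm f σ ρ t := by
  have hd0 : convExponent f ≠ 0 := by omega
  have hsub : ∀ t : ℝ, ∑' ρ : {ρ : ℂ // ρ ≠ σ},
      mult f ρ / ((ρ : ℂ) - σ) ^ convExponent f * Complex.exp ((ρ - σ) * t) =
        ∑' ρ : ℂ, mult f ρ / (ρ - σ) ^ convExponent f * Complex.exp ((ρ - σ) * t) := fun t ↦ by
    refine tsum_subtype_eq_of_support_subset (s := {ρ | ρ ≠ σ}) (f := fun ρ : ℂ ↦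
      mult f ρ / (ρ - σ) ^ convExponent f * Complex.exp ((ρ - σ) * t)) fun ρ hρ h ↦ hρ ?_
    simp [h, hd0]
  have hsum : ∀ t : ℝ, 0 ≤ t → Summable fun ρ : ℂ ↦
      mult f ρ / (ρ - σ) ^ convExponent f * Complex.exp ((ρ - σ) * t) := fun t ht ↦ by
    refine Summable.of_norm_bounded (hs.mul_right (Real.exp ((c - σ.re) * t))) fun ρ ↦ ?_
    rw [norm_mul, norm_div, Complex.norm_intCast, norm_pow, norm_exp_mul_ofReal, Complex.sub_re]
    by_cases h : mult f ρ = 0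
    · simp [h]
    have := (hdiv ρ h).le
    gcongr
  funext t
  by_cases ht : 0 ≤ t
  · rw [Set.indicator_of_mem (Set.mem_Ici.2 ht)]
    simp only [newtonCramerKernel, hsub, kernelTerm, max_eq_left ht, mul_sub, mul_one]
    have h0 := hsum 0 le_rfl
    simp only [Complex.ofReal_zero, mul_zero, Complex.exp_zero, mul_one] at h0 ⊢
    rw [(hsum t ht).tsum_sub h0]
    simp [hd0]
    ring
  · rw [Set.indicator_of_notMem (by simpa using ht)]
    simp [kernelTerm, max_eq_right (not_le.1 ht).le, hd0]

/-- Computed term by term: the sum over the divisor is exchanged with the `t`-integral on one side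
and with the line integral on the other, and the terms agree by `integral_Ioi_exp_sub_one_mul`. The
partial fraction expansion identifies the total. -/
theorem newtonCramer_apply {f : ℂ → ℂ} (hf : IsMeromorphic f) (hd : 1 ≤ convExponent f)
    {N : ℕ} {c : ℝ} (hadm : LaplaceAdmissible (logDeriv f) N c) {σ : ℂ} {Q : Polynomial ℂ}
    (hQ : IsFactorizationPolynomial f (convExponent f - 1) σ Q) (φ : Test) :
    newtonCramer f σ φ = (1 / (2 * Real.pi) : ℂ) *
      ∫ u : ℝ, (logDeriv f (vert c u) - Q.derivative.eval (vert c u)) *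
        laplace (complexify φ) (vert c u) := by
  have hne := order_ne_top_of_one_le_convExponent hf hd
  have hs' := summable_mult_sub (summable_convExponent hd) σ
  obtain ⟨m, hm⟩ : ∃ m, convExponent f = m + 1 := ⟨convExponent f - 1, by omega⟩
  have hs : Summable fun ρ : ℂ ↦ |(mult f ρ : ℝ)| / ‖ρ - σ‖ ^ convExponent f := by
    rwa [Nat.sub_add_cancel hd] at hs'
  have hFint := hadm.integrable_mul (contDiff_complexify φ) (hasCompactSupport_complexify φ)
  obtain ⟨σ₂, C, h0, h1, h2, h3⟩ := hadm
  -- Admissibility alone places the divisor in `Re ρ ≤ σ₂ < c`; the gap `c - σ₂` makes the estimates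
  -- on the line uniform in `ρ`.
  have hdiv' : ∀ ρ, mult f ρ ≠ 0 → ρ.re ≤ σ₂ := fun ρ hρ ↦ by
    by_contra h
    exact hρ (mult_eq_zero_of_differentiableOn hf hne h2 (not_le.1 h))
  have hdiv : ∀ ρ, mult f ρ ≠ 0 → ρ.re < c := fun ρ hρ ↦ (hdiv' ρ hρ).trans_lt h1
  have hvdiv : ∀ u, mult f (vert c u) = 0 := fun u ↦ by
    by_contra h
    have := hdiv _ h
    rw [vert_re] at this
    exact lt_irrefl _ this
  set ψ := complexify φ with hψ
  have hψ1 : ContDiff ℝ ∞ ψ := contDiff_complexify φ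
  have hψ2 : HasCompactSupport ψ := hasCompactSupport_complexify φ
  set χ : ℝ → ℂ := fun t ↦ Complex.exp (σ * t) * ψ t with hχ
  have hχ1 : ContDiff ℝ ∞ χ := contDiff_exp_mul_mul hψ1 σ
  have hχ2 : HasCompactSupport χ := hψ2.mul_left
  set η := deriv^[m + 1] χ with hη
  have hη1 : Continuous η := (ContDiff.iterate_deriv _ hχ1).continuous
  have hη2 : HasCompactSupport η := hasCompactSupport_iterate_deriv hχ2 _
  have hKc := continuous_tsum_kernelTerm hdiv hs
  -- the contribution of the divisor off `σ`
  have hsum1 : HasSum (fun ρ ↦ ∫ t in Set.Ioi (0 : ℝ), kernelTerm f σ ρ t * η t)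
      (∫ t in Set.Ioi (0 : ℝ), (∑' ρ, kernelTerm f σ ρ t) * η t) := by
    refine hasSum_integral_of_norm_le
      (b := fun ρ ↦ |(mult f ρ : ℝ)| / ‖ρ - σ‖ ^ convExponent f)
      (g := fun t ↦ (Real.exp (|c - σ.re| * max t 0) + 1) * ‖η t‖) (fun ρ ↦ ?_) hs ?_
      (fun ρ ↦ .of_forall fun t ↦ ?_) (fun ρ hρ ↦ ?_) (.of_forall fun t ↦ ?_)
    · have : Continuous (kernelTerm f σ ρ) := by unfold kernelTerm; fun_prop
      exact (this.mul hη1).aestronglyMeasurable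
    · refine Integrable.integrableOn (Continuous.integrable_of_hasCompactSupport ?_ ?_)
      · fun_prop
      · exact hη2.norm.mul_left
    · rw [norm_mul, ← mul_assoc]
      gcongr
      exact norm_kernelTerm_le hdiv le_rfl
    · have : mult f ρ = 0 ∨ ρ = σ := by
        rcases div_eq_zero_iff.1 hρ with h | h
        · exact .inl (by simpa using h)
        · exact .inr (sub_eq_zero.1 (norm_eq_zero.1 (eq_zero_of_pow_eq_zero h)))
      funext t
      rcases this with h | h <;> simp [kernelTerm, h, hm]
    · refine (Summable.hasSum (Summable.of_norm_bounded (hs.mul_right _) fun ρ ↦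
        norm_kernelTerm_le (σ := σ) hdiv (le_refl (max t 0)))).mul_right _
  have hden : ∀ ρ, mult f ρ ≠ 0 → ∀ u, c - σ₂ ≤ ‖vert c u - ρ‖ := fun ρ hρ u ↦ by
    have := Complex.re_le_norm (vert c u - ρ)
    rw [Complex.sub_re, vert_re] at this
    linarith [hdiv' ρ hρ]
  have hvne : ∀ ρ, mult f ρ ≠ 0 → ∀ u, vert c u ≠ ρ := fun ρ hρ u h ↦ by
    have := hden ρ hρ u
    rw [h, sub_self, norm_zero] at this
    linarith
  have hpowint : ∀ k : ℕ, Integrable fun u : ℝ ↦ (vert c u - σ) ^ k * laplace ψ (vert c u) := by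
    intro k
    have := integrable_polynomial_mul_laplace hψ1 hψ2 c ((Polynomial.X - Polynomial.C σ) ^ k)
    simpa using this
  have hlap := continuous_laplace_vert hψ1 hψ2 c
  have hvc := continuous_vert c
  have hsum2 : HasSum (fun ρ ↦ ∫ u : ℝ, mult f ρ * partialFraction m σ (vert c u) ρ *
      laplace ψ (vert c u)) (∫ u : ℝ, (logDeriv f (vert c u) - mult f σ / (vert c u - σ) -
        Q.derivative.eval (vert c u)) * laplace ψ (vert c u)) := by
    -- The majorant `g` expands `‖(ρ-σ)/(s-ρ)‖ ≤ 1 + ‖s-σ‖/(c-σ₂)` times `‖s-σ‖^m` and the transform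
    -- of `φ`.
    refine hasSum_integral_of_norm_le
      (b := fun ρ ↦ |(mult f ρ : ℝ)| / ‖ρ - σ‖ ^ convExponent f)
      (g := fun u ↦ ‖(vert c u - σ) ^ m * laplace ψ (vert c u)‖ +
        ‖(vert c u - σ) ^ (m + 1) * laplace ψ (vert c u)‖ / (c - σ₂)) (fun ρ ↦ ?_) hs
      ((hpowint m).norm.add ((hpowint (m + 1)).norm.div_const _))
      (fun ρ ↦ .of_forall fun u ↦ ?_) (fun ρ hρ ↦ ?_) (.of_forall fun u ↦ ?_)
    · by_cases hρ : mult f ρ = 0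
      · simpa [hρ] using aestronglyMeasurable_const
      have : Continuous fun u ↦ partialFraction m σ (vert c u) ρ := by
        unfold partialFraction
        refine (Continuous.div (by fun_prop) (by fun_prop) fun u ↦
          sub_ne_zero.2 (hvne ρ hρ u)).sub (by fun_prop)
      exact ((continuous_const.mul this).mul hlap).aestronglyMeasurable
    · by_cases hρ : mult f ρ = 0
      · simp [hρ]
      have hδ : 0 < c - σ₂ := by linarith
      have e1 : ‖(ρ - σ) / (vert c u - ρ)‖ ≤ 1 + ‖vert c u - σ‖ / (c - σ₂) := by
        refine (norm_div_sub_le (hvne ρ hρ u)).trans ?_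
        have := hden ρ hρ u
        gcongr
      have e2 := norm_mult_mul_partialFraction_le (f := f) (m := m) (σ := σ) (hvne ρ hρ u) e1
      rw [norm_mul]
      refine (mul_le_mul_of_nonneg_right e2 (norm_nonneg _)).trans (le_of_eq ?_)
      simp only [norm_mul, norm_pow, hm]
      ring
    · have : mult f ρ = 0 ∨ ρ = σ := by
        rcases div_eq_zero_iff.1 hρ with h | h
        · exact .inl (by simpa using h)
        · exact .inr (sub_eq_zero.1 (norm_eq_zero.1 (eq_zero_of_pow_eq_zero h)))
      funext u
      rcases this with h | h <;> simp [partialFraction, h]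
    · have hm' : convExponent f - 1 = m := by omega
      rw [hm'] at hQ hs'
      exact (hasSum_partialFraction hf hne hs' hQ (hvdiv u)).mul_right _
  have hterm : ∀ ρ, (-1 : ℂ) ^ (m + 1) * ∫ t in Set.Ioi (0 : ℝ), kernelTerm f σ ρ t * η t =
      (1 / (2 * Real.pi) : ℂ) * ∫ u : ℝ, mult f ρ * partialFraction m σ (vert c u) ρ *
        laplace ψ (vert c u) := by
    intro ρ
    by_cases hρ : mult f ρ = 0
    · simp [hρ, kernelTerm]
    have e1 := integral_Ioi_exp_sub_one_mul hψ1 hψ2 σ (hdiv ρ hρ) m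
    have e2 : ∫ t in Set.Ioi (0 : ℝ), kernelTerm f σ ρ t * η t =
        mult f ρ / (ρ - σ) ^ (m + 1) *
          ∫ t in Set.Ioi (0 : ℝ), (Complex.exp ((ρ - σ) * t) - 1) * η t := by
      rw [← integral_const_mul]
      refine setIntegral_congr_fun measurableSet_Ioi fun t ht ↦ ?_
      simp only [kernelTerm, max_eq_left (le_of_lt (Set.mem_Ioi.1 ht)), hm]
      ring
    have e3 : ∀ u : ℝ, mult f ρ * partialFraction m σ (vert c u) ρ * laplace ψ (vert c u) =
        mult f ρ / (ρ - σ) ^ (m + 1) * (((vert c u - σ) ^ (m + 1) / (vert c u - ρ) -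
          (vert c u - σ) ^ m) * laplace ψ (vert c u)) := fun u ↦ by
      rw [partialFraction]
      ring
    simp only [e3]
    rw [integral_const_mul, mul_left_comm _ _ (∫ u : ℝ, _), ← e1, e2, mul_left_comm]
  have hmain : (-1 : ℂ) ^ (m + 1) * ∫ t in Set.Ioi (0 : ℝ), (∑' ρ, kernelTerm f σ ρ t) * η t =
      (1 / (2 * Real.pi) : ℂ) * ∫ u : ℝ, (logDeriv f (vert c u) - mult f σ / (vert c u - σ) -
        Q.derivative.eval (vert c u)) * laplace ψ (vert c u) := by
    refine (hsum1.mul_left ((-1 : ℂ) ^ (m + 1))).unique ?_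
    simp only [hterm]
    exact hsum2.mul_left _
  -- the contribution of `σ`
  have hσterm : (-1 : ℂ) ^ (m + 1) * ∫ t in Set.Ioi (0 : ℝ),
      mult f σ * (((max t 0 : ℝ) : ℂ) ^ (m + 1) / (m + 1).factorial) * η t =
      (1 / (2 * Real.pi) : ℂ) * ∫ u : ℝ, mult f σ / (vert c u - σ) * laplace ψ (vert c u) := by
    by_cases hσ : mult f σ = 0
    · simp [hσ]
    have e1 := integral_Ioi_pow_mul_iterate_deriv hχ1 hχ2 (m + 1)
    have e2 := integral_laplace_div_sub hψ1 hψ2 (hdiv σ hσ)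
    have e3 : ∫ t in Set.Ioi (0 : ℝ),
        mult f σ * (((max t 0 : ℝ) : ℂ) ^ (m + 1) / (m + 1).factorial) * η t =
        mult f σ / (m + 1).factorial * ∫ t in Set.Ioi (0 : ℝ), (t : ℂ) ^ (m + 1) * η t := by
      rw [← integral_const_mul]
      refine setIntegral_congr_fun measurableSet_Ioi fun t ht ↦ ?_
      simp only [max_eq_left (le_of_lt (Set.mem_Ioi.1 ht))]
      ring
    have e4 : ∀ u : ℝ, mult f σ / (vert c u - σ) * laplace ψ (vert c u) =
        mult f σ * (laplace ψ (vert c u) / (vert c u - σ)) := fun u ↦ by ring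
    simp only [e4]
    rw [hχ] at e1
    rw [e3, hη, mul_left_comm, hχ, e1, integral_const_mul, mul_left_comm _ (mult f σ : ℂ), e2]
    have : ((m + 1).factorial : ℂ) ≠ 0 := by exact_mod_cast (m + 1).factorial_ne_zero
    field_simp
  have hu : LocallyIntegrable (Set.indicator (Set.Ici 0) fun t ↦
      newtonCramerKernel f σ t - newtonCramerKernel f σ 0) := by
    rw [newtonCramerKernel_sub hdiv hs hd]
    refine Continuous.locallyIntegrable ?_
    fun_prop
  have hK0 : ∀ ρ t, t ∉ Set.Ioi (0 : ℝ) → kernelTerm f σ ρ t = 0 := fun ρ t ht ↦ by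
    rw [kernelTerm, max_eq_right (not_lt.1 ht)]
    simp
  rw [newtonCramer, expMul_distDeriv_ofFun_apply hu, newtonCramerKernel_sub hdiv hs hd, hm, ← hψ,
    ← hχ, ← hη]
  have hi1 : Integrable fun t : ℝ ↦
      mult f σ * (((max t 0 : ℝ) : ℂ) ^ (m + 1) / (m + 1).factorial) * η t :=
    Continuous.integrable_of_hasCompactSupport (by fun_prop) hη2.mul_left
  have hi2 : Integrable fun t : ℝ ↦ (∑' ρ, kernelTerm f σ ρ t) * η t :=
    (hKc.mul hη1).integrable_of_hasCompactSupport hη2.mul_left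
  rw [← setIntegral_eq_integral_of_forall_compl_eq_zero (s := Set.Ioi 0)]
  swap
  · intro t ht
    simp [hK0 _ t ht, max_eq_right (not_lt.1 (mt Set.mem_Ioi.2 ht))]
  simp only [add_mul]
  rw [integral_add hi1.integrableOn hi2.integrableOn, mul_add, hmain, hσterm, ← mul_add]
  have hσint : Integrable fun u : ℝ ↦ mult f σ / (vert c u - σ) * laplace ψ (vert c u) := by
    by_cases hσ : mult f σ = 0
    · simp [hσ]
    refine integrable_laplace_mul hψ1 hψ2 c (Continuous.aestronglyMeasurable
      (continuous_const.div (by fun_prop) fun u ↦ sub_ne_zero.2 (hvne σ hσ u)))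
      (A := |(mult f σ : ℝ)| / (c - σ₂)) (k := 0) fun u ↦ ?_
    have := hden σ hσ u
    have hδ : 0 < c - σ₂ := by linarith
    rw [norm_div, Complex.norm_intCast, pow_zero, mul_one]
    gcongr
  have hQint := integrable_polynomial_mul_laplace hψ1 hψ2 c Q.derivative
  have hrest : Integrable fun u : ℝ ↦ (logDeriv f (vert c u) - mult f σ / (vert c u - σ) -
      Q.derivative.eval (vert c u)) * laplace ψ (vert c u) := by
    refine ((hFint.sub hσint).sub hQint).congr (.of_forall fun u ↦ ?_)
    simp only [Pi.sub_apply]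
    ring
  rw [← integral_add hσint hrest]
  congr 2 with u
  ring

/-! ### The Poisson–Newton formula in the general case -/

theorem newtonCramer_eq {f : ℂ → ℂ} (hf : IsMeromorphic f) (hfo : HasFiniteOrder f)
    (hd : 1 ≤ convExponent f) {m : ℕ} {c : ℝ} (hadm : LaplaceAdmissible (logDeriv f) m c) (σ : ℂ)
    {N : ℕ} (hN : (discrepancyPolynomial f σ).natDegree < N) :
    newtonCramer f σ = invLaplace (logDeriv f) m c + ∑ j ∈ Finset.range N,
      (discrepancyPolynomial f σ).coeff j • distDeriv j (dirac 0) := by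
  have hs := summable_mult_sub (summable_convExponent hd) σ
  have hQ := (isHadamardPolynomial_iff hs).1 (isHadamardPolynomial_hadamardPolynomial hf hfo hd σ)
  ext φ
  have hψ1 := contDiff_complexify φ
  have hψ2 := hasCompactSupport_complexify φ
  have e : (∑ j ∈ Finset.range N, (discrepancyPolynomial f σ).coeff j •
      distDeriv j (dirac 0)) φ = ∑ j ∈ Finset.range N, (discrepancyPolynomial f σ).coeff j *
        ((-1) ^ j * (deriv^[j] (complexify φ)) 0) := by
    rw [sum_apply]
    refine Finset.sum_congr rfl fun j _ ↦ ?_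
    rw [← distDeriv_dirac_apply]
    rfl
  change _ = invLaplace (logDeriv f) m c φ + (∑ j ∈ Finset.range N,
    (discrepancyPolynomial f σ).coeff j • distDeriv j (dirac 0)) φ
  rw [e, newtonCramer_apply hf hd hadm hQ, invLaplace_apply hadm,
    ← integral_polynomial_mul_laplace hψ1 hψ2 c _ hN, ← mul_add,
    ← integral_add (hadm.integrable_mul hψ1 hψ2) (integrable_polynomial_mul_laplace hψ1 hψ2 c _)]
  congr 2 with u
  rw [discrepancyPolynomial, Polynomial.eval_neg]
  ring

lemma sum_range_two_mul_add_neg_one_pow {E : Type*} [AddCommGroup E] [Module ℂ E] (T : ℕ → E)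
    (M : ℕ) : ∑ j ∈ Finset.range (2 * M), (T j + (-1 : ℂ) ^ j • T j) =
      (2 : ℂ) • ∑ l ∈ Finset.range M, T (2 * l) := by
  induction M with
  | zero => simp
  | succ M ih =>
    rw [Nat.mul_succ, Finset.sum_range_succ, Finset.sum_range_succ, ih, Finset.sum_range_succ,
      smul_add, pow_succ, pow_mul]
    simp [two_smul]

theorem symNewtonCramer_eq {f : ℂ → ℂ} (hf : IsMeromorphic f) (hfo : HasFiniteOrder f)
    (hd : 1 ≤ convExponent f) (hl : DivisorInLeftHalfPlane f) {m : ℕ} {c : ℝ}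
    (hadm : LaplaceAdmissible (logDeriv f) m c) (σ : ℂ) :
    symNewtonCramer f σ =
      (2 : ℂ) • ∑ l ∈ Finset.range ((genus f + 1) / 2),
        (discrepancyPolynomial f σ).coeff (2 * l) • distDeriv (2 * l) (dirac 0) +
      (invLaplace (logDeriv f) m c + reflect (invLaplace (logDeriv f) m c)) := by
  set P := discrepancyPolynomial f σ with hP
  -- The range `l < (g + 1) / 2` means `0 ≤ l ≤ (g - 1)/2`. It is enlarged to cover the apparent
  -- degree of `P`; any added `l` has `2l ≥ g` and coefficient zero.
  set M := max ((genus f + 1) / 2) (P.natDegree + 1) with hM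
  have hN : P.natDegree < 2 * M := by omega
  have h1 := newtonCramer_eq hf hfo hd hadm σ hN
  have h2 : ∑ l ∈ Finset.range ((genus f + 1) / 2), P.coeff (2 * l) • distDeriv (2 * l) (dirac 0) =
      ∑ l ∈ Finset.range M, P.coeff (2 * l) • distDeriv (2 * l) (dirac 0) := by
    refine Finset.sum_subset (Finset.range_mono (le_max_left _ _)) fun l _ hl' ↦ ?_
    rw [hP, discrepancyPolynomial_coeff_eq_zero hf hfo hd hl σ]
    · exact zero_smul ℂ (distDeriv (2 * l) (dirac 0))
    · have := Finset.mem_range.not.1 hl'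
      omega
  rw [h2, ← sum_range_two_mul_add_neg_one_pow (fun j ↦ P.coeff j • distDeriv j (dirac 0)),
    Finset.sum_add_distrib, symNewtonCramer, h1, reflect_add, reflect_sum]
  have h3 : ∀ j, reflect (P.coeff j • distDeriv j (dirac 0)) =
      (-1 : ℂ) ^ j • P.coeff j • distDeriv j (dirac 0) := fun j ↦ by
    rw [reflect_smul, reflect_distDeriv_dirac, smul_comm]
  simp only [← hP, h3]
  abel

theorem poissonNewton_general {f : ℂ → ℂ} (hf : IsMeromorphic f) (hfo : HasFiniteOrder f)
    (hd : 1 ≤ convExponent f) (hl : DivisorInLeftHalfPlane f) :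
    (∀ τ : ℂ, IsHadamardPolynomial f τ (hadamardPolynomial f τ)) ∧
    (∃ (m : ℕ) (c : ℝ), LaplaceAdmissible (logDeriv f) m c) ∧
    ∀ (σ : ℂ) (m : ℕ) (c : ℝ), LaplaceAdmissible (logDeriv f) m c →
      symNewtonCramer f σ =
        (2 : ℂ) • ∑ l ∈ Finset.range ((genus f + 1) / 2),
          (discrepancyPolynomial f σ).coeff (2 * l) • distDeriv (2 * l) (dirac 0) +
        (invLaplace (logDeriv f) m c + reflect (invLaplace (logDeriv f) m c)) := by
  refine ⟨isHadamardPolynomial_hadamardPolynomial hf hfo hd, ?_,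
    fun σ m c h ↦ symNewtonCramer_eq hf hfo hd hl h σ⟩
  have hs := summable_convExponent hd
  exact exists_laplaceAdmissible hf (order_ne_top_of_one_le_convExponent hf hd) hs
    ((isHadamardPolynomial_iff (by simpa using hs)).1
      (isHadamardPolynomial_hadamardPolynomial hf hfo hd 0)) hl

/-! ### Finiteness of the convergence exponent -/

/-- Dyadic decomposition: the shell `2^k ≤ w i ≤ 2^(k+1)` contributes at most `C 2^{kB}/2^{k(B+1)} =
C 2^{-k}`. -/
lemma summable_div_pow_of_sum_le {ι : Type*} {c w : ι → ℝ} {C : ℝ} {B : ℕ} (hc : ∀ i, 0 ≤ c i)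
    (hw : ∀ i, 1 ≤ w i)
    (h : ∀ (k : ℕ) (F : Finset ι), (∀ i ∈ F, w i ≤ 2 ^ (k + 1)) → ∑ i ∈ F, c i ≤ C * 2 ^ (k * B)) :
    Summable fun i ↦ c i / w i ^ (B + 1) := by
  have hC : 0 ≤ C := by simpa using h 0 ∅
  refine summable_of_sum_le (c := 2 * C) (fun i ↦ by have := hc i; have := hw i; positivity)
    fun F ↦ ?_
  set κ : ι → ℕ := fun i ↦ Nat.log 2 ⌊w i⌋₊ with hκ
  have h1 : ∀ i, (2 : ℝ) ^ κ i ≤ w i := fun i ↦ by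
    have := Nat.pow_log_le_self 2 (Nat.floor_pos.2 (hw i)).ne'
    exact le_trans (by exact_mod_cast this) (Nat.floor_le (zero_le_one.trans (hw i)))
  have h2 : ∀ i, w i ≤ (2 : ℝ) ^ (κ i + 1) := fun i ↦ by
    have := Nat.lt_pow_succ_log_self one_lt_two ⌊w i⌋₊
    have := (Nat.lt_of_floor_lt this).le
    push_cast at this
    exact this
  set K := F.sup κ + 1 with hK
  have hmaps : ∀ i ∈ F, κ i ∈ Finset.range K := fun i hi ↦
    Finset.mem_range.2 (Nat.lt_succ_of_le (Finset.le_sup hi))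
  rw [← Finset.sum_fiberwise_of_maps_to hmaps]
  have h3 : ∀ k ∈ Finset.range K, ∑ i ∈ F with κ i = k, c i / w i ^ (B + 1) ≤
      C * (1 / 2 : ℝ) ^ k := fun k _ ↦ by
    calc ∑ i ∈ F with κ i = k, c i / w i ^ (B + 1) ≤
        ∑ i ∈ F with κ i = k, c i / (2 ^ k) ^ (B + 1) := by
          refine Finset.sum_le_sum fun i hi ↦ ?_
          have := h1 i
          rw [(Finset.mem_filter.1 hi).2] at this
          have := hc i
          gcongr
      _ = (∑ i ∈ F with κ i = k, c i) / (2 ^ k) ^ (B + 1) := by rw [Finset.sum_div]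
      _ ≤ C * 2 ^ (k * B) / (2 ^ k) ^ (B + 1) := by
          gcongr
          refine h k _ fun i hi ↦ ?_
          have := h2 i
          rwa [(Finset.mem_filter.1 hi).2] at this
      _ = C * (1 / 2 : ℝ) ^ k := by
          rw [pow_succ, pow_mul, one_div, inv_pow]
          field_simp
  refine (Finset.sum_le_sum h3).trans ?_
  rw [← Finset.mul_sum, mul_comm]
  gcongr
  exact sum_geometric_two_le K

/-- Jensen's bound: the logarithmic counting functions of zeros and poles are at most `T(1/f)` and
`T(f)`, so together at most `2T(f) + c`, while a point with `‖ρ‖ ≤ r/2` contributes at least `|n_ρ|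
log 2`. -/
lemma HasFiniteOrder.exists_sum_abs_mult_le {f : ℂ → ℂ} (hf : IsMeromorphic f)
    (hfo : HasFiniteOrder f) :
    ∃ (C : ℝ) (B : ℕ) (r₀ : ℝ), 2 ≤ r₀ ∧ ∀ r, r₀ ≤ r → ∀ F : Finset ℂ, (∀ ρ ∈ F, ‖ρ‖ ≤ r / 2) →
      ∑ ρ ∈ F, |(mult f ρ : ℝ)| ≤ C * r ^ B := by
  classical
  obtain ⟨C, B, hC, hchar⟩ := hfo.exists_characteristic_le
  obtain ⟨r₁, hr₁⟩ := eventually_atTop.1 hchar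
  set c := max |Real.log ‖f 0‖| |Real.log ‖meromorphicTrailingCoeffAt f 0‖| with hc
  have hc0 : 0 ≤ c := (abs_nonneg _).trans (le_max_left _ _)
  have hlog2 : 0 < Real.log 2 := Real.log_pos one_lt_two
  refine ⟨(2 * C + c) / Real.log 2, B, max r₁ 2, le_max_right _ _, fun r hr F hF ↦ ?_⟩
  have hr1 := hr₁ r ((le_max_left _ _).trans hr)
  have hr2 : 2 ≤ r := (le_max_right _ _).trans hr
  set D := MeromorphicOn.divisor f Set.univ with hD
  have hbound : Function.locallyFinsuppWithin.logCounting (D⁺ + D⁻) r ≤ 2 * (C * r ^ B) + c := by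
    rw [map_add, Pi.add_apply, ← ValueDistribution.logCounting_zero,
      ← ValueDistribution.logCounting_top]
    have e1 : ValueDistribution.logCounting f ⊤ r ≤ ValueDistribution.characteristic f ⊤ r := by
      rw [ValueDistribution.characteristic, Pi.add_apply]
      exact le_add_of_nonneg_left (ValueDistribution.proximity_nonneg r)
    have e2 : ValueDistribution.logCounting f 0 r ≤ ValueDistribution.characteristic f⁻¹ ⊤ r := by
      rw [ValueDistribution.characteristic, Pi.add_apply, ValueDistribution.logCounting_inv]
      exact le_add_of_nonneg_left (ValueDistribution.proximity_nonneg r)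
    have e3 := abs_le.1
      (ValueDistribution.characteristic_sub_characteristic_inv_le (R := r) hf.meromorphic)
    linarith [e3.1]
  set E : Function.locallyFinsupp ℂ ℤ :=
    ∑ ρ ∈ F, Function.locallyFinsuppWithin.single ρ |mult f ρ| with hE
  have hEapply : ∀ z, E z = if z ∈ F then |mult f z| else 0 := fun z ↦ by
    rw [hE, Function.locallyFinsuppWithin.coe_sum, Finset.sum_apply]
    simp [Function.locallyFinsuppWithin.single_apply]
  have hEle : E ≤ D⁺ + D⁻ := by
    intro z
    rw [hEapply]
    simp only [Function.locallyFinsuppWithin.coe_add, Pi.add_apply,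
      Function.locallyFinsuppWithin.posPart_apply, Function.locallyFinsuppWithin.negPart_apply]
    rw [posPart_add_negPart]
    split_ifs
    · exact le_rfl
    · exact abs_nonneg _
  have h1 := (Function.locallyFinsuppWithin.logCounting_le hEle (by linarith)).trans hbound
  rw [hE, map_sum, Finset.sum_apply] at h1
  have h2 : ∀ ρ ∈ F, |(mult f ρ : ℝ)| * Real.log 2 ≤ Function.locallyFinsuppWithin.logCounting
      (Function.locallyFinsuppWithin.single ρ |mult f ρ|) r := fun ρ hρ ↦ by
    have hρ' := hF ρ hρ
    rw [Function.locallyFinsuppWithin.logCounting_single_eq_log_sub_const (by linarith)]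
    push_cast
    gcongr
    by_cases h0 : ρ = 0
    · rw [h0, norm_zero, Real.log_zero, sub_zero]
      gcongr
    · have hpos := norm_pos_iff.2 h0
      rw [← Real.log_div (by linarith) hpos.ne']
      gcongr
      rw [le_div_iff₀ hpos]
      linarith
  have h3 := (Finset.sum_le_sum h2).trans h1
  rw [← Finset.sum_mul, ← le_div_iff₀ hlog2] at h3
  refine h3.trans ?_
  rw [div_mul_eq_mul_div]
  gcongr
  have : 1 ≤ r ^ B := one_le_pow₀ (by linarith)
  nlinarith

theorem exists_summable_mult {f : ℂ → ℂ} (hf : IsMeromorphic f) (hfo : HasFiniteOrder f) :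
    ∃ d : ℕ, Summable fun ρ : ℂ ↦ |(mult f ρ : ℝ)| / ‖ρ‖ ^ d := by
  obtain ⟨C, B, r₀, hr₀, h⟩ := hfo.exists_sum_abs_mult_le hf
  have hs : Summable fun ρ : ℂ ↦ |(mult f ρ : ℝ)| / max ‖ρ‖ 1 ^ (B + 1) := by
    refine summable_div_pow_of_sum_le (C := C * (2 * r₀) ^ B) (fun _ ↦ abs_nonneg _)
      (fun _ ↦ le_max_right _ _) fun k F hF ↦ ?_
    have hk : (1 : ℝ) ≤ 2 ^ k := one_le_pow₀ one_le_two
    -- The radius is chosen so that half of it, `2^k r₀`, is at least `2^(k+1)`; this uses `r₀ ≥ 2`.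
    refine (h (2 * 2 ^ k * r₀) (by nlinarith) F fun ρ hρ ↦ ?_).trans (le_of_eq ?_)
    · refine (le_max_left _ _).trans ((hF ρ hρ).trans ?_)
      rw [pow_succ]
      nlinarith
    · rw [pow_mul, mul_assoc C, ← mul_pow]
      ring
  refine ⟨B + 1, hs.congr_cofinite ?_⟩
  -- In the unit disc the modified denominator is `1`, so almost all multiplicities there are less
  -- than `1` in absolute value, hence zero.
  filter_upwards [hs.tendsto_cofinite_zero.eventually (gt_mem_nhds one_pos)] with ρ hρ
  rcases le_or_gt 1 ‖ρ‖ with h1 | h1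
  · rw [max_eq_left h1]
  · rw [max_eq_right h1.le, one_pow, div_one] at hρ
    rcases abs_mult_eq_zero_or f ρ with h0 | h0
    · simp [h0]
    · linarith

/-! ### Meromorphic functions given by a Dirichlet series -/

lemma norm_dirichlet_term (a : ℕ → ℂ) (freq : ℕ → ℝ) (n : ℕ) (s : ℂ) :
    ‖a n * Complex.exp (-freq n * s)‖ = ‖a n‖ * Real.exp (-freq n * s.re) := by
  rw [norm_mul, Complex.norm_exp]
  simp

/-- `f` is given on `c₀ ≤ Re s` by a Dirichlet series with `∑ |a_n| e^{-λ_n Re s} ≤ 1/2`. -/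
structure IsDirichletAbscissa (f : ℂ → ℂ) (a : ℕ → ℂ) (freq : ℕ → ℝ) (c₀ : ℝ) : Prop where
  summable : Summable fun n ↦ ‖a n‖ * Real.exp (-freq n * c₀)
  tsum_le : ∑' n, ‖a n‖ * Real.exp (-freq n * c₀) ≤ 1 / 2
  eq_series : ∀ s : ℂ, c₀ ≤ s.re → f s = 1 + ∑' n, a n * Complex.exp (-freq n * s)

/-- The absolute sum tends to `0` far to the right. The threshold `1/2` keeps `f` within `1/2` of
`1`, away from `0` and within reach of the principal logarithm. -/
lemma IsDirichletSeries.exists_abscissa {f : ℂ → ℂ} {a : ℕ → ℂ} {freq : ℕ → ℝ}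
    (h : IsDirichletSeries f a freq) : ∃ c₀, IsDirichletAbscissa f a freq c₀ := by
  obtain ⟨σbar, hs, hf⟩ := h.eq_series
  have hle : ∀ x, σbar ≤ x → ∀ n,
      ‖a n‖ * Real.exp (-freq n * x) ≤ ‖a n‖ * Real.exp (-freq n * σbar) := fun x hx n ↦ by
    have := h.freq_pos n
    gcongr ‖a n‖ * Real.exp ?_
    nlinarith
  have ht : Tendsto (fun x : ℝ ↦ ∑' n, ‖a n‖ * Real.exp (-freq n * x)) atTop
      (𝓝 (∑' _ : ℕ, (0 : ℝ))) := by
    refine tendsto_tsum_of_dominated_convergence hs (fun n ↦ ?_) ?_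
    · have h1 : Tendsto (fun x : ℝ ↦ -freq n * x) atTop atBot :=
        tendsto_id.const_mul_atTop_of_neg (neg_lt_zero.2 (h.freq_pos n))
      simpa using (Real.tendsto_exp_atBot.comp h1).const_mul ‖a n‖
    · filter_upwards [eventually_ge_atTop σbar] with x hx n
      rw [Real.norm_of_nonneg (by positivity)]
      exact hle x hx n
  rw [tsum_zero] at ht
  obtain ⟨x, hx1, hx2⟩ := ((ht.eventually (ge_mem_nhds (by norm_num : (0 : ℝ) < 1 / 2))).and
    (eventually_gt_atTop σbar)).exists
  exact ⟨x, Summable.of_nonneg_of_le (fun n ↦ by positivity) (hle x hx2.le) hs, hx1,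
    fun s hs' ↦ hf s (by linarith)⟩

section Dirichlet

variable {f : ℂ → ℂ} {a : ℕ → ℂ} {freq : ℕ → ℝ} {c₀ : ℝ}

lemma IsDirichletSeries.term_le (h : IsDirichletSeries f a freq) {s : ℂ} (hs : c₀ ≤ s.re) (n : ℕ) :
    ‖a n * Complex.exp (-freq n * s)‖ ≤
      Real.exp (-freq 0 * (s.re - c₀)) * (‖a n‖ * Real.exp (-freq n * c₀)) := by
  rw [norm_dirichlet_term, mul_left_comm, ← Real.exp_add]
  have := h.freq_strictMono.monotone (Nat.zero_le n)
  gcongr ‖a n‖ * Real.exp ?_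
  nlinarith

lemma IsDirichletAbscissa.norm_sub_one_le (hc : IsDirichletAbscissa f a freq c₀)
    (h : IsDirichletSeries f a freq) {s : ℂ} (hs : c₀ ≤ s.re) :
    ‖f s - 1‖ ≤ Real.exp (-freq 0 * (s.re - c₀)) * (1 / 2) := by
  rw [hc.eq_series s hs, add_sub_cancel_left]
  refine (tsum_of_norm_bounded (hc.summable.hasSum.mul_left _) (h.term_le hs)).trans ?_
  gcongr
  exact hc.tsum_le

lemma IsDirichletAbscissa.norm_sub_one_le_half (hc : IsDirichletAbscissa f a freq c₀)
    (h : IsDirichletSeries f a freq) {s : ℂ} (hs : c₀ ≤ s.re) : ‖f s - 1‖ ≤ 1 / 2 := by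
  refine (hc.norm_sub_one_le h hs).trans (mul_le_of_le_one_left (by norm_num) ?_)
  have := h.freq_pos 0
  rw [Real.exp_le_one_iff]
  nlinarith

lemma IsDirichletAbscissa.half_le_norm (hc : IsDirichletAbscissa f a freq c₀)
    (h : IsDirichletSeries f a freq) {s : ℂ} (hs : c₀ ≤ s.re) : 1 / 2 ≤ ‖f s‖ := by
  have h1 := hc.norm_sub_one_le_half h hs
  have h2 := norm_sub_norm_le 1 (f s)
  rw [norm_one, norm_sub_rev] at h2
  linarith

lemma IsDirichletAbscissa.ne_zero (hc : IsDirichletAbscissa f a freq c₀)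
    (h : IsDirichletSeries f a freq) {s : ℂ} (hs : c₀ ≤ s.re) : f s ≠ 0 := fun h0 ↦ by
  have := hc.half_le_norm h hs
  rw [h0, norm_zero] at this
  linarith

lemma IsDirichletAbscissa.order_ne_top (hc : IsDirichletAbscissa f a freq c₀)
    (h : IsDirichletSeries f a freq) (hf : IsMeromorphic f) (z : ℂ) :
    meromorphicOrderAt f z ≠ ⊤ := by
  refine (meromorphicOn_univ.2 hf.meromorphic).meromorphicOrderAt_ne_top_of_isPreconnected
    (x := ((c₀ + 1 : ℝ) : ℂ)) isPreconnected_univ (Set.mem_univ _) (Set.mem_univ _) fun ht ↦ ?_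
  rw [meromorphicOrderAt_eq_top_iff] at ht
  have hopen : IsOpen {s : ℂ | c₀ < s.re} := isOpen_lt continuous_const Complex.continuous_re
  have h1 : ∀ᶠ s in 𝓝[≠] ((c₀ + 1 : ℝ) : ℂ), c₀ < s.re :=
    Filter.Eventually.filter_mono nhdsWithin_le_nhds (hopen.mem_nhds (by simp))
  obtain ⟨s, hs1, hs2⟩ := (ht.and h1).exists
  exact hc.ne_zero h hs2.le hs1

lemma IsDirichletAbscissa.mult_eq_zero (hc : IsDirichletAbscissa f a freq c₀)
    (h : IsDirichletSeries f a freq) (hf : IsMeromorphic f) {s : ℂ} (hs : c₀ ≤ s.re) :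
    mult f s = 0 :=
  (mult_eq_zero_iff hf (hc.order_ne_top h hf)).2 (hc.ne_zero h hs)

lemma IsDirichletAbscissa.divisorInLeftHalfPlane (hc : IsDirichletAbscissa f a freq c₀)
    (h : IsDirichletSeries f a freq) (hf : IsMeromorphic f) : DivisorInLeftHalfPlane f :=
  ⟨c₀, fun ρ hρ ↦ by
    by_contra hlt
    exact hρ (hc.mult_eq_zero h hf (not_le.1 hlt).le)⟩

lemma IsDirichletAbscissa.analyticAt (hc : IsDirichletAbscissa f a freq c₀)
    (h : IsDirichletSeries f a freq) (hf : IsMeromorphic f) {s : ℂ} (hs : c₀ ≤ s.re) :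
    AnalyticAt ℂ f s :=
  hf.analyticAt (hc.order_ne_top h hf) (hc.mult_eq_zero h hf hs)

/-- A logarithmic derivative with finitely many poles that decays rapidly on the real axis vanishes
there eventually. -/
lemma eventually_logDeriv_eq_zero (hf : IsMeromorphic f) (hfo : HasFiniteOrder f)
    (hne : ∀ z, meromorphicOrderAt f z ≠ ⊤) (hfin : (Function.support (mult f)).Finite)
    (hdecay : ∀ p : Polynomial ℂ,
      Tendsto (fun x : ℝ ↦ logDeriv f x * p.eval (x : ℂ)) atTop (𝓝 0)) :
    ∀ᶠ x : ℝ in atTop, logDeriv f x = 0 := by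
  classical
  set S := hfin.toFinset with hS
  have hsum : Summable fun ρ : ℂ ↦ |(mult f ρ : ℝ)| / ‖ρ - 0‖ ^ (0 + 1) :=
    summable_of_hasFiniteSupport (hfin.subset fun ρ hρ h ↦ hρ (by
      simp [show mult f ρ = 0 by simpa using h]))
  obtain ⟨Q, hQ⟩ := exists_hadamard_factorization hf hfo hne hsum
  -- `P` clears the finitely many simple poles of `f'/f`, so `(f'/f) P` agrees with the polynomial
  -- `R` off the divisor; the decay then forces `R = 0`.
  set P : Polynomial ℂ := ∏ ρ ∈ S, (Polynomial.X - Polynomial.C ρ) with hP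
  set R : Polynomial ℂ := Q.derivative * P + ∑ ρ ∈ S, Polynomial.C (mult f ρ : ℂ) *
    ∏ τ ∈ S.erase ρ, (Polynomial.X - Polynomial.C τ) with hR
  have hkey : ∀ s : ℂ, s ∉ S → logDeriv f s * P.eval s = R.eval s := fun s hs ↦ by
    have h0 : mult f s = 0 := by simpa [hS] using hs
    have h1 := (hasSum_partialFraction hf hne hsum hQ h0).tsum_eq
    rw [tsum_eq_sum (s := S) fun ρ hρ ↦ by
      simp [show mult f ρ = 0 by simpa [hS] using hρ]] at h1
    have h2 : logDeriv f s = Q.derivative.eval s + ∑ ρ ∈ S, mult f ρ / (s - ρ) := by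
      -- For `m = 0` and centre `0` the partial fraction of index `ρ ≠ 0` is exactly `1/(s - ρ)`,
      -- whereas that of index `0` is zero.
      have h3 : ∑ ρ ∈ S, (mult f ρ / (s - ρ) - mult f ρ * partialFraction 0 0 s ρ) =
          mult f 0 / (s - 0) := by
        rw [Finset.sum_eq_single 0]
        · simp [partialFraction]
        · intro ρ hρ hρ0
          have : s - ρ ≠ 0 := fun h ↦ hs (by rwa [sub_eq_zero.1 h])
          rw [partialFraction]
          field_simp
          ring
        · intro h
          simp [show mult f 0 = 0 by simpa [hS] using h]
      rw [Finset.sum_sub_distrib, h1] at h3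
      linear_combination -h3
    have h4 : ∀ ρ ∈ S, mult f ρ / (s - ρ) * P.eval s =
        mult f ρ * (∏ τ ∈ S.erase ρ, (Polynomial.X - Polynomial.C τ)).eval s := fun ρ hρ ↦ by
      have : s - ρ ≠ 0 := fun h ↦ hs (by rwa [sub_eq_zero.1 h])
      rw [hP, ← Finset.mul_prod_erase S _ hρ, Polynomial.eval_mul]
      simp only [Polynomial.eval_sub, Polynomial.eval_X, Polynomial.eval_C]
      field_simp
    rw [h2, hR, add_mul, Finset.sum_mul, Finset.sum_congr rfl h4]
    simp [Polynomial.eval_finsetSum]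
  have hlarge : ∀ᶠ x : ℝ in atTop, (x : ℂ) ∉ S := by
    have : ∀ᶠ x : ℝ in atTop, ∀ ρ ∈ S, ρ.re < x :=
      (Finset.eventually_all S).2 fun ρ _ ↦ eventually_gt_atTop _
    filter_upwards [this] with x hx hxS
    exact lt_irrefl _ (hx _ hxS)
  have hR0 : R = 0 := by
    ext j
    refine coeff_eq_zero_of_tendsto (m := 0) ?_ (Nat.zero_le j)
    refine (hdecay P).congr' ?_
    filter_upwards [hlarge] with x hx
    rw [hkey x hx, pow_zero, div_one]
  filter_upwards [hlarge] with x hx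
  have h1 := hkey x hx
  rw [hR0, Polynomial.eval_zero] at h1
  refine (mul_eq_zero.1 h1).resolve_right ?_
  rw [hP, Polynomial.eval_prod]
  refine Finset.prod_ne_zero_iff.2 fun ρ hρ ↦ ?_
  simp only [Polynomial.eval_sub, Polynomial.eval_X, Polynomial.eval_C]
  exact fun h ↦ hx (by rwa [sub_eq_zero.1 h])

/-- Cauchy's estimate for `f - 1` on the unit disc about `x`, combined with `‖f x‖ ≥ 1/2`. -/
lemma IsDirichletAbscissa.norm_logDeriv_le (hc : IsDirichletAbscissa f a freq c₀)
    (h : IsDirichletSeries f a freq) (hf : IsMeromorphic f) {x : ℝ} (hx : c₀ + 1 ≤ x) :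
    ‖logDeriv f x‖ ≤ Real.exp (freq 0 * (c₀ + 1)) * Real.exp (-freq 0 * x) := by
  have hball : ∀ z ∈ Metric.closedBall (x : ℂ) 1, x - 1 ≤ z.re := fun z hz ↦ by
    rw [Metric.mem_closedBall, dist_eq_norm] at hz
    have := (Complex.abs_re_le_norm (z - x)).trans hz
    rw [Complex.sub_re, Complex.ofReal_re] at this
    linarith [(abs_le.1 this).1]
  have hd : DiffContOnCl ℂ (fun z ↦ f z - 1) (Metric.ball (x : ℂ) 1) := by
    refine DifferentiableOn.diffContOnCl (s := Metric.ball (x : ℂ) 1) ?_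
    rw [closure_ball _ one_ne_zero]
    intro z hz
    exact ((hc.analyticAt h hf (by linarith [hball z hz])).differentiableAt.sub_const
      1).differentiableWithinAt
  have h1 := Complex.norm_deriv_le_of_forall_mem_sphere_norm_le (c := (x : ℂ)) one_pos hd
    (C := Real.exp (-freq 0 * (x - 1 - c₀)) * (1 / 2)) fun z hz ↦ by
      have hz' := hball z (Metric.sphere_subset_closedBall hz)
      refine (hc.norm_sub_one_le h (by linarith)).trans ?_
      have := h.freq_pos 0
      gcongr ?_ * (1 / 2)
      rw [Real.exp_le_exp]
      nlinarith
  rw [deriv_sub_const, div_one] at h1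
  have h2 := hc.half_le_norm h (s := (x : ℂ)) (by rw [Complex.ofReal_re]; linarith)
  have h3 : Real.exp (-freq 0 * (x - 1 - c₀)) =
      Real.exp (freq 0 * (c₀ + 1)) * Real.exp (-freq 0 * x) := by
    rw [← Real.exp_add]
    ring_nf
  rw [logDeriv_apply, norm_div, div_le_iff₀ (by linarith), ← h3]
  have := Real.exp_pos (-freq 0 * (x - 1 - c₀))
  nlinarith

lemma IsDirichletAbscissa.tendsto_logDeriv_mul (hc : IsDirichletAbscissa f a freq c₀)
    (h : IsDirichletSeries f a freq) (hf : IsMeromorphic f) (p : Polynomial ℂ) :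
    Tendsto (fun x : ℝ ↦ logDeriv f x * p.eval (x : ℂ)) atTop (𝓝 0) := by
  set A := ∑ i ∈ Finset.range (p.natDegree + 1), ‖p.coeff i‖ with hA
  have h1 := tendsto_rpow_mul_exp_neg_mul_atTop_nhds_zero p.natDegree (freq 0) (h.freq_pos 0)
  have h2 := h1.const_mul (Real.exp (freq 0 * (c₀ + 1)) * A)
  rw [mul_zero] at h2
  refine squeeze_zero_norm' ?_ h2
  filter_upwards [eventually_ge_atTop (c₀ + 1), eventually_ge_atTop 1] with x hx hx1
  have h3 := hc.norm_logDeriv_le h hf hx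
  have hxn : ‖(x : ℂ)‖ = x := by rw [Complex.norm_real, Real.norm_of_nonneg (by linarith)]
  have h4 := norm_polynomial_eval_le p (s := (x : ℂ)) (by rwa [hxn])
  rw [hxn] at h4
  rw [norm_mul, Real.rpow_natCast]
  refine (mul_le_mul h3 h4 (norm_nonneg _) (by positivity)).trans (le_of_eq ?_)
  ring

/-- Otherwise `f` is constant on a real ray, equal to its limit `1`. Multiplying the vanishing
series `∑ a_n e^{-λ_n x}` by `e^{λ_N x}`, with `N` the first index such that `a_N ≠ 0`, and letting
`x → ∞` gives `a_N = 0`. -/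
lemma IsDirichletAbscissa.not_eventually_logDeriv_eq_zero
    (hc : IsDirichletAbscissa f a freq c₀) (h : IsDirichletSeries f a freq)
    (hf : IsMeromorphic f) : ¬ ∀ᶠ x : ℝ in atTop, logDeriv f x = 0 := by
  intro hz
  obtain ⟨x₁, hx₁⟩ := eventually_atTop.1 (hz.and (eventually_ge_atTop c₀))
  have hre : ∀ x, x₁ ≤ x → c₀ ≤ (x : ℂ).re := fun x hx ↦ by
    rw [Complex.ofReal_re]; exact (hx₁ x hx).2
  have hd : ∀ x, x₁ ≤ x → HasDerivAt (fun x : ℝ ↦ f x) 0 x := fun x hx ↦ by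
    have h1 := (hx₁ x hx).1
    rw [logDeriv_apply, div_eq_zero_iff, or_iff_left (hc.ne_zero h (hre x hx))] at h1
    have h2 := (hc.analyticAt h hf (hre x hx)).differentiableAt.hasDerivAt
    rw [h1] at h2
    exact h2.comp_ofReal
  have hconst : ∀ x, x₁ ≤ x → f x = f x₁ := fun x hx ↦
    constant_of_has_deriv_right_zero (f := fun x : ℝ ↦ f x) (a := x₁) (b := x)
      (fun y hy ↦ (hd y hy.1).continuousAt.continuousWithinAt)
      (fun y hy ↦ (hd y hy.1).hasDerivWithinAt) x ⟨hx, le_rfl⟩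
  have hlim : Tendsto (fun x : ℝ ↦ f x - 1) atTop (𝓝 0) := by
    have h1 := tendsto_rpow_mul_exp_neg_mul_atTop_nhds_zero 0 (freq 0) (h.freq_pos 0)
    have h2 := h1.const_mul (Real.exp (freq 0 * c₀))
    rw [mul_zero] at h2
    refine squeeze_zero_norm' ?_ h2
    filter_upwards [eventually_ge_atTop c₀] with x hx
    have h3 := hc.norm_sub_one_le h (s := (x : ℂ)) (by rwa [Complex.ofReal_re])
    rw [Real.rpow_zero, one_mul, ← Real.exp_add]
    refine h3.trans ((mul_le_of_le_one_right (Real.exp_pos _).le (by norm_num)).trans ?_)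
    rw [Real.exp_le_exp, Complex.ofReal_re]
    linarith
  have hone : ∀ x, x₁ ≤ x → f x = 1 := fun x hx ↦ by
    have h1 : Tendsto (fun x : ℝ ↦ f x - 1) atTop (𝓝 (f x₁ - 1)) := by
      refine tendsto_const_nhds.congr' ?_
      filter_upwards [eventually_ge_atTop x₁] with y hy
      rw [hconst y hy]
    rw [hconst x hx]
    exact sub_eq_zero.1 (tendsto_nhds_unique h1 hlim)
  have hex := h.nonconstant
  classical
  set N := Nat.find hex with hN
  have hlt : ∀ n, n < N → a n = 0 := fun n hn ↦ not_not.1 (Nat.find_min hex hn)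
  have htend : Tendsto (fun x : ℝ ↦ ∑' n, a n * Complex.exp (-(freq n - freq N) * x)) atTop
      (𝓝 (∑' n, if n = N then a N else 0)) := by
    refine tendsto_tsum_of_dominated_convergence (bound := fun n ↦
      Real.exp (freq N * x₁) * (‖a n‖ * Real.exp (-freq n * x₁))) ?_ (fun n ↦ ?_) ?_
    · refine Summable.mul_left _ (Summable.of_nonneg_of_le (fun _ ↦ by positivity) (fun n ↦ ?_)
        hc.summable)
      have := h.freq_pos n
      have := (hx₁ x₁ le_rfl).2
      gcongr ‖a n‖ * Real.exp ?_
      nlinarith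
    · rcases lt_trichotomy n N with hn | rfl | hn
      · simp [hlt n hn, hn.ne]
      · simp
      · have h0 : 0 < freq n - freq N := sub_pos.2 (h.freq_strictMono hn)
        rw [if_neg hn.ne', tendsto_zero_iff_norm_tendsto_zero]
        have h1 := (tendsto_rpow_mul_exp_neg_mul_atTop_nhds_zero 0 _ h0).const_mul ‖a n‖
        simp only [Real.rpow_zero, one_mul, mul_zero] at h1
        refine h1.congr fun x ↦ ?_
        rw [norm_mul, Complex.norm_exp]
        simp
    · filter_upwards [eventually_ge_atTop x₁] with x hx n
      rcases lt_or_ge n N with hn | hn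
      · simp [hlt n hn]
      · have h0 : 0 ≤ freq n - freq N := sub_nonneg.2 (h.freq_strictMono.monotone hn)
        have e : ‖Complex.exp (-(freq n - freq N) * x)‖ = Real.exp (-(freq n - freq N) * x) := by
          rw [Complex.norm_exp]
          simp
        rw [norm_mul, e, mul_left_comm, ← Real.exp_add]
        gcongr ‖a n‖ * Real.exp ?_
        nlinarith
  rw [tsum_ite_eq] at htend
  have hzero : ∀ᶠ x : ℝ in atTop,
      ∑' n, a n * Complex.exp (-(freq n - freq N) * x) = 0 := by
    filter_upwards [eventually_ge_atTop x₁] with x hx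
    have h1 := hc.eq_series x (hre x hx)
    rw [hone x hx, left_eq_add] at h1
    have h2 : ∀ n, a n * Complex.exp (-(freq n - freq N) * x) =
        Complex.exp (freq N * x) * (a n * Complex.exp (-freq n * x)) := fun n ↦ by
      rw [mul_left_comm, ← Complex.exp_add]
      ring_nf
    simp only [h2]
    rw [tsum_mul_left, h1, mul_zero]
  exact Nat.find_spec hex (tendsto_nhds_unique
    (htend.congr' hzero) tendsto_const_nhds)

theorem IsDirichletAbscissa.one_le_convExponent (hc : IsDirichletAbscissa f a freq c₀)
    (h : IsDirichletSeries f a freq) (hf : IsMeromorphic f) (hfo : HasFiniteOrder f) :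
    1 ≤ convExponent f := by
  by_contra hlt
  have h0 : convExponent f = 0 := by omega
  -- Finite order shows that some exponent works, so the value `0` is a true minimum rather than the
  -- infimum of the empty set. Summability of the integers `|n_ρ|` then makes the divisor finite.
  obtain ⟨d, hd⟩ := exists_summable_mult hf hfo
  have hmem : convExponent f ∈ {d : ℕ | Summable fun ρ : {ρ : ℂ // ρ ≠ 0} ↦
      |(mult f ρ : ℝ)| / ‖(ρ : ℂ)‖ ^ d} :=
    Nat.sInf_mem ⟨d, hd.comp_injective (Subtype.val_injective (p := fun ρ : ℂ ↦ ρ ≠ 0))⟩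
  rw [h0, Set.mem_ofPred_eq] at hmem
  simp only [pow_zero, div_one] at hmem
  have hfin : {ρ : {ρ : ℂ // ρ ≠ 0} | mult f ρ ≠ 0}.Finite := by
    refine (hmem.tendsto_cofinite_zero.eventually (gt_mem_nhds one_pos)).subset
      fun ρ hρ hlt ↦ ?_
    rcases abs_mult_eq_zero_or f ρ with h1 | h1
    · exact hρ (by simpa using h1)
    · exact absurd hlt (not_lt.2 h1)
  have hfin' : (Function.support (mult f)).Finite := by
    refine ((hfin.image Subtype.val).union (Set.finite_singleton 0)).subset fun ρ hρ ↦ ?_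
    by_cases h1 : ρ = 0
    · exact .inr h1
    · exact .inl ⟨⟨ρ, h1⟩, hρ, rfl⟩
  exact hc.not_eventually_logDeriv_eq_zero h hf (eventually_logDeriv_eq_zero hf hfo
    (hc.order_ne_top h hf) hfin' (hc.tendsto_logDeriv_mul h hf))

end Dirichlet

/-! ### The expansion of the logarithm of a Dirichlet series -/

/-- The coefficient of `∏ A_n ^ k_n` in `- log (1 + ∑ A_n)`, times this product. -/
def logTerm (A : ℕ → ℂ) (k : ℕ →₀ ℕ) : ℂ :=
  (-1) ^ k.degree / k.degree * k.multinomial * k.prod fun n j ↦ A n ^ j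

lemma sum_finsuppAntidiag_multinomial {R : Type*} [CommSemiring R] (s : Finset ℕ) (A : ℕ → R)
    (N : ℕ) : ∑ k ∈ s.finsuppAntidiag N, (k.multinomial : R) * k.prod (fun n j ↦ A n ^ j) =
      (∑ n ∈ s, A n) ^ N := by
  rw [Finset.sum_pow_eq_sum_piAntidiag]
  refine Finset.sum_bij (fun k _ ↦ ⇑k) (fun k hk ↦ ?_) (fun _ _ _ _ h ↦ DFunLike.coe_injective h)
    (fun p hp ↦ ?_) (fun k hk ↦ ?_)
  · rw [Finset.mem_finsuppAntidiag] at hk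
    rw [Finset.mem_piAntidiag]
    exact ⟨hk.1, fun i hi ↦ hk.2 (Finsupp.mem_support_iff.2 hi)⟩
  · rw [Finset.mem_piAntidiag] at hp
    refine ⟨Finsupp.onFinset s p fun i ↦ hp.2 i, ?_, rfl⟩
    rw [Finset.mem_finsuppAntidiag]
    exact ⟨hp.1, Finsupp.support_onFinset_subset⟩
  · rw [Finset.mem_finsuppAntidiag] at hk
    rw [Finsupp.multinomial_of_support_subset hk.2,
      Finsupp.prod_of_support_subset _ hk.2 _ fun _ _ ↦ pow_zero _]

/-- The exponents `k` supported in `{0, …, M - 1}` of size at most `M`. -/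
def exponentBox (M : ℕ) : Finset (ℕ →₀ ℕ) :=
  (Finset.range (M + 1)).biUnion fun N ↦ (Finset.range M).finsuppAntidiag N

lemma degree_of_mem_finsuppAntidiag {s : Finset ℕ} {N : ℕ} {k : ℕ →₀ ℕ}
    (hk : k ∈ s.finsuppAntidiag N) : k.degree = N := by
  rw [Finset.mem_finsuppAntidiag] at hk
  rw [Finsupp.degree_apply, ← hk.1]
  exact Finset.sum_subset hk.2 fun i _ hi ↦ Finsupp.notMem_support_iff.1 hi

lemma mem_exponentBox {M : ℕ} {k : ℕ →₀ ℕ} :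
    k ∈ exponentBox M ↔ k.degree ≤ M ∧ k.support ⊆ Finset.range M := by
  simp only [exponentBox, Finset.mem_biUnion, Finset.mem_range]
  constructor
  · rintro ⟨N, hN, hk⟩
    exact ⟨by rw [degree_of_mem_finsuppAntidiag hk]; omega, (Finset.mem_finsuppAntidiag.1 hk).2⟩
  · rintro ⟨h1, h2⟩
    refine ⟨k.degree, by omega, Finset.mem_finsuppAntidiag.2 ⟨?_, h2⟩⟩
    rw [Finsupp.degree_apply]
    exact (Finset.sum_subset h2 fun i _ hi ↦ Finsupp.notMem_support_iff.1 hi).symm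

lemma sum_exponentBox {E : Type*} [AddCommMonoid E] (g : (ℕ →₀ ℕ) → E) (M : ℕ) :
    ∑ k ∈ exponentBox M, g k =
      ∑ N ∈ Finset.range (M + 1), ∑ k ∈ (Finset.range M).finsuppAntidiag N, g k := by
  refine Finset.sum_biUnion fun N _ N' _ hNN ↦ Finset.disjoint_left.2 fun k h1 h2 ↦ hNN ?_
  rw [← degree_of_mem_finsuppAntidiag h1, ← degree_of_mem_finsuppAntidiag h2]

/-- The boxes exhaust the index set, so an unconditional sum can be evaluated along them. -/
lemma tendsto_exponentBox : Tendsto exponentBox atTop atTop := by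
  refine tendsto_atTop_finset_of_monotone (fun M M' h k hk ↦ ?_) fun k ↦ ?_
  · rw [mem_exponentBox] at hk ⊢
    exact ⟨hk.1.trans h, hk.2.trans (Finset.range_mono h)⟩
  · refine ⟨max k.degree (k.support.sup id + 1), mem_exponentBox.2 ⟨le_max_left _ _, fun n hn ↦ ?_⟩⟩
    have := Finset.le_sup (f := id) hn
    rw [Finset.mem_range]
    simp only [id] at this
    omega

/-- By the multinomial theorem the exponents of size `N` add up to `(-1)^N/N` times the `N`-th power
of the partial sum. For `N = 0` both sides use division by zero and vanish. -/
lemma sum_logTerm_exponentBox (A : ℕ → ℂ) (M : ℕ) :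
    ∑ k ∈ exponentBox M, logTerm A k =
      -Complex.logTaylor (M + 1) (∑ n ∈ Finset.range M, A n) := by
  rw [sum_exponentBox, Complex.logTaylor, ← Finset.sum_neg_distrib]
  refine Finset.sum_congr rfl fun N _ ↦ ?_
  have : ∀ k ∈ (Finset.range M).finsuppAntidiag N, logTerm A k =
      (-1) ^ N / N * (k.multinomial * k.prod fun n j ↦ A n ^ j) := fun k hk ↦ by
    rw [logTerm, degree_of_mem_finsuppAntidiag hk, mul_assoc]
  rw [Finset.sum_congr rfl this, ← Finset.mul_sum, sum_finsuppAntidiag_multinomial, pow_succ]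
  ring

lemma norm_logTerm_le (A : ℕ → ℂ) (k : ℕ →₀ ℕ) :
    ‖logTerm A k‖ ≤ k.multinomial * k.prod fun n j ↦ ‖A n‖ ^ j := by
  rw [logTerm, norm_mul, norm_mul, Finsupp.prod, norm_prod, Complex.norm_natCast, mul_assoc]
  simp only [norm_pow]
  refine mul_le_of_le_one_left (by positivity) ?_
  rw [norm_div, norm_pow, norm_neg, norm_one, one_pow, Complex.norm_natCast]
  rcases Nat.eq_zero_or_pos k.degree with h | h
  · simp [h]
  · exact div_le_one_of_le₀ (by exact_mod_cast h) (by positivity)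

/-- The multinomial theorem applied to `‖A n‖` bounds each finite sum by `∑ (1/2)^N ≤ 2`. -/
lemma summable_norm_logTerm {A : ℕ → ℂ} (hA : Summable fun n ↦ ‖A n‖)
    (hA' : ∑' n, ‖A n‖ ≤ 1 / 2) : Summable fun k ↦ ‖logTerm A k‖ := by
  refine summable_of_sum_le (c := 2) (fun _ ↦ norm_nonneg _) fun F ↦ ?_
  obtain ⟨M, hM⟩ := (tendsto_exponentBox.eventually (eventually_ge_atTop F)).exists
  calc ∑ k ∈ F, ‖logTerm A k‖ ≤ ∑ k ∈ exponentBox M, ‖logTerm A k‖ :=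
        Finset.sum_le_sum_of_subset_of_nonneg hM fun _ _ _ ↦ norm_nonneg _
    _ ≤ ∑ k ∈ exponentBox M, k.multinomial * k.prod fun n j ↦ ‖A n‖ ^ j :=
        Finset.sum_le_sum fun k _ ↦ norm_logTerm_le A k
    _ = ∑ N ∈ Finset.range (M + 1), (∑ n ∈ Finset.range M, ‖A n‖) ^ N := by
        rw [sum_exponentBox]
        exact Finset.sum_congr rfl fun N _ ↦ sum_finsuppAntidiag_multinomial _ _ N
    _ ≤ ∑ N ∈ Finset.range (M + 1), (1 / 2 : ℝ) ^ N := by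
        gcongr
        exact (hA.sum_le_tsum _ fun _ _ ↦ norm_nonneg _).trans hA'
    _ ≤ 2 := sum_geometric_two_le _

/-- Along the boxes the sum is a Taylor polynomial of growing degree at a moving point `z M`; since
`‖z M‖ ≤ 1/2`, the remainder is at most `2^{-M}`, and `log (1 + z M)` converges by continuity. -/
theorem hasSum_logTerm {A : ℕ → ℂ} (hA : Summable fun n ↦ ‖A n‖)
    (hA' : ∑' n, ‖A n‖ ≤ 1 / 2) : HasSum (logTerm A) (-Complex.log (1 + ∑' n, A n)) := by
  have hs := (summable_norm_logTerm hA hA').of_norm.hasSum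
  have h1 := hs.comp tendsto_exponentBox
  simp only [Function.comp_def, sum_logTerm_exponentBox] at h1
  set z : ℕ → ℂ := fun M ↦ ∑ n ∈ Finset.range M, A n with hz
  have hzle : ∀ M, ‖z M‖ ≤ 1 / 2 := fun M ↦ (norm_sum_le _ _).trans
    ((hA.sum_le_tsum _ fun _ _ ↦ norm_nonneg _).trans hA')
  have hzt : Tendsto z atTop (𝓝 (∑' n, A n)) := hA.of_norm.hasSum.tendsto_sum_nat
  have hle : ‖∑' n, A n‖ ≤ 1 / 2 := (norm_tsum_le_tsum_norm hA).trans hA'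
  have hlog : Tendsto (fun M ↦ Complex.log (1 + z M)) atTop
      (𝓝 (Complex.log (1 + ∑' n, A n))) :=
    (hzt.const_add 1).clog (Complex.mem_slitPlane_of_norm_lt_one (by linarith))
  have hdiff : Tendsto (fun M ↦ Complex.log (1 + z M) - Complex.logTaylor (M + 1) (z M)) atTop
      (𝓝 0) := by
    refine squeeze_zero_norm (a := fun M : ℕ ↦ (1 / 2 : ℝ) ^ M) (fun M ↦ ?_)
      (tendsto_pow_atTop_nhds_zero_of_lt_one (by norm_num) (by norm_num))
    have h2 := hzle M
    refine (Complex.norm_log_sub_logTaylor_le M (by linarith)).trans ?_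
    have h3 : (1 - ‖z M‖)⁻¹ ≤ 2 := by
      rw [inv_le_comm₀ (by linarith) two_pos]
      linarith
    have h3' : 0 ≤ (1 - ‖z M‖)⁻¹ := inv_nonneg.2 (by linarith)
    have h4 : ‖z M‖ ^ (M + 1) ≤ (1 / 2) ^ (M + 1) := by gcongr
    refine (div_le_self (by positivity) (by linarith [M.cast_nonneg (α := ℝ)])).trans ?_
    calc ‖z M‖ ^ (M + 1) * (1 - ‖z M‖)⁻¹ ≤ (1 / 2) ^ (M + 1) * 2 := by gcongr
      _ = (1 / 2 : ℝ) ^ M := by rw [pow_succ]; ring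
  have h5 := (hlog.sub hdiff).neg
  simp only [sub_sub_cancel, sub_zero] at h5
  rwa [tendsto_nhds_unique h1 h5] at hs

/-- The frequency `∑ λ_n k_n`. -/
def frequency (freq : ℕ → ℝ) (k : ℕ →₀ ℕ) : ℝ := k.sum fun n j ↦ freq n * j

lemma logTerm_mul_exp (a : ℕ → ℂ) (freq : ℕ → ℝ) (s : ℂ) (k : ℕ →₀ ℕ) :
    logTerm (fun n ↦ a n * Complex.exp (-freq n * s)) k =
      logTerm a k * Complex.exp (-frequency freq k * s) := by
  rw [logTerm, logTerm, mul_assoc (_ * _)]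
  congr 1
  simp only [Finsupp.prod, mul_pow, Finset.prod_mul_distrib, frequency, Finsupp.sum]
  congr 1
  push_cast
  rw [← Finset.sum_neg_distrib, Finset.sum_mul, Complex.exp_sum]
  refine Finset.prod_congr rfl fun n _ ↦ ?_
  rw [← Complex.exp_nat_mul]
  ring_nf

section Dirichlet

variable {f : ℂ → ℂ} {a : ℕ → ℂ} {freq : ℕ → ℝ} {c₀ : ℝ}

lemma IsDirichletSeries.frequency_nonneg (h : IsDirichletSeries f a freq) (k : ℕ →₀ ℕ) :
    0 ≤ frequency freq k :=
  Finset.sum_nonneg fun n _ ↦ mul_nonneg (h.freq_pos n).le (Nat.cast_nonneg _)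

lemma IsDirichletAbscissa.tsum_term_le (hc : IsDirichletAbscissa f a freq c₀)
    (h : IsDirichletSeries f a freq) {s : ℂ} (hs : c₀ ≤ s.re) :
    (Summable fun n ↦ ‖a n * Complex.exp (-freq n * s)‖) ∧
      ∑' n, ‖a n * Complex.exp (-freq n * s)‖ ≤ 1 / 2 := by
  have hle : ∀ n, ‖a n * Complex.exp (-freq n * s)‖ ≤ ‖a n‖ * Real.exp (-freq n * c₀) :=
    fun n ↦ by
      rw [norm_dirichlet_term]
      have := h.freq_pos n
      gcongr ‖a n‖ * Real.exp ?_
      nlinarith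
  have hsum := Summable.of_nonneg_of_le (fun _ ↦ norm_nonneg _) hle hc.summable
  exact ⟨hsum, (hsum.tsum_le_tsum hle hc.summable).trans hc.tsum_le⟩

lemma IsDirichletAbscissa.hasSum_log (hc : IsDirichletAbscissa f a freq c₀)
    (h : IsDirichletSeries f a freq) {s : ℂ} (hs : c₀ ≤ s.re) :
    HasSum (fun k ↦ logTerm a k * Complex.exp (-frequency freq k * s)) (-Complex.log (f s)) := by
  have h1 := hc.tsum_term_le h hs
  have h2 := hasSum_logTerm h1.1 h1.2
  rw [← hc.eq_series s hs] at h2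
  exact h2.congr_fun fun k ↦ (logTerm_mul_exp a freq s k).symm

lemma norm_logTerm_mul_exp (a : ℕ → ℂ) (freq : ℕ → ℝ) (k : ℕ →₀ ℕ) (s : ℂ) :
    ‖logTerm a k * Complex.exp (-frequency freq k * s)‖ =
      ‖logTerm a k‖ * Real.exp (-frequency freq k * s.re) := by
  rw [norm_mul, Complex.norm_exp]
  simp

lemma IsDirichletAbscissa.summable_norm_log (hc : IsDirichletAbscissa f a freq c₀)
    (h : IsDirichletSeries f a freq) :
    Summable fun k ↦ ‖logTerm a k‖ * Real.exp (-frequency freq k * c₀) := by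
  have h1 := hc.tsum_term_le h (s := (c₀ : ℂ)) (by simp)
  have h2 := summable_norm_logTerm h1.1 h1.2
  simpa only [logTerm_mul_exp, norm_logTerm_mul_exp, Complex.ofReal_re] using h2

/-- The factor `⟨λ,k⟩` is absorbed by moving to the right of `c₀`, because `x e^{-x(c-c₀)} ≤
(c-c₀)⁻¹`. -/
lemma IsDirichletAbscissa.summable_frequency_mul (hc : IsDirichletAbscissa f a freq c₀)
    (h : IsDirichletSeries f a freq) {c : ℝ} (hcc : c₀ < c) :
    Summable fun k ↦ frequency freq k * ‖logTerm a k‖ * Real.exp (-frequency freq k * c) := by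
  have hpos : 0 < c - c₀ := sub_pos.2 hcc
  refine Summable.of_nonneg_of_le (fun k ↦ ?_) (fun k ↦ ?_)
    ((hc.summable_norm_log h).mul_left (c - c₀)⁻¹)
  · have := h.frequency_nonneg k
    positivity
  · have h0 := h.frequency_nonneg k
    have h1 := Real.add_one_le_exp (frequency freq k * (c - c₀))
    have h2 : Real.exp (-frequency freq k * c) =
        (Real.exp (frequency freq k * (c - c₀)))⁻¹ * Real.exp (-frequency freq k * c₀) := by
      rw [← Real.exp_neg, ← Real.exp_add]
      ring_nf
    have h3 : frequency freq k * (Real.exp (frequency freq k * (c - c₀)))⁻¹ ≤ (c - c₀)⁻¹ := by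
      rw [← div_eq_mul_inv, ← one_div, div_le_div_iff₀ (Real.exp_pos _) hpos]
      linarith
    rw [h2]
    calc _ = frequency freq k * (Real.exp (frequency freq k * (c - c₀)))⁻¹ *
          (‖logTerm a k‖ * Real.exp (-frequency freq k * c₀)) := by ring
      _ ≤ _ := by gcongr

/-- Termwise differentiation of the expansion of `-log f`, which converges locally uniformly; `f`
stays in the slit plane since `‖f - 1‖ ≤ 1/2`. -/
theorem IsDirichletAbscissa.hasSum_logDeriv (hc : IsDirichletAbscissa f a freq c₀)
    (h : IsDirichletSeries f a freq) (hf : IsMeromorphic f) {s : ℂ} (hs : c₀ < s.re) :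
    HasSum (fun k ↦ frequency freq k * logTerm a k * Complex.exp (-frequency freq k * s))
      (logDeriv f s) := by
  have hopen : IsOpen {s : ℂ | c₀ < s.re} := isOpen_lt continuous_const Complex.continuous_re
  have hderiv : ∀ k (z : ℂ), HasDerivAt
      (fun z ↦ logTerm a k * Complex.exp (-frequency freq k * z))
      (-(frequency freq k * logTerm a k * Complex.exp (-frequency freq k * z))) z := fun k z ↦ by
    have := (((hasDerivAt_id z).const_mul (-frequency freq k : ℂ)).cexp).const_mul (logTerm a k)
    refine this.congr_deriv ?_
    simp only [id]
    ring
  have h1 := Complex.hasSum_deriv_of_summable_norm (hc.summable_norm_log h)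
    (F := fun k z ↦ logTerm a k * Complex.exp (-frequency freq k * z))
    (fun k ↦ (fun z _ ↦ (hderiv k z).differentiableAt.differentiableWithinAt)) hopen
    (fun k w hw ↦ ?_) hs
  swap
  · rw [norm_logTerm_mul_exp]
    have h2 := h.frequency_nonneg k
    have h3 : c₀ < w.re := hw
    gcongr ‖logTerm a k‖ * Real.exp ?_
    nlinarith
  have h4 : (fun w ↦ ∑' k, logTerm a k * Complex.exp (-frequency freq k * w)) =ᶠ[𝓝 s]
      fun w ↦ -Complex.log (f w) := by
    filter_upwards [hopen.mem_nhds hs] with w hw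
    exact (hc.hasSum_log h (le_of_lt hw)).tsum_eq
  have h5 : f s ∈ Complex.slitPlane := by
    have := Complex.mem_slitPlane_of_norm_lt_one (z := f s - 1)
      (by linarith [hc.norm_sub_one_le_half h hs.le])
    rwa [add_sub_cancel] at this
  have h6 := ((hc.analyticAt h hf hs.le).differentiableAt.hasDerivAt.clog h5).neg
  rw [h4.deriv_eq, show deriv (fun w ↦ -Complex.log (f w)) s = _ from h6.deriv] at h1
  simp only [(hderiv _ _).deriv] at h1
  simpa [logDeriv_apply] using h1.neg

/-- On the line, `e^{-⟨λ,k⟩s}` paired with the transform of `φ` returns `φ(⟨λ,k⟩)` by Fourier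
inversion; absolute convergence justifies summing under the integral. -/
theorem IsDirichletAbscissa.hasSum_invLaplace (hc : IsDirichletAbscissa f a freq c₀)
    (h : IsDirichletSeries f a freq) (hf : IsMeromorphic f) {m : ℕ} {c : ℝ} (hcc : c₀ < c)
    (hadm : LaplaceAdmissible (logDeriv f) m c) (φ : Test) :
    HasSum (fun k ↦ frequency freq k * logTerm a k * complexify φ (frequency freq k))
      (invLaplace (logDeriv f) m c φ) := by
  have hψ1 := contDiff_complexify φ
  have hψ2 := hasCompactSupport_complexify φ
  have hlap := continuous_laplace_vert hψ1 hψ2 c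
  have hvc := continuous_vert c
  have hre : ∀ u, c₀ < (vert c u).re := fun u ↦ by rwa [vert_re]
  have hnorm : ∀ k u, ‖frequency freq k * logTerm a k *
      Complex.exp (-frequency freq k * vert c u)‖ =
        frequency freq k * ‖logTerm a k‖ * Real.exp (-frequency freq k * c) := fun k u ↦ by
    rw [mul_assoc, norm_mul, norm_logTerm_mul_exp, vert_re, Complex.norm_real,
      Real.norm_of_nonneg (h.frequency_nonneg k), mul_assoc]
  rw [invLaplace_apply hadm]
  have hsum := hasSum_integral_of_norm_le (μ := volume)
    (F := fun k u ↦ frequency freq k * logTerm a k *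
      Complex.exp (-frequency freq k * vert c u) * laplace (complexify φ) (vert c u))
    (f := fun u ↦ logDeriv f (vert c u) * laplace (complexify φ) (vert c u))
    (g := fun u ↦ ‖laplace (complexify φ) (vert c u)‖)
    (fun k ↦ Continuous.aestronglyMeasurable (by fun_prop)) (hc.summable_frequency_mul h hcc)
    (integrable_laplace_vert hψ1 hψ2 c).norm
    (fun k ↦ .of_forall fun u ↦ by rw [norm_mul, hnorm]) (fun k hk ↦ ?_)
    (.of_forall fun u ↦ (hc.hasSum_logDeriv h hf (hre u)).mul_right _)
  swap
  · funext u
    have := hnorm k u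
    rw [hk, norm_eq_zero] at this
    simp only [this, zero_mul, Pi.zero_apply]
  refine (hsum.mul_left (1 / (2 * Real.pi) : ℂ)).congr_fun fun k ↦ ?_
  have h1 := integral_laplace_mul_exp hψ1 hψ2 c (frequency freq k)
  rw [← h1, mul_left_comm, ← integral_const_mul (_ * _)]
  congr 2 with u
  have h2 : -frequency freq k * vert c u = -vert c u * frequency freq k := by ring
  rw [h2]
  ring

end Dirichlet

/-! ### Locally finite sums of Dirac masses -/

lemma smul_dirac_apply (z : ℂ) (x : ℝ) (φ : Test) : (z • dirac x) φ = z * complexify φ x := by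
  rw [← dirac_apply]
  rfl

/-- Compact sets of test functions are uniformly small at a sequence of points tending to infinity,
to any prescribed order. -/
lemma exists_norm_mul_complexify_le {ι : Type*} {x : ι → ℝ}
    (hx : ∀ R : ℝ, {k | |x k| ≤ R}.Finite) (v : ι → ℂ) {S : Set Test} (hS : IsCompact S) :
    ∃ C : ℝ, ∀ φ ∈ S, ∀ k, ‖v k * complexify φ (x k)‖ ≤ C := by
  classical
  have hfin : ∀ K : Compacts ℝ, {k | x k ∈ (K : Set ℝ)}.Finite := fun K ↦ by
    obtain ⟨R, hR⟩ := K.isCompact.isBounded.exists_norm_le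
    exact (hx R).subset fun k hk ↦ hR _ hk
  have hmem : ∀ φ : Test, Memℓp (fun k ↦ v k * complexify φ (x k)) ⊤ := fun φ ↦ by
    refine (memℓp_zero ?_).of_exponent_ge bot_le
    refine (hfin ⟨tsupport φ, φ.hasCompactSupport⟩).subset fun k hk ↦ ?_
    refine subset_tsupport φ fun h0 ↦ hk ?_
    simp [complexify, h0]
  -- Sampling at the points `x k` with weights `v k` is a continuous linear map into `ℓ^∞`: for
  -- supports in a fixed compact set only finitely many coordinates are nonzero. A compact set of
  -- test functions then has bounded image.
  let Φ : Test →L[ℝ] lp (fun _ : ι ↦ ℂ) ⊤ := TestFunction.mkCLM ℝ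
    (fun φ ↦ ⟨fun k ↦ v k * complexify φ (x k), hmem φ⟩)
    (fun φ ψ ↦ by
      refine Subtype.ext (funext fun k ↦ ?_)
      change v k * ((φ (x k) + ψ (x k) : ℝ) : ℂ) =
        v k * complexify φ (x k) + v k * complexify ψ (x k)
      rw [complexify, complexify]
      push_cast
      ring)
    (fun c φ ↦ by
      refine Subtype.ext (funext fun k ↦ ?_)
      change v k * ((c * φ (x k) : ℝ) : ℂ) = c • (v k * complexify φ (x k))
      rw [complexify, Complex.real_smul]
      push_cast
      ring)
    (fun K hK ↦ by
      have hcont : Continuous fun g : 𝓓^{⊤}_{K}(ℝ, ℝ) ↦ ∑ k ∈ (hfin K).toFinset,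
          (TestFunction.ofSupportedIn hK g) (x k) • lp.single (E := fun _ : ι ↦ ℂ) ⊤ k (v k) := by
        refine continuous_finsetSum _ fun k _ ↦ Continuous.fun_smul ?_ continuous_const
        exact (continuous_eval_const (F := Test) (x k)).comp
          (TestFunction.continuous_ofSupportedIn hK)
      refine hcont.congr fun g ↦ Subtype.ext (funext fun j ↦ ?_)
      rw [lp.coeFn_sum, Finset.sum_apply]
      simp only [lp.coeFn_smul, Pi.smul_apply, lp.single_apply, Function.comp_apply]
      by_cases hj : x j ∈ (K : Set ℝ)
      · rw [Finset.sum_eq_single j]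
        · simp [complexify, mul_comm]
        · intro b _ hb
          rw [Pi.single_eq_of_ne hb.symm, smul_zero]
        · intro h
          exact absurd ((hfin K).mem_toFinset.2 hj) h
      · have h0 : (TestFunction.ofSupportedIn hK g) (x j) = 0 := g.zero_on_compl hj
        rw [complexify, h0, Finset.sum_eq_zero]
        · simp
        · intro b hb
          have : j ≠ b := by
            rintro rfl
            exact hj ((hfin K).mem_toFinset.1 hb)
          rw [Pi.single_eq_of_ne this, smul_zero])
  obtain ⟨C, hC⟩ := (hS.image Φ.continuous).isBounded.exists_norm_le
  exact ⟨C, fun φ hφ k ↦ (lp.norm_apply_le_norm (by simp) (Φ φ) k).trans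
    (hC _ (Set.mem_image_of_mem _ hφ))⟩

/-- Convergence of distributions means uniform convergence on compact sets of test functions.
Applying the preceding bound to the weights `w k / ε k`, with `ε` positive and summable, gives `‖w k
φ(x k)‖ ≤ C ε k` and hence the M-test, whatever the growth of `w`. -/
theorem hasSum_smul_dirac {ι : Type*} [Countable ι] {x : ι → ℝ}
    (hx : ∀ R : ℝ, {k | |x k| ≤ R}.Finite) (w : ι → ℂ) (T : Distr)
    (hT : ∀ φ : Test, HasSum (fun k ↦ w k * complexify φ (x k)) (T φ)) :
    HasSum (fun k ↦ w k • dirac (x k)) T := by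
  obtain ⟨_⟩ := nonempty_encodable ι
  obtain ⟨ε, hε, c, hc, -⟩ := posSumOfEncodable one_pos ι
  refine (UniformConvergenceCLM.tendsto_iff_tendstoUniformlyOn _ _ _).2 fun S hS ↦ ?_
  obtain ⟨C, hC⟩ := exists_norm_mul_complexify_le hx (fun k ↦ w k / ε k) (S := S) hS
  have h := tendstoUniformlyOn_tsum (s := S) (f := fun k (φ : Test) ↦ w k * complexify φ (x k))
    (hc.summable.mul_left C) fun k φ hφ ↦ by
      have h1 := hC φ hφ k
      have hpos := hε k
      rw [div_mul_eq_mul_div, norm_div, Complex.norm_real, Real.norm_of_nonneg hpos.le,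
        div_le_iff₀ hpos] at h1
      exact h1
  refine (h.congr (.of_forall fun F φ _ ↦ ?_)).congr_right fun φ _ ↦ (hT φ).tsum_eq
  simp only
  rw [sum_apply]
  exact Finset.sum_congr rfl fun k _ ↦ (smul_dirac_apply _ _ _).symm

/-! ### The index set -/

/-- The inclusion of the finitely supported sequences of natural numbers into those of integers. -/
def castIndex (k : ℕ →₀ ℕ) : ℕ →₀ ℤ := k.mapRange (fun j : ℕ ↦ (j : ℤ)) Nat.cast_zero

lemma castIndex_injective : Function.Injective castIndex :=
  Finsupp.mapRange_injective _ Nat.cast_zero Nat.cast_injective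

lemma castIndex_mem_Lam {k : ℕ →₀ ℕ} : castIndex k ∈ Lam ↔ k ≠ 0 := by
  have h0 : castIndex 0 = 0 := Finsupp.mapRange_zero
  refine ⟨fun h hk ↦ h.1 (by rw [hk, h0]), fun h ↦ ⟨fun hk ↦ h (castIndex_injective
    (hk.trans h0.symm)), fun n ↦ Int.natCast_nonneg _⟩⟩

lemma exists_castIndex_eq {k : ℕ →₀ ℤ} (hk : k ∈ Lam) : ∃ j, castIndex j = k := by
  refine ⟨k.mapRange Int.toNat Int.toNat_zero, ?_⟩
  ext n
  exact Int.toNat_of_nonneg (hk.2 n)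

lemma pairing_castIndex (freq : ℕ → ℝ) (k : ℕ →₀ ℕ) :
    pairing freq (castIndex k) = frequency freq k := by
  rw [pairing, castIndex, Finsupp.sum_mapRange_index (by simp)]
  rfl

lemma pairing_neg (freq : ℕ → ℝ) (k : ℕ →₀ ℤ) : pairing freq (-k) = -pairing freq k := by
  rw [pairing, pairing, Finsupp.sum_neg_index (by simp), Finsupp.sum, Finsupp.sum,
    ← Finset.sum_neg_distrib]
  simp

lemma absIndex_neg (k : ℕ →₀ ℤ) : absIndex (-k) = absIndex k := by
  ext n
  simp [absIndex]

lemma absIndex_of_mem_Lam {k : ℕ →₀ ℤ} (hk : k ∈ Lam) : absIndex k = k := by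
  ext n
  simp [absIndex, abs_of_nonneg (hk.2 n)]

lemma logCoeff_castIndex (a : ℕ → ℂ) (k : ℕ →₀ ℕ) : logCoeff a (castIndex k) = logTerm a k := by
  have h1 : ((castIndex k).sum fun _ j ↦ j.toNat) = k.degree := by
    rw [castIndex, Finsupp.sum_mapRange_index (by simp)]
    rfl
  have h2 : ((castIndex k).prod fun _ j ↦ (j.toNat.factorial : ℂ)) =
      k.prod fun _ j ↦ (j.factorial : ℂ) := by
    rw [castIndex, Finsupp.prod_mapRange_index (by simp)]
    rfl
  have h3 : ((castIndex k).prod fun n j ↦ a n ^ j.toNat) = k.prod fun n j ↦ a n ^ j := by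
    rw [castIndex, Finsupp.prod_mapRange_index (by simp)]
    rfl
  have h4 : (k.degree.factorial : ℂ) / (k.prod fun _ j ↦ (j.factorial : ℂ)) = k.multinomial := by
    have h5 : (k.prod fun _ j ↦ (j.factorial : ℂ)) ≠ 0 :=
      Finset.prod_ne_zero_iff.2 fun n _ ↦
      Nat.cast_ne_zero.2 (Nat.factorial_ne_zero _)
    rw [div_eq_iff h5, Finsupp.multinomial_eq, mul_comm, Finsupp.prod]
    have := Nat.multinomial_spec k.support k
    rw [Finsupp.degree_apply, ← this]
    push_cast
    rfl
  simp only [logCoeff]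
  rw [h1, h2, h3, h4, logTerm]

/-- `Λ` is the image of the nonzero natural exponents; dropping the zero exponent costs nothing
because its term vanishes. -/
lemma hasSum_Lam {g : (ℕ →₀ ℤ) → ℂ} {G : (ℕ →₀ ℕ) → ℂ} {s : ℂ} (hG : HasSum G s)
    (h0 : G 0 = 0) (h : ∀ k ≠ 0, g (castIndex k) = G k) :
    HasSum (g ∘ ((↑) : Lam → ℕ →₀ ℤ)) s := by
  rw [hasSum_subtype_iff_indicator, ← castIndex_injective.hasSum_iff]
  · convert! hG using 1
    funext k
    by_cases hk : k = 0
    · rw [hk, h0, Function.comp_apply, Set.indicator_of_notMem]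
      rw [castIndex_mem_Lam]
      exact fun h ↦ h rfl
    · rw [Function.comp_apply, Set.indicator_of_mem (castIndex_mem_Lam.2 hk), h k hk]
  · intro k hk
    exact Set.indicator_of_notMem (fun hmem ↦ hk (exists_castIndex_eq hmem)) _

lemma hasSum_neg_Lam {g : (ℕ →₀ ℤ) → ℂ} {G : (ℕ →₀ ℕ) → ℂ} {s : ℂ} (hG : HasSum G s)
    (h0 : G 0 = 0) (h : ∀ k ≠ 0, g (-castIndex k) = G k) :
    HasSum (g ∘ ((↑) : ↥(-Lam) → ℕ →₀ ℤ)) s := by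
  have h1 := hasSum_Lam (g := fun k ↦ g (-k)) hG h0 h
  rw [hasSum_subtype_iff_indicator] at h1 ⊢
  rw [← (Equiv.neg (ℕ →₀ ℤ)).hasSum_iff]
  convert! h1 using 1
  funext k
  have e : -k ∈ -Lam ↔ k ∈ Lam := by rw [Set.mem_neg, neg_neg]
  rw [Function.comp_apply, Equiv.neg_apply]
  by_cases hk : k ∈ Lam
  · rw [Set.indicator_of_mem (e.2 hk), Set.indicator_of_mem hk]
  · rw [Set.indicator_of_notMem (mt e.1 hk), Set.indicator_of_notMem hk]

lemma disjoint_Lam_neg : Disjoint Lam (-Lam) := by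
  refine Set.disjoint_left.2 fun k hk hk' ↦ hk.1 ?_
  ext n
  have h1 := hk.2 n
  have h2 := hk'.2 n
  rw [Finsupp.neg_apply] at h2
  simp only [Finsupp.coe_zero, Pi.zero_apply]
  omega

/-- A frequency at most `R` bounds the size of `k` by `R/λ_0` and confines its support to the
finitely many `n` with `λ_n ≤ R`. -/
lemma IsDirichletSeries.finite_frequency_le {f : ℂ → ℂ} {a : ℕ → ℂ} {freq : ℕ → ℝ}
    (h : IsDirichletSeries f a freq) (R : ℝ) : {k | frequency freq k ≤ R}.Finite := by
  obtain ⟨M, hM⟩ := eventually_atTop.1 (h.freq_tendsto.eventually_gt_atTop R)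
  obtain ⟨M', hM'⟩ := exists_nat_ge (R / freq 0)
  refine (exponentBox (max M M')).finite_toSet.subset fun k hk ↦ mem_exponentBox.2 ⟨?_, ?_⟩
  · have h1 : freq 0 * k.degree ≤ R := by
      refine le_trans ?_ (Set.mem_ofPred_eq.mp hk : frequency freq k ≤ R)
      rw [Finsupp.degree_apply, frequency, Finsupp.sum]
      push_cast
      rw [Finset.mul_sum]
      refine Finset.sum_le_sum fun n _ ↦ ?_
      have := h.freq_strictMono.monotone (Nat.zero_le n)
      gcongr
    have h2 : (k.degree : ℝ) ≤ M' := by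
      refine le_trans ?_ hM'
      rwa [le_div_iff₀' (h.freq_pos 0)]
    exact le_trans (by exact_mod_cast h2) (le_max_right _ _)
  · intro n hn
    rw [Finset.mem_range]
    refine lt_of_lt_of_le ?_ (le_max_left _ _)
    by_contra hle
    have h1 := hM n (not_lt.1 hle)
    have h2 : freq n * k n ≤ frequency freq k :=
      Finset.single_le_sum (f := fun n ↦ freq n * (k n : ℝ))
        (fun i _ ↦ mul_nonneg (h.freq_pos i).le (Nat.cast_nonneg _)) hn
    have h3 : (1 : ℝ) ≤ k n := by
      exact_mod_cast Nat.one_le_iff_ne_zero.2 (Finsupp.mem_support_iff.1 hn)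
    have h4 : frequency freq k ≤ R := hk
    nlinarith [h.freq_pos n]

lemma IsDirichletSeries.finite_abs_pairing_le {f : ℂ → ℂ} {a : ℕ → ℂ} {freq : ℕ → ℝ}
    (h : IsDirichletSeries f a freq) (R : ℝ) :
    {k : ↥(Lam ∪ -Lam) | |pairing freq k| ≤ R}.Finite := by
  have h1 := (h.finite_frequency_le R).image castIndex
  refine Set.Finite.of_finite_image ?_ (Subtype.val_injective.injOn)
  refine (h1.union h1.neg).subset ?_
  rintro _ ⟨⟨k, hk⟩, hkR, rfl⟩
  have hkR : |pairing freq k| ≤ R := hkR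
  rcases hk with hk | hk
  · obtain ⟨j, rfl⟩ := exists_castIndex_eq hk
    refine .inl ⟨j, ?_, rfl⟩
    replace hkR : |pairing freq (castIndex j)| ≤ R := hkR
    rw [pairing_castIndex] at hkR
    exact (le_abs_self _).trans hkR
  · obtain ⟨j, hj⟩ := exists_castIndex_eq hk
    refine .inr ⟨j, ?_, hj⟩
    replace hkR : |pairing freq k| ≤ R := hkR
    rw [← abs_neg, ← pairing_neg, ← hj, pairing_castIndex] at hkR
    exact (le_abs_self _).trans hkR

/-! ### The Poisson–Newton formula for Dirichlet series -/

/-- `Λ` carries the inverse Laplace transform, `-Λ` its reflection, and the two sets are disjoint.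
-/
theorem hasSum_dirac_invLaplace {f : ℂ → ℂ} {a : ℕ → ℂ} {freq : ℕ → ℝ} {c₀ : ℝ}
    (hc : IsDirichletAbscissa f a freq c₀) (h : IsDirichletSeries f a freq)
    (hf : IsMeromorphic f) {m : ℕ} {c : ℝ} (hcc : c₀ < c)
    (hadm : LaplaceAdmissible (logDeriv f) m c) :
    HasSum (fun k : ↥(Lam ∪ -Lam) ↦
        (pairing freq (absIndex k) * logCoeff a (absIndex k)) • dirac (pairing freq k))
      (invLaplace (logDeriv f) m c + reflect (invLaplace (logDeriv f) m c)) := by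
  refine hasSum_smul_dirac (x := fun k : ↥(Lam ∪ -Lam) ↦ pairing freq k)
    (h.finite_abs_pairing_le) _ _ fun φ ↦ ?_
  have h0 : frequency freq 0 = 0 := Finsupp.sum_zero_index
  change HasSum _ (invLaplace (logDeriv f) m c φ + invLaplace (logDeriv f) m c (testReflect φ))
  refine HasSum.add_disjoint (f := fun k : ℕ →₀ ℤ ↦ pairing freq (absIndex k) *
    logCoeff a (absIndex k) * complexify φ (pairing freq k)) disjoint_Lam_neg ?_ ?_
  · refine hasSum_Lam (hc.hasSum_invLaplace h hf hcc hadm φ) (by simp [h0]) fun k hk ↦ ?_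
    rw [absIndex_of_mem_Lam (castIndex_mem_Lam.2 hk), pairing_castIndex, logCoeff_castIndex]
  · refine hasSum_neg_Lam (hc.hasSum_invLaplace h hf hcc hadm (testReflect φ)) (by simp [h0])
      fun k hk ↦ ?_
    rw [absIndex_neg, absIndex_of_mem_Lam (castIndex_mem_Lam.2 hk), pairing_neg,
      pairing_castIndex, logCoeff_castIndex]
    rfl

lemma LaplaceAdmissible.mono {F : ℂ → ℂ} {m : ℕ} {c c' : ℝ} (h : LaplaceAdmissible F m c)
    (hcc : c ≤ c') : LaplaceAdmissible F m c' := by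
  obtain ⟨σ₂, C, h0, h1, h2⟩ := h
  exact ⟨σ₂, C, h0, h1.trans_le hcc, h2⟩

theorem poissonNewton_dirichlet {f : ℂ → ℂ} {a : ℕ → ℂ} {freq : ℕ → ℝ} (hf : IsMeromorphic f)
    (hfo : HasFiniteOrder f) (h : IsDirichletSeries f a freq) :
    (∀ τ : ℂ, IsHadamardPolynomial f τ (hadamardPolynomial f τ)) ∧
    Summable (fun k : ↥(Lam ∪ -Lam) ↦
      (pairing freq (absIndex k) * logCoeff a (absIndex k)) • dirac (pairing freq k)) ∧
    ∀ σ : ℂ,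
      symNewtonCramer f σ =
        (2 : ℂ) • ∑ l ∈ Finset.range ((genus f + 1) / 2),
          (discrepancyPolynomial f σ).coeff (2 * l) • distDeriv (2 * l) (dirac 0) +
        ∑' k : ↥(Lam ∪ -Lam),
          (pairing freq (absIndex k) * logCoeff a (absIndex k)) •
            dirac (pairing freq k) := by
  obtain ⟨c₀, hc⟩ := h.exists_abscissa
  have hd := hc.one_le_convExponent h hf hfo
  have hl := hc.divisorInLeftHalfPlane h hf
  obtain ⟨h1, ⟨m, c, hadm⟩, h2⟩ := poissonNewton_general hf hfo hd hl
  -- The abscissa is increased beyond `c₀`, so that the Dirichlet expansion is available on the line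
  -- of integration.
  have hadm' := hadm.mono (le_max_left c (c₀ + 1))
  have hsum := hasSum_dirac_invLaplace hc h hf
    ((lt_add_one c₀).trans_le (le_max_right c (c₀ + 1))) hadm'
  refine ⟨h1, hsum.summable, fun σ ↦ ?_⟩
  rw [h2 σ _ _ hadm', hsum.tsum_eq]

end

end PoissonNewton

theorem mainTheorem3 :
    (∀ f : ℂ → ℂ, IsMeromorphic f → HasFiniteOrder f → 1 ≤ convExponent f →
      DivisorInLeftHalfPlane f →
      (∀ τ : ℂ, IsHadamardPolynomial f τ (hadamardPolynomial f τ)) ∧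
      (∃ (m : ℕ) (c : ℝ), LaplaceAdmissible (logDeriv f) m c) ∧
      ∀ (σ : ℂ) (m : ℕ) (c : ℝ), LaplaceAdmissible (logDeriv f) m c →
        symNewtonCramer f σ =
          (2 : ℂ) • ∑ l ∈ Finset.range ((genus f + 1) / 2),
            (discrepancyPolynomial f σ).coeff (2 * l) • distDeriv (2 * l) (dirac 0) +
          (invLaplace (logDeriv f) m c + reflect (invLaplace (logDeriv f) m c))) ∧
    (∀ (f : ℂ → ℂ) (a : ℕ → ℂ) (freq : ℕ → ℝ), IsMeromorphic f → HasFiniteOrder f →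
      IsDirichletSeries f a freq →
      (∀ τ : ℂ, IsHadamardPolynomial f τ (hadamardPolynomial f τ)) ∧
      Summable (fun k : ↥(Lam ∪ -Lam) ↦
        (pairing freq (absIndex k) * logCoeff a (absIndex k)) • dirac (pairing freq k)) ∧
      ∀ σ : ℂ,
        symNewtonCramer f σ =
          (2 : ℂ) • ∑ l ∈ Finset.range ((genus f + 1) / 2),
            (discrepancyPolynomial f σ).coeff (2 * l) • distDeriv (2 * l) (dirac 0) +
          ∑' k : ↥(Lam ∪ -Lam),
            (pairing freq (absIndex k) * logCoeff a (absIndex k)) •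
              dirac (pairing freq k)) := by
  exact ⟨fun f hf hfo hd hl ↦ poissonNewton_general hf hfo hd hl,
    fun f a freq hf hfo h ↦ poissonNewton_dirichlet hf hfo h⟩
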